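/- Let $n\ge 1$, let $\Omega\subset\mathbb{RP}^n$ be a proper convex domain, i.e. the image in $\mathbb{RP}^n$ of the interior $K_\Omega^o$ of a closed convex cone $K_\Omega\subset\mathbb R^{n+1}$ that contains no line and has nonempty interior. Let $f:\Omega\to K_\Omega^o$ be a lift of class $C^3$ (each $f(p)$ represents $p$). The decomposition $D_X(f_*Y)=f_*(\nabla_XY)+h(X,Y)\,f$ of the flat connection $D$ of $\mathbb R^{n+1}$ defines the induced connection $\nabla$ and the centro-affine form $h$ on $\Omega$; assume that $f$ is convex and non-degenerate of hyperbolic type, i.e. that $h$ is positive definite. Let $C=\nabla h$ be the cubic form, and assume that for some constant $\gamma>0$ $$C(X,X,X)\le 2\gamma\,h(X,X)^{3/2}$$ for all tangent vectors $X$ of $\Omega$. Let $d^R$ be the geodesic distance of the Riemannian metric $h$, let $l^R(a,b)$ be the Riemannian length of the projective line segment in $\Omega$ joining $a,b\in\Omega$, and let $d^H(a,b)=\frac12\log\frac{\|ya\|\,\|xb\|}{\|yb\|\,\|xa\|}$ be the Hilbert distance, where $x,y\in\partial\Omega$ lie on the projective line through $a,b$ in the order $x,a,b,y$ and the lengths are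 measured in any affine chart of this line. Put $\mu=\frac\gamma2+\sqrt{1+\frac{\gamma^2}4}$ and, for $d>0$ and $E=e^d$, $$\beta(d)=\begin{cases}\dfrac{2\mu}{\mu^2+1}\log\dfrac{(\mu^2+1)(E-1)+2}{2}, & d\le\log\dfrac{\mu^2+1}{\mu^2-1},\\[2ex] \log\dfrac{(\mu-1)(\sqrt{E+1}+\sqrt{E-1})}{(\mu+1)(\sqrt{E+1}-\sqrt{E-1})}+\dfrac{2\mu}{\mu^2+1}\log\dfrac{2\mu^2}{\mu^2-1}, & d\ge\log\dfrac{\mu^2+1}{\mu^2-1},\end{cases}$$ $$c=\log 2-\log\frac{\mu+1}{\mu-1}+\frac{2\mu}{\mu^2+1}\log\frac{2\mu^2}{\mu^2-1}.$$ Then for all distinct points $a,b\in\Omega$ $$d^R(a,b)\le l^R(a,b)<\beta\bigl(d^H(a,b)\bigr)<d^H(a,b)+c.$$ The inequalities cannot be improved: for all $n\ge1$, $\gamma>0$, $d>0$ and $\varepsilon>0$ there are $\Omega$, $f$ as above, with the cubic form bounded as above, and distinct points $a,b\in\Omega$ such that $d^H(a,b)=d$, $d^R(a,b)=l^R(a,b)$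 and $l^R(a,b)>\beta(d)-\varepsilon$; moreover $\beta(d)-d\to c$ as $d\to\infty$. -/

import Mathlib

open Set Filter Topology MeasureTheory
open scoped LinearAlgebra.Projectivization

noncomputable section

namespace CentroAffine

variable {V : Type*} [NormedAddCommGroup V] [NormedSpace ℝ V]

/-- The vector `v` is a vector of homogeneous coordinates of the projective point `p`. -/
def Represents (v : V) (p : ℙ ℝ V) : Prop :=
  ∃ hv : v ≠ 0, Projectivization.mk ℝ v hv = p

/-- `Ω` is a proper (properly) convex domain in the projective space of `V`, and `K` is the closed
convex cone over its closure: `K` is a closed convex cone which contains no line and has nonempty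
interior, and `Ω` is the set of projective points represented by interior vectors of `K`.
(The cone of a given `Ω` is unique up to replacing `K` by `-K`.) -/
structure IsProperConvexDomain (Ω : Set (ℙ ℝ V)) (K : ProperCone ℝ V) : Prop where
  salient : (K.toPointedCone : ConvexCone ℝ V).Salient
  interior_nonempty : (interior (K : Set V)).Nonempty
  mem_iff : ∀ p : ℙ ℝ V, p ∈ Ω ↔ ∃ v ∈ interior (K : Set V), Represents v p

/-! ### The Hilbert distance -/

/-- The Hilbert distance of the domain with cone `K`. For `a ≠ b` it is the number
`(1/2) log (‖ya‖‖xb‖ / (‖yb‖‖xa‖))`, where `x, y` are the boundary points on the projective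
line through `a, b`, in the order `x, a, b, y`. The coordinate differences are measured in the
affine chart of that line given by an affine line in `V` which misses the origin and on which
`X, A, B, Y` represent `x, a, b, y`; the result does not depend on this chart. -/
def hilbertDist (K : ProperCone ℝ V) (a b : ℙ ℝ V) : ℝ :=
  open Classical in
  if a = b then 0 else
    Classical.epsilon fun d : ℝ =>
      ∃ X Y A B : V, ∃ s t : ℝ,
        X ∈ frontier (K : Set V) ∧ X ≠ 0 ∧ Y ∈ frontier (K : Set V) ∧ Y ≠ 0 ∧
        0 < s ∧ s < t ∧ t < 1 ∧
        A = AffineMap.lineMap X Y s ∧ B = AffineMap.lineMap X Y t ∧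
        Represents A a ∧ Represents B b ∧
        d = 1 / 2 * Real.log ((dist Y A * dist X B) / (dist Y B * dist X A))

/-! ### Centro-affine geometry of a lift

A map `f` defined on projective points is studied through its expression `pullback f` in
homogeneous coordinates, i.e. its composition with the quotient map `π : V \ {0} → ℙ ℝ V`. As `π` is
a surjective submersion, `f` is of class `C^k` on `Ω` iff `pullback f` is so on the open cone over
`Ω`. A vector `w : V` at a point `v` of that cone stands for the tangent vector `dπ_v(w)` of `Ω` at
`[v]`; every tangent vector is of this form, and `w` is unique modulo `ℝ v`. -/

/-- The map `f` in homogeneous coordinates. -/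
def pullback (f : ℙ ℝ V → V) (v : V) : V :=
  open Classical in
  if hv : v ≠ 0 then f (Projectivization.mk ℝ v hv) else 0

/-- `D_X (f_* Y)`, the flat derivative of the ambient space, for the vector fields `X, Y` which are
represented by the constant vectors `w, w'`. -/
def flatDeriv (f : ℙ ℝ V → V) (v w w' : V) : V :=
  fderiv ℝ (fun u => fderiv ℝ (pullback f) u w') v w

/-- The centro-affine fundamental form `h(X, Y)` at `[v]`: the transversal coefficient in the
decomposition `D_X (f_* Y) = f_* (∇_X Y) + h(X, Y) f`, where the transversal vector
field is the position vector. -/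
def metric (f : ℙ ℝ V → V) (v w w' : V) : ℝ :=
  Classical.epsilon fun c : ℝ =>
    ∃ z : V, flatDeriv f v w w' = fderiv ℝ (pullback f) v z + c • pullback f v

/-- The induced affine connection: a vector representing `∇_X Y` in the decomposition
`D_X (f_* Y) = f_* (∇_X Y) + h(X, Y) f`. -/
def connection (f : ℙ ℝ V → V) (v w w' : V) : V :=
  Classical.epsilon fun z : V =>
    flatDeriv f v w w' = fderiv ℝ (pullback f) v z + metric f v w w' • pullback f v

/-- The cubic form `C = ∇ h` on the diagonal:
`C(X, X, X) = X (h(X, X)) - 2 h(∇_X X, X)`. -/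
def cubicForm (f : ℙ ℝ V → V) (v w : V) : ℝ :=
  fderiv ℝ (fun u => metric f u w w) v w - 2 * metric f v (connection f v w w) w

/-- `f` is a lift of class `C^3` of `Ω` into the interior of the cone `K` over `Ω` which is convex
and non-degenerate, of hyperbolic type: its centro-affine form `h` is positive definite on the
tangent spaces of `Ω`. -/
structure IsConvexLift (Ω : Set (ℙ ℝ V)) (K : ProperCone ℝ V) (f : ℙ ℝ V → V) : Prop where
  mem_interior : ∀ p ∈ Ω, f p ∈ interior (K : Set V)
  represents : ∀ p ∈ Ω, Represents (f p) p
  contDiffOn : ContDiffOn ℝ 3 (pullback f) (interior (K : Set V))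
  metric_pos : ∀ v ∈ interior (K : Set V), ∀ w : V, w ∉ Submodule.span ℝ {v} → 0 < metric f v w w

/-- The bound `C(X, X, X) ≤ 2 γ h(X, X)^(3/2)` for all tangent vectors `X` of the domain. -/
def CubicFormBound (K : ProperCone ℝ V) (f : ℙ ℝ V → V) (γ : ℝ) : Prop :=
  ∀ v ∈ interior (K : Set V), ∀ w : V,
    cubicForm f v w ≤ 2 * γ * (metric f v w w) ^ (3 / 2 : ℝ)

/-! ### Riemannian length and geodesic distance -/

/-- The Riemannian length of the projection to the domain of the curve `c : [0, 1] → V`. -/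
def curveLength (f : ℙ ℝ V → V) (c : ℝ → V) : ℝ :=
  ∫ t in (0 : ℝ)..1, Real.sqrt (metric f (c t) (deriv c t) (deriv c t))

/-- `l^R(a, b)`: the Riemannian length of the projective line segment in the domain
joining `a` and `b`. -/
def segmentLength (f : ℙ ℝ V → V) (a b : ℙ ℝ V) : ℝ :=
  curveLength f fun t => AffineMap.lineMap (f a) (f b) t

/-- `d^R(a, b)`: the infimum of the Riemannian lengths of `C^1` curves from `a` to `b` in the
domain. The curves are given in homogeneous coordinates (any `C^1` curve in the domain
lifts to the open cone, with prescribed representatives at both ends). -/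
def geodesicDist (K : ProperCone ℝ V) (f : ℙ ℝ V → V) (a b : ℙ ℝ V) : ℝ :=
  sInf {L : ℝ | ∃ c : ℝ → V, ContDiff ℝ 1 c ∧ (∀ t ∈ Icc (0 : ℝ) 1, c t ∈ interior (K : Set V)) ∧
    c 0 = f a ∧ c 1 = f b ∧ L = curveLength f c}

end CentroAffine

/-! ### The bounds -/

/-- `μ = γ/2 + √(1 + γ²/4)`. -/
def muOf (γ : ℝ) : ℝ := γ / 2 + Real.sqrt (1 + γ ^ 2 / 4)

/-- The upper bound on the length of a segment as a function of `μ` and the Hilbert distance `d`,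
with `E = exp d`. (Both expressions agree at the switch.) -/
def lengthBound (μ d : ℝ) : ℝ :=
  if d ≤ Real.log ((μ ^ 2 + 1) / (μ ^ 2 - 1)) then
    2 * μ / (μ ^ 2 + 1) * Real.log (((μ ^ 2 + 1) * (Real.exp d - 1) + 2) / 2)
  else
    Real.log (((μ - 1) * (Real.sqrt (Real.exp d + 1) + Real.sqrt (Real.exp d - 1))) /
        ((μ + 1) * (Real.sqrt (Real.exp d + 1) - Real.sqrt (Real.exp d - 1))))
      + 2 * μ / (μ ^ 2 + 1) * Real.log (2 * μ ^ 2 / (μ ^ 2 - 1))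

/-- The additive constant in the bound which is linear in the Hilbert distance. -/
def additiveConst (μ : ℝ) : ℝ :=
  Real.log 2 - Real.log ((μ + 1) / (μ - 1))
    + 2 * μ / (μ ^ 2 + 1) * Real.log (2 * μ ^ 2 / (μ ^ 2 - 1))

end

/-! In homogeneous coordinates the lift is `exp G` times the position vector, with `G`
logarithmically homogeneous, and `h` is `D²G - dG ⊗ dG`. Let `X`, `Y` be the boundary points of the
line through `a`, `b`. On the curve `exp (-t) X + exp t Y`, whose parameter is Hilbert arc length,
let `p` be the derivative of `G` and `q` the speed for `h`. Then `p' = p² + q² - 1` and `q' = 2pq +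
uq²`, where `u = C / (2q³)` and so `|u| ≤ γ = μ - 1/μ`. The length of the segment is the integral of
`q` over an interval of length `d^H(a, b)`, and the task is to maximize this integral.

Trajectories exist for all times, and this is the decisive constraint: `ρ = p + q/μ - 1` satisfies
`ρ' ≥ ρ² + 2ρ`, so a positive value would blow up in finite time. Hence `p + q/μ ≤ 1`, and `-p + q/μ
≤ 1` by time reversal. For the upper bound the equation of `q` is then dropped: `q` is treated as a
control for `p` under this state constraint alone. The Lagrangian `q + l (p² + q² - 1) + ν (1 - p -
q/μ)` is concave for `l ≤ 0`, so a reference arc satisfying the Pontryagin conditions with `l ≤ 0 ≤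
ν` is optimal (`integral_sub_le_of_calibration`). The interval is centred at 0 and each half treated
separately. For small `d` the extremal starts at the tip `(0, μ)` and follows the edge `p + q/μ =
1`; for large `d` it first follows a singular arc with `u = 0`. No trajectory contains either
extremal, whence strictness (`integral_symm_lt_lengthBound`).

For sharpness, the extremal for some `μ' < μ` is a trajectory with jumping control. Averaging over
short windows makes it smooth, the gap `μ - μ'` absorbing the errors (`exists_isProfile`). The
resulting `p` defines a lift over the quadratic cone `‖z‖² < x y`, invariant under the parabolic
automorphisms fixing a boundary point. Its metric is a sum of a multiple of `d(height)²` and a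
nonnegative transversal part, so the plane segment minimizes length (`geodesicDist_planePoint`). The
cubic form is bounded in all directions if `q / (1 + p)` stays between `1/μ` and `μ`
(`cubic_le_all`), which the extremals respect. -/

/-! ### The control system along a line and its viability constraint. -/

/-- A global solution with `|u| ≤ γ` of the control system which the centro-affine metric and its
logarithmic derivative satisfy along a projective line, in the Hilbert arc length. -/
structure IsTrajectory (γ : ℝ) (p q : ℝ → ℝ) : Prop where
  pos : ∀ t, 0 < q t
  hasDerivAt_fst : ∀ t, HasDerivAt p (p t ^ 2 + q t ^ 2 - 1) t
  hasDerivAt_snd : ∀ t, ∃ u, |u| ≤ γ ∧ HasDerivAt q (2 * p t * q t + u * q t ^ 2) t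

/-- A function with `ρ' ≥ ρ² + 2ρ` on the whole real line is nowhere positive. -/
theorem nonpos_of_sq_add_le_deriv {ρ ρ' : ℝ → ℝ} (h : ∀ t, HasDerivAt ρ (ρ' t) t)
    (h' : ∀ t, ρ t ^ 2 + 2 * ρ t ≤ ρ' t) (t₀ : ℝ) : ρ t₀ ≤ 0 := by
  by_contra! hpos
  -- `1 / (c - t)` is the solution of `y' = y²` through `(t₀, ρ t₀)`. It blows up at `c` and serves
  -- as a barrier from below.
  set c := t₀ + 1 / ρ t₀ with hc
  have hcont : Continuous ρ := continuous_iff_continuousAt.2 fun t => (h t).continuousAt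
  have key : ∀ t ∈ Ico t₀ c, 1 / (c - t) ≤ ρ t := by
    intro t ht
    have hsub : ∀ x ∈ Icc t₀ t, 0 < c - x := fun x hx => by linarith [hx.2, ht.2]
    have hd : ∀ x ∈ Icc t₀ t, HasDerivAt (fun x => 1 / (c - x)) (1 / (c - x) ^ 2) x := by
      intro x hx
      have h1 : HasDerivAt (fun x => c - x) (-1) x := by
        simpa using (hasDerivAt_id x).const_sub c
      have h2 := h1.fun_inv (hsub x hx).ne'
      simp only [one_div]
      exact h2.congr_deriv (by simp)
    refine image_le_of_deriv_right_lt_deriv_boundary' (f := fun x => 1 / (c - x))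
      (f' := fun x => 1 / (c - x) ^ 2) (a := t₀) (b := t) (B := ρ) (B' := ρ')
      (fun x hx => (hd x hx).continuousAt.continuousWithinAt)
      (fun x hx => (hd x ⟨hx.1, hx.2.le⟩).hasDerivWithinAt) ?_ hcont.continuousOn
      (fun x hx => (h x).hasDerivWithinAt) ?_ ⟨ht.1, le_rfl⟩
    · have : c - t₀ = 1 / ρ t₀ := by rw [hc]; ring
      simp only [this, one_div_one_div, le_refl]
    · intro x hx hxe
      have h3 := hsub x ⟨hx.1, hx.2.le⟩
      have h4 : 0 < 1 / (c - x) := by positivity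
      have h5 := h' x
      have h6 : 1 / (c - x) ^ 2 = (1 / (c - x)) ^ 2 := by rw [div_pow, one_pow]
      rw [h6]
      change 1 / (c - x) = ρ x at hxe
      rw [hxe] at h4 ⊢
      linarith
  have htc : t₀ < c := by rw [hc]; have : 0 < 1 / ρ t₀ := by positivity
                          linarith
  obtain ⟨M, hM⟩ := (isCompact_Icc (a := t₀) (b := c)).bddAbove_image hcont.continuousOn
  have hM' : ∀ t ∈ Icc t₀ c, ρ t ≤ M := fun t ht => hM ⟨t, ht, rfl⟩
  have hM0 : 0 < M := hpos.trans_le (hM' t₀ ⟨le_rfl, htc.le⟩)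
  -- At this time the barrier is at least `2 * M`, twice the bound for `ρ` on `[t₀, c]`.
  have h1 : max t₀ (c - 1 / (2 * M)) ∈ Ico t₀ c := by
    refine ⟨le_max_left _ _, max_lt htc ?_⟩
    have : 0 < 1 / (2 * M) := by positivity
    linarith
  have h2 := key _ h1
  have h3 := hM' _ ⟨h1.1, h1.2.le⟩
  have h4 : c - max t₀ (c - 1 / (2 * M)) ≤ 1 / (2 * M) := by
    linarith [le_max_right t₀ (c - 1 / (2 * M))]
  have h5 : 0 < c - max t₀ (c - 1 / (2 * M)) := by linarith [h1.2]
  have h6 : 2 * M ≤ 1 / (c - max t₀ (c - 1 / (2 * M))) := by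
    rw [le_div_iff₀ h5]
    calc _ ≤ 2 * M * (1 / (2 * M)) := by gcongr
      _ = 1 := by field_simp
  linarith

namespace IsTrajectory

variable {γ μ : ℝ} {p q : ℝ → ℝ}

/-- Time reversal exchanges the two boundary points of the line. It turns every statement about the
edge `p + q/μ = 1` into one about the opposite edge, and every bound on `[0, T]` into one on `[-T,
0]`. -/
theorem reverse (h : IsTrajectory γ p q) : IsTrajectory γ (fun t => -p (-t)) (fun t => q (-t)) where
  pos t := h.pos _
  hasDerivAt_fst t := by
    have := ((h.hasDerivAt_fst (-t)).scomp t (hasDerivAt_neg t)).neg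
    exact this.congr_deriv (by simp)
  hasDerivAt_snd t := by
    obtain ⟨u, hu, hd⟩ := h.hasDerivAt_snd (-t)
    refine ⟨-u, by rwa [abs_neg], ?_⟩
    have := hd.scomp t (hasDerivAt_neg t)
    exact this.congr_deriv (by simp; ring)

theorem shift (h : IsTrajectory γ p q) (c : ℝ) :
    IsTrajectory γ (fun t => p (t + c)) (fun t => q (t + c)) where
  pos t := h.pos _
  hasDerivAt_fst t := (h.hasDerivAt_fst (t + c)).comp_add_const t c
  hasDerivAt_snd t := by
    obtain ⟨u, hu, hd⟩ := h.hasDerivAt_snd (t + c)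
    exact ⟨u, hu, hd.comp_add_const t c⟩

theorem continuous_snd (h : IsTrajectory γ p q) : Continuous q :=
  continuous_iff_continuousAt.2 fun t => by
    obtain ⟨u, -, hd⟩ := h.hasDerivAt_snd t
    exact hd.continuousAt

/-- The viability constraint: trajectories are defined for all times. -/
theorem add_div_le (h : IsTrajectory (μ - 1 / μ) p q) (hμ : 1 < μ) (t : ℝ) :
    p t + q t / μ ≤ 1 := by
  choose u hu hd using h.hasDerivAt_snd
  have := nonpos_of_sq_add_le_deriv (ρ := fun t => p t + q t / μ - 1)
    (fun t => ((h.hasDerivAt_fst t).fun_add ((hd t).div_const μ)).sub_const 1) (fun t => ?_) t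
  · linarith
  -- The worst control is `u = -γ`. For it the differential inequality is an equality, which is what
  -- singles out the slope `1/μ` with `γ = μ - 1/μ`.
  · have h1 : -(μ - 1 / μ) * q t ^ 2 ≤ u t * q t ^ 2 := by
      have := (abs_le.1 (hu t)).1
      gcongr
    have h2 : (-(μ - 1 / μ) * q t ^ 2) / μ ≤ u t * q t ^ 2 / μ := by
      have : 0 < μ := by linarith
      gcongr
    have h3 : (p t + q t / μ - 1) ^ 2 + 2 * (p t + q t / μ - 1) =
      p t ^ 2 + q t ^ 2 - 1 + (2 * p t * q t / μ + (-(μ - 1 / μ) * q t ^ 2) / μ) := by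
      field_simp
      ring
    rw [h3, add_div (2 * p t * q t)]
    linarith

/-- At a time at which the constraint is active it is stationary. -/
theorem deriv_eq_of_add_div_eq (h : IsTrajectory (μ - 1 / μ) p q) (hμ : 1 < μ) {t q' : ℝ}
    (ht : p t + q t / μ = 1) (hd : HasDerivAt q q' t) :
    p t ^ 2 + q t ^ 2 - 1 + q' / μ = 0 := by
  have hmax : IsLocalMax (fun t => p t + q t / μ) t :=
    Eventually.of_forall fun s => by
      simp only [ht]
      exact h.add_div_le hμ s
  exact hmax.hasDerivAt_eq_zero ((h.hasDerivAt_fst t).fun_add (hd.div_const μ))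

/-- A trajectory does not pass through the tip of the viability region. -/
theorem ne_tip (h : IsTrajectory (μ - 1 / μ) p q) (hμ : 1 < μ) (t : ℝ) : ¬(p t = 0 ∧ q t = μ) := by
  rintro ⟨h0, h1⟩
  have hμ0 : μ ≠ 0 := by linarith
  obtain ⟨u, -, hd⟩ := h.hasDerivAt_snd t
  have e1 := h.deriv_eq_of_add_div_eq hμ (by simp [h0, h1, hμ0]) hd
  -- At the tip both edges are active. Stationarity along the first edge determines `q'`,
  -- stationarity along the second determines `-q'`, and adding gives `μ² = 1`.
  have e2 := h.reverse.deriv_eq_of_add_div_eq hμ (t := -t) (by simp [h0, h1, hμ0])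
    (HasDerivAt.scomp (-t) (h := fun t => -t) (by simpa using hd) (hasDerivAt_neg (-t)))
  simp only [neg_neg, h0, h1, neg_div, neg_smul, one_smul] at e1 e2
  nlinarith

end IsTrajectory

/-! ### Sufficiency of the Pontryagin conditions. -/

/-- Comparison of a trajectory with a reference arc `(P, Q)` on which the length functional is
calibrated by the costate `l` and the multiplier `ν` of the constraint. -/
theorem integral_sub_le_of_calibration {μ a b : ℝ} (hab : a ≤ b) (hμ : μ ≠ 0)
    {p q P Q R l ν : ℝ → ℝ} (hqc : Continuous q)
    (hp : ∀ t ∈ Icc a b, HasDerivAt p (p t ^ 2 + q t ^ 2 - 1) t)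
    (hP : ∀ t ∈ Icc a b, HasDerivAt P (P t ^ 2 + Q t ^ 2 - 1) t)
    (hQ : ContinuousOn Q (Icc a b))
    (hR : ∀ t ∈ Icc a b, HasDerivAt R (Q t) t)
    (hl : ∀ t ∈ Icc a b, HasDerivAt l (ν t - 2 * l t * P t) t)
    (hlν : ∀ t ∈ Icc a b, ν t = μ * (1 + 2 * l t * Q t))
    (hl0 : ∀ t ∈ Icc a b, l t ≤ 0) (hν0 : ∀ t ∈ Icc a b, 0 ≤ ν t)
    (hν1 : ∀ t ∈ Icc a b, ν t * (P t + Q t / μ - 1) = 0)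
    (hr : ∀ t ∈ Icc a b, p t + q t / μ ≤ 1) :
    (∫ t in a..b, q t) ≤ R b - R a + l a * (p a - P a) - l b * (p b - P b) ∧
    ((∃ t ∈ Icc a b, a < b ∧ l t < 0 ∧ ¬(p t = P t ∧ q t = Q t)) →
    (∫ t in a..b, q t) < R b - R a + l a * (p a - P a) - l b * (p b - P b)) := by
  have hpc : ContinuousOn p (Icc a b) := fun t ht => (hp t ht).continuousAt.continuousWithinAt
  have hPc : ContinuousOn P (Icc a b) := fun t ht => (hP t ht).continuousAt.continuousWithinAt
  have hlc : ContinuousOn l (Icc a b) := fun t ht => (hl t ht).continuousAt.continuousWithinAt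
  have hνc : ContinuousOn ν (Icc a b) := by
    refine ContinuousOn.congr (f := fun t => μ * (1 + 2 * l t * Q t)) ?_ hlν
    fun_prop
  -- `D` is the derivative of `R - l (p - P)`, so its integral consists of boundary terms only.
  set D : ℝ → ℝ := fun t => Q t - (ν t - 2 * l t * P t) * (p t - P t)
    - l t * (p t ^ 2 + q t ^ 2 - 1 - (P t ^ 2 + Q t ^ 2 - 1)) with hD
  have hDc : ContinuousOn D (Icc a b) := by
    have := hqc.continuousOn (s := Icc a b)
    fun_prop
  have hint : (∫ t in a..b, D t) = R b - R a + l a * (p a - P a) - l b * (p b - P b) := by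
    rw [intervalIntegral.integral_eq_sub_of_hasDerivAt (f := fun t => R t - l t * (p t - P t))]
    · ring
    · intro t ht
      rw [uIcc_of_le hab] at ht
      have := (hR t ht).fun_sub ((hl t ht).fun_mul ((hp t ht).fun_sub (hP t ht)))
      exact this.congr_deriv (by simp only [hD]; ring)
    · exact (hDc.mono (by rw [uIcc_of_le hab])).intervalIntegrable
  -- The Lagrangian is quadratic in `(p, q)` and stationary at `(P, Q)`, by the adjoint equation for
  -- `l` and by the formula for `ν`. Its expansion there has only the quadratic term, with
  -- coefficient `l`.
  have hdiff : ∀ t ∈ Icc a b, D t - q t = ν t * (1 - (p t + q t / μ))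
      - l t * ((p t - P t) ^ 2 + (q t - Q t) ^ 2) := by
    intro t ht
    have h1 := hν1 t ht
    have h2 : ν t / μ = 1 + 2 * l t * Q t := by rw [hlν t ht]; field_simp
    have h3 : ν t * (p t + q t / μ) = ν t * p t + (ν t / μ) * q t := by ring
    have h4 : ν t * (P t + Q t / μ - 1) = ν t * P t + (ν t / μ) * Q t - ν t := by ring
    rw [h4, h2] at h1
    rw [mul_sub, h3, h2]
    simp only [hD]
    linear_combination h1
  have hle : ∀ t ∈ Icc a b, q t ≤ D t := by
    intro t ht
    have h1 := hdiff t ht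
    have h2 : 0 ≤ ν t * (1 - (p t + q t / μ)) := mul_nonneg (hν0 t ht) (by linarith [hr t ht])
    have h3 : 0 ≤ -l t * ((p t - P t) ^ 2 + (q t - Q t) ^ 2) :=
      mul_nonneg (by linarith [hl0 t ht]) (by positivity)
    linarith
  rw [← hint]
  refine ⟨intervalIntegral.integral_mono_on hab (hqc.intervalIntegrable _ _)
    (hDc.mono (by rw [uIcc_of_le hab])).intervalIntegrable hle, ?_⟩
  rintro ⟨t, ht, hab', hlt, hne⟩
  refine intervalIntegral.integral_lt_integral_of_continuousOn_of_le_of_exists_lt hab'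
    hqc.continuousOn hDc (fun x hx => hle x ⟨hx.1.le, hx.2⟩) ⟨t, ht, ?_⟩
  have h1 := hdiff t ht
  have h2 : 0 ≤ ν t * (1 - (p t + q t / μ)) := mul_nonneg (hν0 t ht) (by linarith [hr t ht])
  have h3 : 0 < -l t * ((p t - P t) ^ 2 + (q t - Q t) ^ 2) := by
    refine mul_pos (by linarith) ?_
    by_contra! hcon
    refine hne ⟨?_, ?_⟩
    · have : (p t - P t) ^ 2 ≤ 0 := by nlinarith [sq_nonneg (q t - Q t)]
      nlinarith [pow_eq_zero_iff (two_ne_zero) |>.1 (le_antisymm this (sq_nonneg _))]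
    · have : (q t - Q t) ^ 2 ≤ 0 := by nlinarith [sq_nonneg (p t - P t)]
      nlinarith [pow_eq_zero_iff (two_ne_zero) |>.1 (le_antisymm this (sq_nonneg _))]
  linarith

/-! ### The extremal arc on the edge of the viability region. -/

/-- The reciprocal speed along an extremal arc which runs on the boundary of the viability
region. -/
noncomputable def edgeRecip (μ A t : ℝ) : ℝ := (μ ^ 2 + 1) / (2 * μ) - A * Real.exp (-2 * t)

/-- On the edge `p = 1 - q/μ` with `u = -γ`, the equation of `q` becomes linear for the reciprocal
`1/q`. -/
theorem hasDerivAt_edgeRecip (μ A t : ℝ) :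
    HasDerivAt (edgeRecip μ A) ((μ ^ 2 + 1) / μ - 2 * edgeRecip μ A t) t := by
  have h1 : HasDerivAt (fun t : ℝ => Real.exp (-2 * t)) (Real.exp (-2 * t) * (-2)) t := by
    simpa using ((hasDerivAt_id t).const_mul (-2 : ℝ)).exp
  have h2 := (h1.const_mul A).const_sub ((μ ^ 2 + 1) / (2 * μ))
  refine h2.congr_deriv ?_
  simp only [edgeRecip]
  ring

theorem edgeRecip_mono {μ A s t : ℝ} (hA : 0 ≤ A) (hst : s ≤ t) :
    edgeRecip μ A s ≤ edgeRecip μ A t := by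
  unfold edgeRecip
  have : Real.exp (-2 * t) ≤ Real.exp (-2 * s) := Real.exp_le_exp.2 (by linarith)
  gcongr

theorem hasDerivAt_inv_edgeRecip {μ A t : ℝ} (hμ : 1 < μ) (hy : 0 < edgeRecip μ A t) :
    HasDerivAt (fun t => 1 / edgeRecip μ A t)
      (2 * (1 - 1 / (μ * edgeRecip μ A t)) * (1 / edgeRecip μ A t)
        + (-(μ - 1 / μ)) * (1 / edgeRecip μ A t) ^ 2) t := by
  have hμ0 : μ ≠ 0 := by linarith
  have h := (hasDerivAt_edgeRecip μ A t).fun_inv hy.ne'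
  simp only [one_div] at h ⊢
  refine h.congr_deriv ?_
  field_simp
  ring

theorem hasDerivAt_edge_fst {μ A t : ℝ} (hμ : 1 < μ) (hy : 0 < edgeRecip μ A t) :
    HasDerivAt (fun t => 1 - 1 / (μ * edgeRecip μ A t))
      ((1 - 1 / (μ * edgeRecip μ A t)) ^ 2 + (1 / edgeRecip μ A t) ^ 2 - 1) t := by
  have hμ0 : μ ≠ 0 := by linarith
  have h := ((hasDerivAt_inv_edgeRecip hμ hy).div_const μ).const_sub 1
  have e : (fun t => 1 - 1 / (μ * edgeRecip μ A t)) = fun t => 1 - 1 / edgeRecip μ A t / μ := by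
    funext t; rw [div_div, mul_comm]
  rw [e]
  refine h.congr_deriv ?_
  field_simp
  ring

theorem edge_add_exp {μ A t : ℝ} :
    (μ ^ 2 + 1) / (2 * μ) * Real.exp (2 * t) - A = edgeRecip μ A t * Real.exp (2 * t) := by
  have : Real.exp (-2 * t) * Real.exp (2 * t) = 1 := by rw [← Real.exp_add]; simp
  unfold edgeRecip
  linear_combination A * this

/-- The argument of the logarithm is the reciprocal speed times `exp (2t)`, by `edge_add_exp`; the
derivative of this product is a constant multiple of `exp (2t)`. -/
theorem hasDerivAt_edge_length {μ A t : ℝ} (hμ : 1 < μ) (hy : 0 < edgeRecip μ A t) :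
    HasDerivAt (fun t => μ / (μ ^ 2 + 1) *
      Real.log ((μ ^ 2 + 1) / (2 * μ) * Real.exp (2 * t) - A)) (1 / edgeRecip μ A t) t := by
  have hμ0 : μ ≠ 0 := by linarith
  have h1 : HasDerivAt (fun t : ℝ => Real.exp (2 * t)) (Real.exp (2 * t) * 2) t := by
    simpa using ((hasDerivAt_id t).const_mul (2 : ℝ)).exp
  have hpos : 0 < (μ ^ 2 + 1) / (2 * μ) * Real.exp (2 * t) - A := by
    rw [edge_add_exp]; positivity
  have h2 := ((((h1.const_mul ((μ ^ 2 + 1) / (2 * μ))).sub_const A).log hpos.ne').const_mul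
    (μ / (μ ^ 2 + 1)))
  refine h2.congr_deriv ?_
  rw [edge_add_exp]
  field_simp

/-- The calibration with the edge arc as reference. The end value of `p` at `T` is free, so the
costate is normalized to vanish there; the only boundary term left is the one at `a`. The hypothesis
`hκ` says that the multiplier of the constraint is nonnegative at `a`, and since it increases with
time, on all of `[a, T]`. -/
theorem IsTrajectory.edge_integral_le {μ A a T : ℝ} {p q : ℝ → ℝ} (hμ : 1 < μ)
    (h : IsTrajectory (μ - 1 / μ) p q) (haT : a ≤ T) (hA : 0 ≤ A) (hy : 0 < edgeRecip μ A a)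
    (hκ : μ * (1 - Real.exp (2 * (a - T))) ≤ edgeRecip μ A T) :
    (∫ t in a..T, q t) ≤
      μ / (μ ^ 2 + 1) * Real.log ((μ ^ 2 + 1) / (2 * μ) * Real.exp (2 * T) - A) -
      μ / (μ ^ 2 + 1) * Real.log ((μ ^ 2 + 1) / (2 * μ) * Real.exp (2 * a) - A) +
      -(μ / 2) * (edgeRecip μ A a / edgeRecip μ A T) * (1 - Real.exp (2 * (a - T))) *
        (p a - (1 - 1 / (μ * edgeRecip μ A a))) ∧
    (a < T → ¬(p a = 1 - 1 / (μ * edgeRecip μ A a) ∧ q a = 1 / edgeRecip μ A a) →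
    (∫ t in a..T, q t) <
      μ / (μ ^ 2 + 1) * Real.log ((μ ^ 2 + 1) / (2 * μ) * Real.exp (2 * T) - A) -
      μ / (μ ^ 2 + 1) * Real.log ((μ ^ 2 + 1) / (2 * μ) * Real.exp (2 * a) - A) +
      -(μ / 2) * (edgeRecip μ A a / edgeRecip μ A T) * (1 - Real.exp (2 * (a - T))) *
        (p a - (1 - 1 / (μ * edgeRecip μ A a)))) := by
  have hμ0 : 0 < μ := by linarith
  have hpos : ∀ t ∈ Icc a T, 0 < edgeRecip μ A t := fun t ht => hy.trans_le (edgeRecip_mono hA ht.1)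
  have hT := hpos T ⟨haT, le_rfl⟩
  have hexp : ∀ t ∈ Icc a T, 0 ≤ 1 - Real.exp (2 * (t - T)) := fun t ht => by
    have : Real.exp (2 * (t - T)) ≤ 1 := Real.exp_le_one_iff.2 (by linarith [ht.2])
    linarith
  have key := integral_sub_le_of_calibration (μ := μ) haT hμ0.ne' h.continuous_snd
    (fun t _ => h.hasDerivAt_fst t)
    (P := fun t => 1 - 1 / (μ * edgeRecip μ A t)) (Q := fun t => 1 / edgeRecip μ A t)
    (R := fun t => μ / (μ ^ 2 + 1) * Real.log ((μ ^ 2 + 1) / (2 * μ) * Real.exp (2 * t) - A))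
    (l := fun t => -(μ / 2) * (edgeRecip μ A t / edgeRecip μ A T) * (1 - Real.exp (2 * (t - T))))
    (ν := fun t => μ * (1 - μ / edgeRecip μ A T * (1 - Real.exp (2 * (t - T)))))
    (fun t ht => hasDerivAt_edge_fst hμ (hpos t ht))
    (fun t ht => (hasDerivAt_inv_edgeRecip hμ (hpos t ht)).continuousAt.continuousWithinAt)
    (fun t ht => hasDerivAt_edge_length hμ (hpos t ht)) ?_ ?_ ?_ ?_ ?_
    (fun t _ => h.add_div_le hμ t)
  · simp only [sub_self, mul_zero, Real.exp_zero, zero_mul, sub_zero] at key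
    refine ⟨key.1, fun hlt hne => key.2 ⟨a, ⟨le_rfl, haT⟩, hlt, ?_, hne⟩⟩
    have h1 : 0 < 1 - Real.exp (2 * (a - T)) := by
      have : Real.exp (2 * (a - T)) < 1 := Real.exp_lt_one_iff.2 (by linarith)
      linarith
    have : 0 < (μ / 2) * (edgeRecip μ A a / edgeRecip μ A T) * (1 - Real.exp (2 * (a - T))) := by
      positivity
    linarith
  · intro t ht
    have h1 : HasDerivAt (fun t : ℝ => Real.exp (2 * (t - T))) (Real.exp (2 * (t - T)) * 2) t := by
      simpa using (((hasDerivAt_id t).sub_const T).const_mul (2 : ℝ)).exp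
    have h2 := ((((hasDerivAt_edgeRecip μ A t).div_const (edgeRecip μ A T)).const_mul
      (-(μ / 2))).fun_mul (h1.const_sub 1))
    refine h2.congr_deriv ?_
    have h3 := hpos t ht
    -- Eliminating `A` between the times `t` and `T` leaves a rational identity in the two
    -- reciprocal speeds.
    have h4 : edgeRecip μ A T = (μ ^ 2 + 1) / (2 * μ) -
        ((μ ^ 2 + 1) / (2 * μ) - edgeRecip μ A t) * Real.exp (2 * (t - T)) := by
      have : Real.exp (-2 * t) * Real.exp (2 * (t - T)) = Real.exp (-2 * T) := by
        rw [← Real.exp_add]; congr 1; ring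
      unfold edgeRecip
      linear_combination (A * this)
    set e := Real.exp (2 * (t - T))
    set y := edgeRecip μ A t
    set yT := edgeRecip μ A T
    field_simp
    field_simp at h4
    linear_combination (-1 : ℝ) * h4
  · intro t ht
    have h3 := hpos t ht
    field_simp
    ring
  · intro t ht
    have h3 := hpos t ht
    have : 0 ≤ (μ / 2) * (edgeRecip μ A t / edgeRecip μ A T) * (1 - Real.exp (2 * (t - T))) :=
      mul_nonneg (by positivity) (hexp t ht)
    linarith
  · intro t ht
    refine mul_nonneg hμ0.le ?_
    have : μ / edgeRecip μ A T * (1 - Real.exp (2 * (t - T))) ≤ 1 := by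
      rw [div_mul_eq_mul_div, div_le_one hT]
      refine le_trans ?_ hκ
      gcongr
      exact ht.1
    linarith
  · intro t ht
    have h3 := hpos t ht
    rw [div_div, mul_comm (edgeRecip μ A t) μ]
    ring

/-! ### The singular arc in the interior of the viability region. -/

section SingularArc

variable {E S : ℝ}

theorem hasDerivAt_two_mul_cosh (t : ℝ) :
    HasDerivAt (fun t => Real.cosh (2 * t)) (2 * Real.sinh (2 * t)) t := by
  simpa [mul_comm] using ((hasDerivAt_id t).const_mul (2 : ℝ)).cosh

theorem hasDerivAt_two_mul_sinh (t : ℝ) :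
    HasDerivAt (fun t => Real.sinh (2 * t)) (2 * Real.cosh (2 * t)) t := by
  simpa [mul_comm] using ((hasDerivAt_id t).const_mul (2 : ℝ)).sinh

theorem hasDerivAt_singular_fst (hS : S ^ 2 = E ^ 2 - 1) {t : ℝ} (ht : 0 < E - Real.cosh (2 * t)) :
    HasDerivAt (fun t => Real.sinh (2 * t) / (E - Real.cosh (2 * t)))
      ((Real.sinh (2 * t) / (E - Real.cosh (2 * t))) ^ 2 + (S / (E - Real.cosh (2 * t))) ^ 2 - 1)
      t := by
  have h := (hasDerivAt_two_mul_sinh t).fun_div ((hasDerivAt_two_mul_cosh t).const_sub E) ht.ne'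
  refine h.congr_deriv ?_
  have h1 := Real.cosh_sq (2 * t)
  field_simp
  linear_combination (-1 : ℝ) * hS - h1

theorem hasDerivAt_singular_snd {t : ℝ} (ht : 0 < E - Real.cosh (2 * t)) :
    HasDerivAt (fun t => S / (E - Real.cosh (2 * t)))
      (2 * (Real.sinh (2 * t) / (E - Real.cosh (2 * t))) * (S / (E - Real.cosh (2 * t)))) t := by
  have h := (hasDerivAt_const t S).fun_div ((hasDerivAt_two_mul_cosh t).const_sub E) ht.ne'
  refine h.congr_deriv ?_
  field_simp
  ring

/-- `E + S` and `E - S` are mutually inverse roots of the quadratic in `exp (2t)` given by `E - cosh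
(2t)`; the factorization yields the antiderivative of the speed. -/
theorem singular_length_factor (hS : S ^ 2 = E ^ 2 - 1) (t : ℝ) :
    ((E + S) * Real.exp (2 * t) - 1) * (E + S - Real.exp (2 * t)) =
      2 * (E + S) * Real.exp (2 * t) * (E - Real.cosh (2 * t)) := by
  have h1 : Real.exp (2 * t) * Real.exp (-(2 * t)) = 1 := by rw [← Real.exp_add]; simp
  rw [Real.cosh_eq]
  linear_combination Real.exp (2 * t) * hS + (E + S) * h1

theorem singular_length_pos (hS0 : 0 < S) (hE : 1 < E) (hS : S ^ 2 = E ^ 2 - 1) {t : ℝ}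
    (ht : 0 < E - Real.cosh (2 * t)) :
    0 < (E + S) * Real.exp (2 * t) - 1 ∧ 0 < E + S - Real.exp (2 * t) := by
  have h1 := singular_length_factor hS t
  have h2 : 0 < 2 * (E + S) * Real.exp (2 * t) * (E - Real.cosh (2 * t)) := by
    have : 0 < Real.exp (2 * t) := Real.exp_pos _
    positivity
  rw [← h1] at h2
  rcases mul_pos_iff.1 h2 with h | h
  · exact h
  · nlinarith [Real.exp_pos (2 * t)]

theorem hasDerivAt_singular_length (hS0 : 0 < S) (hE : 1 < E) (hS : S ^ 2 = E ^ 2 - 1) {t : ℝ}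
    (ht : 0 < E - Real.cosh (2 * t)) :
    HasDerivAt (fun t => 1 / 2 * (Real.log ((E + S) * Real.exp (2 * t) - 1)
      - Real.log (E + S - Real.exp (2 * t)))) (S / (E - Real.cosh (2 * t))) t := by
  have h1 : HasDerivAt (fun t : ℝ => Real.exp (2 * t)) (Real.exp (2 * t) * 2) t := by
    simpa using ((hasDerivAt_id t).const_mul (2 : ℝ)).exp
  obtain ⟨h2, h3⟩ := singular_length_pos hS0 hE hS ht
  have h := ((((h1.const_mul (E + S)).sub_const 1).log h2.ne').fun_sub
    ((h1.const_sub (E + S)).log h3.ne')).const_mul (1 / 2)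
  refine h.congr_deriv ?_
  have h4 := singular_length_factor hS t
  rw [div_sub_div _ _ h2.ne' h3.ne', h4]
  have h5 : 0 < E + S := by linarith
  have h6 := (Real.exp_pos (2 * t))
  field_simp
  linear_combination -hS

/-- Off the edge the multiplier vanishes, so stationarity forces the costate to be `-1/(2Q)`. The
reference arc has control `u = 0` and passes through `p = 0` at time 0, where its antiderivative of
the speed is also 0. -/
theorem IsTrajectory.singular_integral_le {μ a : ℝ} {p q : ℝ → ℝ} (hμ : 1 < μ)
    (h : IsTrajectory (μ - 1 / μ) p q) (ha : 0 ≤ a) (hS0 : 0 < S) (hE : 1 < E)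
    (hS : S ^ 2 = E ^ 2 - 1) (haE : 0 < E - Real.cosh (2 * a)) :
    (∫ t in (0 : ℝ)..a, q t) ≤
      1 / 2 * (Real.log ((E + S) * Real.exp (2 * a) - 1) - Real.log (E + S - Real.exp (2 * a)))
      - (E - 1) / (2 * S) * p 0
      + (E - Real.cosh (2 * a)) / (2 * S)
        * (p a - Real.sinh (2 * a) / (E - Real.cosh (2 * a))) ∧
    (0 < a → (∃ t ∈ Icc 0 a, ¬(p t = Real.sinh (2 * t) / (E - Real.cosh (2 * t)) ∧
        q t = S / (E - Real.cosh (2 * t)))) →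
    (∫ t in (0 : ℝ)..a, q t) <
      1 / 2 * (Real.log ((E + S) * Real.exp (2 * a) - 1) - Real.log (E + S - Real.exp (2 * a)))
      - (E - 1) / (2 * S) * p 0
      + (E - Real.cosh (2 * a)) / (2 * S)
        * (p a - Real.sinh (2 * a) / (E - Real.cosh (2 * a)))) := by
  have hμ0 : 0 < μ := by linarith
  have hpos : ∀ t ∈ Icc 0 a, 0 < E - Real.cosh (2 * t) := fun t ht => by
    have : Real.cosh (2 * t) ≤ Real.cosh (2 * a) := by
      rw [Real.cosh_le_cosh, abs_of_nonneg (by linarith [ht.1]), abs_of_nonneg (by linarith)]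
      linarith [ht.2]
    linarith
  have key := integral_sub_le_of_calibration (μ := μ) ha hμ0.ne' h.continuous_snd
    (fun t _ => h.hasDerivAt_fst t)
    (P := fun t => Real.sinh (2 * t) / (E - Real.cosh (2 * t)))
    (Q := fun t => S / (E - Real.cosh (2 * t)))
    (R := fun t => 1 / 2 * (Real.log ((E + S) * Real.exp (2 * t) - 1)
      - Real.log (E + S - Real.exp (2 * t))))
    (l := fun t => -((E - Real.cosh (2 * t)) / (2 * S)))
    (ν := fun _ => 0)
    (fun t ht => hasDerivAt_singular_fst hS (hpos t ht))
    (fun t ht => (hasDerivAt_singular_snd (hpos t ht)).continuousAt.continuousWithinAt)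
    (fun t ht => hasDerivAt_singular_length hS0 hE hS (hpos t ht)) ?_ ?_ ?_ ?_ ?_
    (fun t _ => h.add_div_le hμ t)
  · have e : ∀ r : ℝ, r - 1 / 2 * (Real.log ((E + S) * Real.exp (2 * 0) - 1)
        - Real.log (E + S - Real.exp (2 * 0)))
        + -((E - Real.cosh (2 * 0)) / (2 * S)) *
          (p 0 - Real.sinh (2 * 0) / (E - Real.cosh (2 * 0)))
        - -((E - Real.cosh (2 * a)) / (2 * S)) *
          (p a - Real.sinh (2 * a) / (E - Real.cosh (2 * a)))
        = r - (E - 1) / (2 * S) * p 0 + (E - Real.cosh (2 * a)) / (2 * S)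
          * (p a - Real.sinh (2 * a) / (E - Real.cosh (2 * a))) := by
      intro r
      simp only [mul_zero, Real.exp_zero, mul_one, sub_self, Real.cosh_zero, Real.sinh_zero,
        zero_div, sub_zero]
      ring
    simp only [e] at key
    refine ⟨key.1, fun hlt ⟨t, ht, hne⟩ => key.2 ⟨t, ht, hlt, ?_, hne⟩⟩
    have := hpos t ht
    have : 0 < (E - Real.cosh (2 * t)) / (2 * S) := by positivity
    linarith
  · intro t ht
    have h1 := hpos t ht
    have h2 := (((hasDerivAt_two_mul_cosh t).const_sub E).div_const (2 * S)).fun_neg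
    refine h2.congr_deriv ?_
    field_simp
    ring
  · intro t ht
    have h1 := hpos t ht
    field_simp
    ring
  · intro t ht
    have h1 := hpos t ht
    have : 0 < (E - Real.cosh (2 * t)) / (2 * S) := by positivity
    linarith
  · intro t ht
    exact le_rfl
  · intro t ht
    simp

end SingularArc

/-! ### Matching the two arcs at the switch. -/

/-- The data of the extremal of half length `T` in the case of a large Hilbert distance: `a` is the
time of the switch from the singular arc to the boundary arc, and `E = exp (2T)`. -/
structure IsSwitch (μ T E S a : ℝ) : Prop where
  one_lt : 1 < μ
  exp_eq : E = Real.exp (2 * T)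
  S_pos : 0 < S
  S_sq : S ^ 2 = E ^ 2 - 1
  one_lt_E : 1 < E
  exp_switch : Real.exp (2 * a) = E - S / μ
  pos : 0 < a
  lt : a < T

theorem one_lt_of_lt_div {μ E : ℝ} (hμ : 1 < μ) (hE : (μ ^ 2 + 1) / (μ ^ 2 - 1) < E) : 1 < E := by
  refine lt_trans ?_ hE
  rw [lt_div_iff₀] <;> nlinarith

/-- The switch lies at a positive time iff `S < μ (E - 1)`. As `S² = (E - 1)(E + 1)`, this is
precisely the threshold between the two cases of the bound. -/
theorem exists_isSwitch {μ T : ℝ} (hμ : 1 < μ)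
    (hE : (μ ^ 2 + 1) / (μ ^ 2 - 1) < Real.exp (2 * T)) :
    ∃ a, IsSwitch μ T (Real.exp (2 * T)) (√(Real.exp (2 * T) ^ 2 - 1)) a := by
  set E := Real.exp (2 * T) with hEdef
  have h1 := one_lt_of_lt_div hμ hE
  have h2 : 0 < E ^ 2 - 1 := by nlinarith
  have hS : 0 < √(E ^ 2 - 1) := Real.sqrt_pos.2 h2
  have hS2 : √(E ^ 2 - 1) ^ 2 = E ^ 2 - 1 := Real.sq_sqrt h2.le
  set S := √(E ^ 2 - 1)
  have hμ0 : 0 < μ := by linarith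
  have h3 : 1 < E - S / μ := by
    rw [lt_sub_comm, div_lt_iff₀ hμ0]
    have h4 : μ ^ 2 + 1 < E * (μ ^ 2 - 1) := by rwa [div_lt_iff₀ (by nlinarith)] at hE
    refine lt_of_pow_lt_pow_left₀ 2 (by nlinarith) ?_
    rw [hS2]
    nlinarith
  have h5 : 0 < S / μ := by positivity
  refine ⟨1 / 2 * Real.log (E - S / μ), hμ, rfl, hS, hS2, h1, ?_, ?_, ?_⟩
  · rw [← mul_assoc]; norm_num
    exact Real.exp_log (by linarith)
  · have := Real.log_pos h3
    linarith
  · have : Real.log (E - S / μ) < Real.log E := Real.log_lt_log (by linarith) (by linarith)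
    rw [hEdef, Real.log_exp, ← hEdef] at this
    linarith

namespace IsSwitch

variable {μ T E S a : ℝ}

theorem S_lt (h : IsSwitch μ T E S a) : S < E := by
  have := h.S_sq; have := h.one_lt_E; have := h.S_pos
  nlinarith

/-- The constant of the boundary arc. -/
noncomputable def edgeConst (μ E S : ℝ) : ℝ := ((μ ^ 2 + 1) / (2 * μ) - S / E) * E

theorem edgeConst_nonneg (h : IsSwitch μ T E S a) : 0 ≤ edgeConst μ E S := by
  have h0 := h.one_lt
  have h1 := h.one_lt_E
  refine mul_nonneg ?_ (by linarith)
  have h2 : S / E ≤ 1 := by rw [div_le_one (by linarith)]; exact h.S_lt.le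
  have h3 : 1 ≤ (μ ^ 2 + 1) / (2 * μ) := by
    rw [le_div_iff₀ (by linarith)]; nlinarith [sq_nonneg (μ - 1)]
  linarith

theorem sub_cosh (h : IsSwitch μ T E S a) :
    E - Real.cosh (2 * a) = S ^ 2 * (μ ^ 2 - 1) / (2 * μ ^ 2 * Real.exp (2 * a)) := by
  have h0 := h.one_lt
  have h1 := Real.exp_pos (2 * a)
  have h2 := h.exp_switch
  have h3 := h.S_sq
  rw [Real.cosh_eq, Real.exp_neg]
  set x := Real.exp (2 * a)
  have h4 : S = μ * (E - x) := by rw [h2]; field_simp; ring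
  have h5 : E - (x + x⁻¹) / 2 = (2 * E * x - x ^ 2 - 1) / (2 * x) := by field_simp; ring
  rw [h5, div_eq_div_iff (by positivity) (by positivity)]
  have h6 : μ ^ 2 * (2 * E * x - x ^ 2 - 1) = S ^ 2 * (μ ^ 2 - 1) := by
    linear_combination (-μ ^ 2) * h3 + (S + μ * (E - x)) * h4
  linear_combination 2 * x * h6

theorem sub_cosh_pos (h : IsSwitch μ T E S a) : 0 < E - Real.cosh (2 * a) := by
  rw [h.sub_cosh]
  have h0 := h.one_lt
  have h1 := h.S_pos
  have h2 : 0 < μ ^ 2 - 1 := by nlinarith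
  have h3 := Real.exp_pos (2 * a)
  positivity

theorem edgeRecip_mul_exp (h : IsSwitch μ T E S a) :
    edgeRecip μ (edgeConst μ E S) a * Real.exp (2 * a) = S * (μ ^ 2 - 1) / (2 * μ ^ 2) := by
  have h0 := h.one_lt
  have hμ : μ ≠ 0 := by linarith
  have h1 := h.one_lt_E
  have hE : E ≠ 0 := by linarith
  rw [← edge_add_exp, h.exp_switch, edgeConst]
  field_simp
  ring

theorem edgeRecip_switch (h : IsSwitch μ T E S a) :
    E - Real.cosh (2 * a) = S * edgeRecip μ (edgeConst μ E S) a := by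
  have h0 := h.one_lt
  have h1 := Real.exp_pos (2 * a)
  have h2 := h.edgeRecip_mul_exp
  rw [h.sub_cosh]
  rw [eq_div_iff (by nlinarith)] at h2
  rw [div_eq_iff (by positivity)]
  linear_combination (-S) * h2

theorem edgeRecip_pos (h : IsSwitch μ T E S a) : 0 < edgeRecip μ (edgeConst μ E S) a := by
  have h1 := h.sub_cosh_pos
  rw [h.edgeRecip_switch] at h1
  exact pos_of_mul_pos_right h1 h.S_pos.le

theorem edge_end_mul_exp (h : IsSwitch μ T E S a) :
    (μ ^ 2 + 1) / (2 * μ) * Real.exp (2 * T) - edgeConst μ E S = S := by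
  have h1 := h.one_lt_E
  have hE : E ≠ 0 := by linarith
  rw [← h.exp_eq, edgeConst]
  field_simp
  ring

/-- The constant of the edge arc is fixed by this end value. Together with `one_sub_exp` it makes
the multiplier of the constraint vanish at the switch, as it does on the singular arc. -/
theorem edgeRecip_end (h : IsSwitch μ T E S a) : edgeRecip μ (edgeConst μ E S) T = S / E := by
  have h1 := edge_add_exp (μ := μ) (A := edgeConst μ E S) (t := T)
  rw [h.edge_end_mul_exp, ← h.exp_eq] at h1
  have := h.one_lt_E
  rw [eq_div_iff (by linarith)]
  exact h1.symm

theorem one_sub_exp (h : IsSwitch μ T E S a) :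
    1 - Real.exp (2 * (a - T)) = S / (μ * E) := by
  have h0 := h.one_lt
  have h1 := h.one_lt_E
  rw [mul_sub, Real.exp_sub, ← h.exp_eq, h.exp_switch]
  field_simp
  ring

/-- With `snd_switch`: the singular arc reaches the edge at the switch and continues into the edge
arc. -/
theorem fst_switch (h : IsSwitch μ T E S a) :
    Real.sinh (2 * a) / (E - Real.cosh (2 * a))
      = 1 - 1 / (μ * edgeRecip μ (edgeConst μ E S) a) := by
  have h0 := h.one_lt
  have h1 := h.edgeRecip_pos
  have h2 := h.S_pos
  have h3 := Real.cosh_add_sinh (2 * a)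
  have h4 := h.edgeRecip_switch
  rw [h.exp_switch] at h3
  have h5 : Real.sinh (2 * a) = S * edgeRecip μ (edgeConst μ E S) a - S / μ := by linarith
  rw [h4, h5]
  field_simp

theorem snd_switch (h : IsSwitch μ T E S a) :
    S / (E - Real.cosh (2 * a)) = 1 / edgeRecip μ (edgeConst μ E S) a := by
  have h1 := h.edgeRecip_pos
  have h2 := h.S_pos
  rw [h.edgeRecip_switch]
  field_simp

theorem singular_length (h : IsSwitch μ T E S a) :
    Real.log ((E + S) * Real.exp (2 * a) - 1) - Real.log (E + S - Real.exp (2 * a))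
      = Real.log ((μ - 1) / (μ + 1) * (E + S)) := by
  have h0 := h.one_lt
  have h1 := h.one_lt_E
  have h2 := h.S_pos
  have h3 := singular_length_pos h2 h1 h.S_sq h.sub_cosh_pos
  rw [← Real.log_div h3.1.ne' h3.2.ne']
  congr 1
  rw [div_eq_iff h3.2.ne', h.exp_switch]
  field_simp
  linear_combination (-(μ * (μ + 1))) * h.S_sq

theorem edge_length (h : IsSwitch μ T E S a) :
    Real.log ((μ ^ 2 + 1) / (2 * μ) * Real.exp (2 * T) - edgeConst μ E S)
      - Real.log ((μ ^ 2 + 1) / (2 * μ) * Real.exp (2 * a) - edgeConst μ E S)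
      = Real.log (2 * μ ^ 2 / (μ ^ 2 - 1)) := by
  have h0 := h.one_lt
  have h2 := h.S_pos
  have h3 : 0 < μ ^ 2 - 1 := by nlinarith
  rw [h.edge_end_mul_exp, edge_add_exp, h.edgeRecip_mul_exp, ← Real.log_div h2.ne' (by positivity)]
  congr 1
  field_simp

end IsSwitch

/-! ### The sharp bound on the length of a trajectory. -/

theorem lengthBound_of_exp_le {μ d : ℝ} (hμ : 1 < μ)
    (h : Real.exp d ≤ (μ ^ 2 + 1) / (μ ^ 2 - 1)) :
    lengthBound μ d =
      2 * μ / (μ ^ 2 + 1) * Real.log (((μ ^ 2 + 1) * (Real.exp d - 1) + 2) / 2) := by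
  have h3 : 0 < μ ^ 2 - 1 := by nlinarith
  rw [lengthBound, if_pos ((Real.le_log_iff_exp_le (by positivity)).2 h)]

/-- The product of `√(E+1) + √(E-1)` and `√(E+1) - √(E-1)` is 2, so their quotient is `E + √(E² -
1)`. -/
theorem lengthBound_of_lt_exp {μ d : ℝ} (hμ : 1 < μ)
    (h : (μ ^ 2 + 1) / (μ ^ 2 - 1) < Real.exp d) :
    lengthBound μ d = Real.log ((μ - 1) / (μ + 1) * (Real.exp d + √(Real.exp d ^ 2 - 1)))
      + 2 * μ / (μ ^ 2 + 1) * Real.log (2 * μ ^ 2 / (μ ^ 2 - 1)) := by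
  have h3 : 0 < μ ^ 2 - 1 := by nlinarith
  rw [lengthBound, if_neg (by rw [Real.le_log_iff_exp_le (by positivity)]; exact h.not_ge)]
  congr 2
  have h1 := one_lt_of_lt_div hμ h
  set E := Real.exp d
  have h4 : √(E ^ 2 - 1) = √(E + 1) * √(E - 1) := by
    rw [← Real.sqrt_mul (by linarith)]; congr 1; ring
  have h5 := Real.sq_sqrt (show 0 ≤ E + 1 by linarith)
  have h6 := Real.sq_sqrt (show 0 ≤ E - 1 by linarith)
  have h7 : 0 < √(E + 1) - √(E - 1) := sub_pos.2 (Real.sqrt_lt_sqrt (by linarith) (by linarith))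
  rw [h4]
  set u := √(E + 1)
  set v := √(E - 1)
  have h8 : E = (u ^ 2 + v ^ 2) / 2 := by rw [h5, h6]; ring
  have h9 : u ^ 2 - v ^ 2 = 2 := by rw [h5, h6]; ring
  rw [h8]
  field_simp
  linear_combination (-(μ - 1) * (u + v)) * h9

/-- The length of a trajectory over a symmetric time interval. -/
theorem IsTrajectory.integral_symm_lt_lengthBound {μ T : ℝ} {p q : ℝ → ℝ} (hμ : 1 < μ)
    (h : IsTrajectory (μ - 1 / μ) p q) (hT : 0 < T) :
    (∫ t in -T..T, q t) < lengthBound μ (2 * T) := by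
  have hμ0 : 0 < μ := by linarith
  have hsplit : (∫ t in -T..T, q t) = (∫ t in (0 : ℝ)..T, q (-t)) + ∫ t in (0 : ℝ)..T, q t := by
    have := intervalIntegral.integral_comp_neg (a := 0) (b := T) q
    rw [this, neg_zero, intervalIntegral.integral_add_adjacent_intervals] <;>
    exact h.continuous_snd.intervalIntegrable _ _
  rw [hsplit]
  rcases le_or_gt (Real.exp (2 * T)) ((μ ^ 2 + 1) / (μ ^ 2 - 1)) with hE | hE
  · rw [lengthBound_of_exp_le hμ hE]
    set E := Real.exp (2 * T) with hEdef
    have hE1 : 1 < E := Real.one_lt_exp_iff.2 (by linarith)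
    -- This constant makes the edge arc start at the tip `(0, μ)` at time 0.
    set A := (μ ^ 2 + 1) / (2 * μ) - 1 / μ with hA
    have hA' : A = (μ ^ 2 - 1) / (2 * μ) := by rw [hA]; field_simp; ring
    have hA0 : 0 ≤ A := by
      rw [hA']; have : 0 ≤ μ ^ 2 - 1 := by nlinarith
      positivity
    have hy0 : edgeRecip μ A 0 = 1 / μ := by simp [edgeRecip, hA]
    have hκ : μ * (1 - Real.exp (2 * (0 - T))) ≤ edgeRecip μ A T := by
      have h1 : Real.exp (2 * (0 - T)) = 1 / E := by
        rw [hEdef, one_div, ← Real.exp_neg]; congr 1; ring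
      have h2 : Real.exp (-2 * T) = 1 / E := by
        rw [hEdef, one_div, ← Real.exp_neg]; congr 1; ring
      rw [edgeRecip, h1, h2, hA']
      have h3 : E * (μ ^ 2 - 1) ≤ μ ^ 2 + 1 := by
        rwa [le_div_iff₀ (by nlinarith)] at hE
      field_simp
      nlinarith
    have hval : μ / (μ ^ 2 + 1) * Real.log ((μ ^ 2 + 1) / (2 * μ) * Real.exp (2 * T) - A) -
        μ / (μ ^ 2 + 1) * Real.log ((μ ^ 2 + 1) / (2 * μ) * Real.exp (2 * 0) - A) =
        μ / (μ ^ 2 + 1) * Real.log (((μ ^ 2 + 1) * (E - 1) + 2) / 2) := by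
      rw [← mul_sub, ← Real.log_div]
      · congr 2
        rw [← hEdef, mul_zero, Real.exp_zero, hA]
        field_simp
        ring
      · rw [edge_add_exp]
        have := hy0 ▸ edgeRecip_mono (μ := μ) hA0 hT.le
        have : 0 < edgeRecip μ A T := lt_of_lt_of_le (by positivity) this
        positivity
      · simp [hA]; positivity
    have k1 := h.edge_integral_le hμ hT.le hA0 (by rw [hy0]; positivity) hκ
    -- Here `P 0 = 0`, and `p 0` enters the two halves with opposite signs, so the boundary terms at
    -- time 0 cancel. Strictness is needed in one half only and comes from `ne_tip`.
    have k2 := h.reverse.edge_integral_le hμ hT.le hA0 (by rw [hy0]; positivity) hκ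
    have hz : 1 - 1 / (μ * (1 / μ)) = 0 := by field_simp; simp
    rw [hval, hy0, hz] at k1 k2
    have k1' := k1.2 hT (by simpa using h.ne_tip hμ 0)
    have k2' := k2.1
    simp only [neg_zero] at k2'
    have : 2 * μ / (μ ^ 2 + 1) * Real.log (((μ ^ 2 + 1) * (E - 1) + 2) / 2) =
      2 * (μ / (μ ^ 2 + 1) * Real.log (((μ ^ 2 + 1) * (E - 1) + 2) / 2)) := by ring
    rw [this]
    linarith
  · rw [lengthBound_of_lt_exp hμ hE]
    obtain ⟨a, hs⟩ := exists_isSwitch hμ hE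
    set E := Real.exp (2 * T)
    set S := √(E ^ 2 - 1)
    have hκ : μ * (1 - Real.exp (2 * (a - T))) ≤ edgeRecip μ (IsSwitch.edgeConst μ E S) T := by
      rw [hs.edgeRecip_end, hs.one_sub_exp]
      have := hs.one_lt_E
      apply le_of_eq
      field_simp
    -- The costates of the two arcs agree at the switch, so the boundary terms at `a` cancel.
    have hl : -(μ / 2) * (edgeRecip μ (IsSwitch.edgeConst μ E S) a /
        edgeRecip μ (IsSwitch.edgeConst μ E S) T) * (1 - Real.exp (2 * (a - T))) =
        -((E - Real.cosh (2 * a)) / (2 * S)) := by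
      rw [hs.edgeRecip_end, hs.one_sub_exp, hs.edgeRecip_switch]
      have := hs.one_lt_E
      have := hs.S_pos
      field_simp
    have e1 := fun {p q : ℝ → ℝ} (h : IsTrajectory (μ - 1 / μ) p q) =>
      (h.edge_integral_le hμ hs.lt.le hs.edgeConst_nonneg hs.edgeRecip_pos hκ).1
    have s1 := fun {p q : ℝ → ℝ} (h : IsTrajectory (μ - 1 / μ) p q) =>
      h.singular_integral_le hμ hs.pos.le hs.S_pos hs.one_lt_E hs.S_sq hs.sub_cosh_pos
    rw [← mul_sub, hs.edge_length, hl, ← hs.fst_switch] at e1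
    rw [hs.singular_length] at s1
    have hadd : ∀ {p q : ℝ → ℝ}, IsTrajectory (μ - 1 / μ) p q →
        (∫ t in (0 : ℝ)..T, q t) = (∫ t in (0 : ℝ)..a, q t) + ∫ t in a..T, q t := fun h => by
      rw [intervalIntegral.integral_add_adjacent_intervals] <;>
      exact h.continuous_snd.intervalIntegrable _ _
    -- A trajectory equal to the singular arc on `[0, a]` would reach the edge with control 0,
    -- whereas stationarity of an active constraint forces `u = -γ`.
    have hne : ∃ t ∈ Icc 0 a, ¬(p t = Real.sinh (2 * t) / (E - Real.cosh (2 * t)) ∧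
        q t = S / (E - Real.cosh (2 * t))) := by
      by_contra! hcon
      obtain ⟨hpa, hqa⟩ := hcon a ⟨hs.pos.le, le_rfl⟩
      obtain ⟨u, -, hd⟩ := h.hasDerivAt_snd a
      have hq' : HasDerivWithinAt q (2 * p a * q a) (Icc 0 a) a := by
        rw [hpa, hqa]
        exact (hasDerivAt_singular_snd hs.sub_cosh_pos).hasDerivWithinAt.congr
          (fun t ht => (hcon t ht).2) hqa
      have huniq : UniqueDiffWithinAt ℝ (Icc 0 a) a :=
        uniqueDiffOn_Icc hs.pos a ⟨hs.pos.le, le_rfl⟩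
      have hequ := huniq.eq_deriv _ hd.hasDerivWithinAt hq'
      rw [hequ] at hd
      have hr : p a + q a / μ = 1 := by
        rw [hpa, hqa, hs.fst_switch, hs.snd_switch]
        have := hs.edgeRecip_pos
        field_simp
        ring
      have h1 := h.deriv_eq_of_add_div_eq hμ hr hd
      have h2 : p a = 1 - q a / μ := by linarith
      rw [h2] at h1
      have h3 := h.pos a
      have h4 : q a ^ 2 * (μ ^ 2 - 1) = 0 := by
        field_simp at h1
        linear_combination h1
      have h5 : 0 < q a ^ 2 * (μ ^ 2 - 1) := mul_pos (by positivity) (by nlinarith)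
      linarith
    have a1 := (s1 h).2 hs.pos hne
    have a2 := e1 h
    have b1 := (s1 h.reverse).1
    have b2 := e1 h.reverse
    have c1 := hadd h
    have c2 := hadd h.reverse
    simp only [neg_zero] at b1
    set L1 := Real.log ((μ - 1) / (μ + 1) * (E + S))
    set L2 := Real.log (2 * μ ^ 2 / (μ ^ 2 - 1))
    have : 2 * μ / (μ ^ 2 + 1) * L2 = 2 * (μ / (μ ^ 2 + 1) * L2) := by ring
    rw [this, c1, c2]
    linarith

/-- The length of a trajectory over an arbitrary time interval. -/
theorem IsTrajectory.integral_lt_lengthBound {μ a b : ℝ} {p q : ℝ → ℝ} (hμ : 1 < μ)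
    (h : IsTrajectory (μ - 1 / μ) p q) (hab : a < b) :
    (∫ t in a..b, q t) < lengthBound μ (b - a) := by
  have h1 := (h.shift ((a + b) / 2)).integral_symm_lt_lengthBound hμ (T := (b - a) / 2)
    (by linarith)
  rw [intervalIntegral.integral_comp_add_right q] at h1
  convert h1 using 2 <;> ring

/-! ### Elementary properties of the bound. -/

theorem one_lt_muOf {γ : ℝ} (hγ : 0 < γ) : 1 < muOf γ := by
  have : 1 ≤ √(1 + γ ^ 2 / 4) := Real.one_le_sqrt.2 (by nlinarith [sq_nonneg γ])
  unfold muOf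
  linarith

theorem muOf_sub_one_div {γ : ℝ} (hγ : 0 < γ) : muOf γ - 1 / muOf γ = γ := by
  have h0 := one_lt_muOf hγ
  have h1 : √(1 + γ ^ 2 / 4) ^ 2 = 1 + γ ^ 2 / 4 := Real.sq_sqrt (by positivity)
  have h2 : muOf γ ≠ 0 := by linarith
  field_simp
  unfold muOf
  linear_combination h1

/-- Below the threshold the difference from `d` is nondecreasing in `exp d`, so it suffices to look
at the threshold, where it is less than the constant. Above it, only `√(E² - 1) < E` is lost. -/
theorem lengthBound_lt_add_additiveConst {μ d : ℝ} (hμ : 1 < μ) (hd : 0 < d) :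
    lengthBound μ d < d + additiveConst μ := by
  have hm : 0 < μ - 1 := by linarith
  have hm2 : 0 < μ ^ 2 - 1 := by nlinarith
  have hE1 : 1 < Real.exp d := Real.one_lt_exp_iff.2 hd
  have hd' : d = Real.log (Real.exp d) := (Real.log_exp d).symm
  rcases le_or_gt (Real.exp d) ((μ ^ 2 + 1) / (μ ^ 2 - 1)) with hE | hE
  · rw [lengthBound_of_exp_le hμ hE, additiveConst]
    nth_rw 2 [hd']
    set E := Real.exp d
    set E₀ := (μ ^ 2 + 1) / (μ ^ 2 - 1) with hE₀
    have hE₀' : E₀ ≤ (μ + 1) / (μ - 1) := by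
      rw [hE₀, div_le_div_iff₀ hm2 hm]
      nlinarith
    have hW : ∀ x ∈ Icc 1 E₀, 0 < ((μ ^ 2 + 1) * (x - 1) + 2) / 2 := fun x hx => by
      have : 0 ≤ (μ ^ 2 + 1) * (x - 1) := mul_nonneg (by positivity) (by linarith [hx.1])
      linarith
    have hder : ∀ x ∈ Icc 1 E₀, HasDerivAt
        (fun x => 2 * μ / (μ ^ 2 + 1) * Real.log (((μ ^ 2 + 1) * (x - 1) + 2) / 2) - Real.log x)
        (2 * μ / ((μ ^ 2 + 1) * (x - 1) + 2) - 1 / x) x := by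
      intro x hx
      have h1 : HasDerivAt (fun x : ℝ => ((μ ^ 2 + 1) * (x - 1) + 2) / 2) ((μ ^ 2 + 1) / 2) x := by
        simpa using ((((hasDerivAt_id x).sub_const 1).const_mul (μ ^ 2 + 1)).add_const 2).div_const 2
      have h2 := ((h1.log (hW x hx).ne').const_mul (2 * μ / (μ ^ 2 + 1))).fun_sub
        (Real.hasDerivAt_log (show x ≠ 0 by linarith [hx.1]))
      refine h2.congr_deriv ?_
      have := hW x hx
      field_simp
    have hmono : MonotoneOn
        (fun x => 2 * μ / (μ ^ 2 + 1) * Real.log (((μ ^ 2 + 1) * (x - 1) + 2) / 2) - Real.log x)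
        (Icc 1 E₀) := by
      refine monotoneOn_of_deriv_nonneg (convex_Icc _ _)
        (fun x hx => (hder x hx).continuousAt.continuousWithinAt)
        (fun x hx => (hder x (interior_subset hx)).differentiableAt.differentiableWithinAt) ?_
      intro x hx
      have hx' := interior_subset hx
      rw [(hder x hx').deriv, sub_nonneg, div_le_div_iff₀ (by linarith [hx'.1])
        (by linarith [hW x hx'])]
      have : x * (μ - 1) ≤ μ + 1 := by
        rw [← le_div_iff₀ hm]; exact hx'.2.trans hE₀'
      nlinarith
    have h1 := hmono ⟨hE1.le, hE⟩ ⟨hE1.le.trans hE, le_rfl⟩ hE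
    have h2 : ((μ ^ 2 + 1) * (E₀ - 1) + 2) / 2 = 2 * μ ^ 2 / (μ ^ 2 - 1) := by
      rw [hE₀]; field_simp; ring
    simp only [h2] at h1
    have h3 : Real.log ((μ + 1) / (μ - 1)) < Real.log 2 + Real.log E₀ := by
      rw [← Real.log_mul two_ne_zero (by positivity)]
      refine Real.log_lt_log (by positivity) ?_
      rw [hE₀, mul_div_assoc', div_lt_div_iff₀ hm hm2]
      have : 0 < (μ - 1) ^ 3 := by positivity
      nlinarith
    linarith
  · rw [lengthBound_of_lt_exp hμ hE, additiveConst]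
    nth_rw 3 [hd']
    set E := Real.exp d
    have h1 : √(E ^ 2 - 1) < E := by
      rw [Real.sqrt_lt' (by linarith)]; linarith
    have h2 : 0 ≤ √(E ^ 2 - 1) := Real.sqrt_nonneg _
    have h3 : Real.log ((μ - 1) / (μ + 1) * (E + √(E ^ 2 - 1))) <
        Real.log E + (Real.log 2 - Real.log ((μ + 1) / (μ - 1))) := by
      rw [← Real.log_div two_ne_zero (by positivity), ← Real.log_mul (by positivity) (by positivity)]
      refine Real.log_lt_log (by positivity) ?_
      have : E * (2 / ((μ + 1) / (μ - 1))) = (μ - 1) / (μ + 1) * (E + E) := by field_simp; ring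
      rw [this]
      gcongr
    linarith

theorem tendsto_lengthBound_sub {μ : ℝ} (hμ : 1 < μ) :
    Tendsto (fun d : ℝ => lengthBound μ d - d) atTop (𝓝 (additiveConst μ)) := by
  have hm : 0 < μ - 1 := by linarith
  have h1 : Tendsto (fun d : ℝ => Real.log ((μ - 1) / (μ + 1) * (1 + √(1 - Real.exp (-d) ^ 2)))
      + 2 * μ / (μ ^ 2 + 1) * Real.log (2 * μ ^ 2 / (μ ^ 2 - 1))) atTop
      (𝓝 (Real.log ((μ - 1) / (μ + 1) * (1 + √(1 - 0 ^ 2)))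
      + 2 * μ / (μ ^ 2 + 1) * Real.log (2 * μ ^ 2 / (μ ^ 2 - 1)))) := by
    refine Tendsto.add_const _ ?_
    have h2 : Tendsto (fun d : ℝ => Real.exp (-d)) atTop (𝓝 0) := Real.tendsto_exp_neg_atTop_nhds_zero
    refine Tendsto.log ?_ (by simp; constructor <;> linarith)
    exact (((h2.pow 2).const_sub 1).sqrt.const_add 1).const_mul _
  have h3 : Real.log ((μ - 1) / (μ + 1) * (1 + √(1 - 0 ^ 2)))
      + 2 * μ / (μ ^ 2 + 1) * Real.log (2 * μ ^ 2 / (μ ^ 2 - 1)) = additiveConst μ := by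
    rw [additiveConst, ← Real.log_div two_ne_zero (by positivity)]
    congr 2
    norm_num
    field_simp
  rw [h3] at h1
  refine h1.congr' ?_
  filter_upwards [Real.tendsto_exp_atTop.eventually_gt_atTop ((μ ^ 2 + 1) / (μ ^ 2 - 1))] with d hd
  rw [lengthBound_of_lt_exp hμ hd]
  have hE1 := one_lt_of_lt_div hμ hd
  have h4 : √(Real.exp d ^ 2 - 1) = Real.exp d * √(1 - Real.exp (-d) ^ 2) := by
    rw [← Real.sqrt_sq (Real.exp_pos d).le, ← Real.sqrt_mul (by positivity), Real.sqrt_sq (Real.exp_pos d).le,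
      Real.exp_neg]
    congr 1
    field_simp
  have h5 : 0 ≤ √(1 - Real.exp (-d) ^ 2) := Real.sqrt_nonneg _
  have h6 : (μ - 1) / (μ + 1) * (Real.exp d + √(Real.exp d ^ 2 - 1)) =
      (μ - 1) / (μ + 1) * (1 + √(1 - Real.exp (-d) ^ 2)) * Real.exp d := by
    rw [h4]; ring
  rw [h6, Real.log_mul (y := Real.exp d) (by positivity) (by positivity), Real.log_exp]
  ring

/-- The bound depends continuously on `μ`, at least from the left. -/
theorem exists_lengthBound_gt {μ d ε : ℝ} (hμ : 1 < μ) (hd : 0 < d) (hε : 0 < ε) :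
    ∃ μ', 1 < μ' ∧ μ' < μ ∧ lengthBound μ d - ε < lengthBound μ' d := by
  have hm2 : 0 < μ ^ 2 - 1 := by nlinarith
  have hE1 : 1 < Real.exp d := Real.one_lt_exp_iff.2 hd
  have hIoo : ∀ᶠ x in 𝓝[<] μ, 1 < x ∧ x < μ :=
    (Ioo_mem_nhdsLT hμ)
  have hsq : ContinuousAt (fun x : ℝ => (x ^ 2 + 1) / (x ^ 2 - 1)) μ :=
    ContinuousAt.div (by fun_prop) (by fun_prop) hm2.ne'
  rcases le_or_gt (Real.exp d) ((μ ^ 2 + 1) / (μ ^ 2 - 1)) with hE | hE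
  · have hc : ContinuousAt (fun μ : ℝ =>
        2 * μ / (μ ^ 2 + 1) * Real.log (((μ ^ 2 + 1) * (Real.exp d - 1) + 2) / 2)) μ := by
      refine ContinuousAt.mul (ContinuousAt.div (by fun_prop) (by fun_prop) (by positivity)) ?_
      refine ContinuousAt.log (by fun_prop) (ne_of_gt ?_)
      have : 0 < (μ ^ 2 + 1) * (Real.exp d - 1) := mul_pos (by positivity) (by linarith)
      linarith
    have h1 := (hc.tendsto.mono_left nhdsWithin_le_nhds).eventually
      (lt_mem_nhds (sub_lt_self _ hε)) |>.and hIoo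
    obtain ⟨x, h2, h3, h4⟩ := h1.exists
    refine ⟨x, h3, h4, ?_⟩
    rw [lengthBound_of_exp_le hμ hE, lengthBound_of_exp_le h3]
    · exact h2
    -- The threshold decreases in `μ`, so lowering `μ` stays in this case.
    · refine hE.trans ?_
      rw [div_le_div_iff₀ hm2 (by nlinarith)]
      nlinarith
  · have hc : ContinuousAt (fun μ : ℝ =>
        Real.log ((μ - 1) / (μ + 1) * (Real.exp d + √(Real.exp d ^ 2 - 1)))
      + 2 * μ / (μ ^ 2 + 1) * Real.log (2 * μ ^ 2 / (μ ^ 2 - 1))) μ := by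
      have hpos : 0 < Real.exp d + √(Real.exp d ^ 2 - 1) := by
        have := Real.sqrt_nonneg (Real.exp d ^ 2 - 1); linarith
      refine ContinuousAt.add (ContinuousAt.log (ContinuousAt.mul (ContinuousAt.div (by fun_prop)
        (by fun_prop) (by linarith)) (by fun_prop)) ?_) ?_
      · have : 0 < μ - 1 := by linarith
        positivity
      · refine ContinuousAt.mul (ContinuousAt.div (by fun_prop) (by fun_prop) (by positivity)) ?_
        refine ContinuousAt.log (ContinuousAt.div (by fun_prop) (by fun_prop) hm2.ne') ?_
        positivity
    have h1 := (hc.tendsto.mono_left nhdsWithin_le_nhds).eventually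
      (lt_mem_nhds (sub_lt_self _ hε)) |>.and (hIoo.and
        ((hsq.tendsto.mono_left nhdsWithin_le_nhds).eventually (gt_mem_nhds hE)))
    obtain ⟨x, h2, ⟨h3, h4⟩, h5⟩ := h1.exists
    refine ⟨x, h3, h4, ?_⟩
    rw [lengthBound_of_lt_exp hμ hE, lengthBound_of_lt_exp h3 h5]
    exact h2

/-! ### Centro-affine geometry in terms of a logarithmically homogeneous potential. -/

namespace CentroAffine

variable {V : Type*} [NormedAddCommGroup V] [NormedSpace ℝ V]

theorem _root_.DifferentiableAt.hasDerivAt_comp_curve {W : Type*} [NormedAddCommGroup W]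
    [NormedSpace ℝ W] {H : V → W} {c : ℝ → V} {c' : V} {t : ℝ} (h : DifferentiableAt ℝ H (c t))
    (hc : HasDerivAt c c' t) : HasDerivAt (fun t => H (c t)) (fderiv ℝ H (c t) c') t :=
  h.hasFDerivAt.comp_hasDerivAt t hc

theorem _root_.DifferentiableAt.hasDerivAt_comp_curve_apply {H : V → V →L[ℝ] ℝ} {c : ℝ → V} {c' : V}
    {t : ℝ} (h : DifferentiableAt ℝ H (c t)) (hc : HasDerivAt c c' t) (w : V) :
    HasDerivAt (fun t => H (c t) w) (fderiv ℝ H (c t) c' w) t := by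
  have h1 := DifferentiableAt.hasDerivAt_comp_curve (W := V →L[ℝ] ℝ) h hc
  have h2 := h1.clm_apply (hasDerivAt_const t w)
  exact h2.congr_deriv (by rw [map_zero, add_zero])

/-- In homogeneous coordinates, the lift `f` is `exp G` times the position vector, with a
logarithmically homogeneous potential `G` of class `C^3` on an open cone. -/
structure IsLogPotential (U : Set V) (f : ℙ ℝ V → V) (G : V → ℝ) : Prop where
  isOpen : IsOpen U
  smul_mem : ∀ v ∈ U, ∀ c : ℝ, 0 < c → c • v ∈ U
  ne_zero : ∀ v ∈ U, v ≠ 0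
  contDiffOn : ContDiffOn ℝ 3 G U
  apply_smul : ∀ v ∈ U, ∀ c : ℝ, 0 < c → G (c • v) = G v - Real.log c
  pullback_eq : ∀ v ∈ U, pullback f v = Real.exp (G v) • v

/-- The centro-affine form in terms of the potential. -/
noncomputable def potentialMetric (G : V → ℝ) (v w w' : V) : ℝ :=
  fderiv ℝ (fderiv ℝ G) v w w' - fderiv ℝ G v w * fderiv ℝ G v w'

namespace IsLogPotential

variable {U : Set V} {f : ℙ ℝ V → V} {G : V → ℝ} {v : V}

theorem contDiffAt (h : IsLogPotential U f G) (hv : v ∈ U) : ContDiffAt ℝ 3 G v :=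
  h.contDiffOn.contDiffAt (h.isOpen.mem_nhds hv)

theorem contDiffAt_fderiv (h : IsLogPotential U f G) (hv : v ∈ U) :
    ContDiffAt ℝ 2 (fderiv ℝ G) v :=
  (h.contDiffAt hv).fderiv_right (by norm_num)

theorem contDiffAt_fderiv_fderiv (h : IsLogPotential U f G) (hv : v ∈ U) :
    ContDiffAt ℝ 1 (fderiv ℝ (fderiv ℝ G)) v :=
  (h.contDiffAt_fderiv hv).fderiv_right (by norm_num)

theorem hasFDerivAt (h : IsLogPotential U f G) (hv : v ∈ U) : HasFDerivAt G (fderiv ℝ G v) v :=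
  ((h.contDiffAt hv).differentiableAt (by norm_num)).hasFDerivAt

theorem hasFDerivAt_fderiv (h : IsLogPotential U f G) (hv : v ∈ U) :
    HasFDerivAt (fderiv ℝ G) (fderiv ℝ (fderiv ℝ G) v) v :=
  ((h.contDiffAt_fderiv hv).differentiableAt (by norm_num)).hasFDerivAt

theorem hasFDerivAt_fderiv_fderiv (h : IsLogPotential U f G) (hv : v ∈ U) :
    HasFDerivAt (fderiv ℝ (fderiv ℝ G)) (fderiv ℝ (fderiv ℝ (fderiv ℝ G)) v) v :=
  ((h.contDiffAt_fderiv_fderiv hv).differentiableAt (by norm_num)).hasFDerivAt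

/-- Euler's relation for a function of logarithmic degree `-1`. -/
theorem fderiv_self (h : IsLogPotential U f G) (hv : v ∈ U) : fderiv ℝ G v v = -1 := by
  have h1 : HasDerivAt (fun c : ℝ => G (c • v)) (fderiv ℝ G v v) 1 := by
    have h2 : HasDerivAt (fun c : ℝ => c • v) v 1 := by
      simpa using (hasDerivAt_id (1 : ℝ)).smul_const v
    have h3 := (h.hasFDerivAt hv).differentiableAt
    rw [← one_smul ℝ v] at h3
    have h4 := h3.hasDerivAt_comp_curve h2
    rwa [one_smul] at h4
  have h2 : HasDerivAt (fun c : ℝ => G v - Real.log c) (-1) 1 := by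
    simpa using (Real.hasDerivAt_log (one_ne_zero)).const_sub (G v)
  refine h1.unique (h2.congr_of_eventuallyEq ?_)
  filter_upwards [lt_mem_nhds one_pos] with c hc
  exact h.apply_smul v hv c hc

theorem fderiv_smul (h : IsLogPotential U f G) (hv : v ∈ U) {c : ℝ} (hc : 0 < c) (w : V) :
    fderiv ℝ G (c • v) w = c⁻¹ * fderiv ℝ G v w := by
  have h1 : HasFDerivAt (fun u => G (c • u)) ((fderiv ℝ G (c • v)).comp
      (c • ContinuousLinearMap.id ℝ V)) v :=
    (h.hasFDerivAt (h.smul_mem v hv c hc)).comp v ((hasFDerivAt_id v).const_smul c)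
  have h2 : HasFDerivAt (fun u => G u - Real.log c) (fderiv ℝ G v) v :=
    (h.hasFDerivAt hv).sub_const _
  have h3 := h1.unique (h2.congr_of_eventuallyEq (by
    filter_upwards [h.isOpen.mem_nhds hv] with u hu
    exact h.apply_smul u hu c hc))
  have h4 := DFunLike.congr_fun h3 w
  simp at h4
  rw [← h4]
  field_simp

theorem fderiv_fderiv_symm (h : IsLogPotential U f G) (hv : v ∈ U) (w w' : V) :
    fderiv ℝ (fderiv ℝ G) v w w' = fderiv ℝ (fderiv ℝ G) v w' w :=
  ((h.contDiffAt hv).isSymmSndFDerivAt (by simp; norm_num)).eq w w'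

theorem fderiv_fderiv_self (h : IsLogPotential U f G) (hv : v ∈ U) (w : V) :
    fderiv ℝ (fderiv ℝ G) v v w = -fderiv ℝ G v w := by
  have h1 : HasDerivAt (fun c : ℝ => fderiv ℝ G (c • v) w) (fderiv ℝ (fderiv ℝ G) v v w) 1 := by
    have h2 : HasDerivAt (fun c : ℝ => c • v) v 1 := by
      simpa using (hasDerivAt_id (1 : ℝ)).smul_const v
    have h3 := (h.hasFDerivAt_fderiv hv).differentiableAt
    rw [← one_smul ℝ v] at h3
    have h4 := h3.hasDerivAt_comp_curve_apply h2 w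
    rwa [one_smul] at h4
  have h2 : HasDerivAt (fun c : ℝ => c⁻¹ * fderiv ℝ G v w) (-fderiv ℝ G v w) 1 := by
    simpa using (hasDerivAt_inv (one_ne_zero (α := ℝ))).mul_const (fderiv ℝ G v w)
  refine h1.unique (h2.congr_of_eventuallyEq ?_)
  filter_upwards [lt_mem_nhds one_pos] with c hc
  exact h.fderiv_smul hv hc w

/-- The position vector is in the kernel of the form, since it represents the zero tangent vector of
the projective space. -/
theorem potentialMetric_self_left (h : IsLogPotential U f G) (hv : v ∈ U) (w : V) :
    potentialMetric G v v w = 0 := by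
  rw [potentialMetric, h.fderiv_self hv, h.fderiv_fderiv_self hv]
  ring

theorem fderiv_fderiv_smul (h : IsLogPotential U f G) (hv : v ∈ U) {c : ℝ} (hc : 0 < c) (w w' : V) :
    fderiv ℝ (fderiv ℝ G) (c • v) w w' = (c⁻¹) ^ 2 * fderiv ℝ (fderiv ℝ G) v w w' := by
  have h1 : HasFDerivAt (fun u => fderiv ℝ G (c • u)) ((fderiv ℝ (fderiv ℝ G) (c • v)).comp
      (c • ContinuousLinearMap.id ℝ V)) v :=
    (h.hasFDerivAt_fderiv (h.smul_mem v hv c hc)).comp v ((hasFDerivAt_id v).const_smul c)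
  have h2 : HasFDerivAt (fun u => c⁻¹ • fderiv ℝ G u) (c⁻¹ • fderiv ℝ (fderiv ℝ G) v) v :=
    (h.hasFDerivAt_fderiv hv).const_smul c⁻¹
  have h3 := h1.unique (h2.congr_of_eventuallyEq (by
    filter_upwards [h.isOpen.mem_nhds hv] with u hu
    ext w
    simpa using h.fderiv_smul hu hc w))
  have h4 := DFunLike.congr_fun (DFunLike.congr_fun h3 w) w'
  simp at h4
  field_simp
  field_simp at h4
  linear_combination h4

/-- The centro-affine form is invariant under rescaling of the homogeneous coordinates. -/
theorem potentialMetric_smul (h : IsLogPotential U f G) (hv : v ∈ U) {c : ℝ} (hc : 0 < c) (w : V)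
    (r s : ℝ) : potentialMetric G (c • v) (c • (r • w + s • v)) (c • (r • w + s • v)) =
      r ^ 2 * potentialMetric G v w w := by
  have h1 := h.fderiv_fderiv_symm hv w v
  rw [potentialMetric, potentialMetric, h.fderiv_fderiv_smul hv hc, h.fderiv_smul hv hc]
  simp only [map_add,
    map_smul, add_apply, smul_apply, smul_eq_mul, h1,
    h.fderiv_self hv, h.fderiv_fderiv_self hv]
  field_simp
  ring

theorem hasFDerivAt_pullback (h : IsLogPotential U f G) (hv : v ∈ U) :
    HasFDerivAt (pullback f) (Real.exp (G v) • ContinuousLinearMap.id ℝ V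
      + (Real.exp (G v) • fderiv ℝ G v).smulRight v) v := by
  refine ((h.hasFDerivAt hv).exp.smul (hasFDerivAt_id v)).congr_of_eventuallyEq ?_
  filter_upwards [h.isOpen.mem_nhds hv] with u hu
  exact h.pullback_eq u hu

theorem fderiv_pullback (h : IsLogPotential U f G) (hv : v ∈ U) (w : V) :
    fderiv ℝ (pullback f) v w = Real.exp (G v) • (w + fderiv ℝ G v w • v) := by
  rw [(h.hasFDerivAt_pullback hv).fderiv]
  simp [smul_add, smul_smul]

theorem flatDeriv_eq (h : IsLogPotential U f G) (hv : v ∈ U) (w w' : V) :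
    flatDeriv f v w w' = Real.exp (G v) • (fderiv ℝ G v w • w' + fderiv ℝ G v w' • w +
      (fderiv ℝ G v w * fderiv ℝ G v w' + fderiv ℝ (fderiv ℝ G) v w w') • v) := by
  have h1 : HasFDerivAt (fun u => fderiv ℝ G u w') ((fderiv ℝ (fderiv ℝ G) v).flip w') v := by
    have := (h.hasFDerivAt_fderiv hv).clm_apply (hasFDerivAt_const w' v)
    simpa using this
  have h2 := (h.hasFDerivAt hv).exp.smul ((h1.smul (hasFDerivAt_id v)).const_add w')
  have h3 : HasFDerivAt (fun u => fderiv ℝ (pullback f) u w') _ v :=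
    h2.congr_of_eventuallyEq (by
      filter_upwards [h.isOpen.mem_nhds hv] with u hu
      exact h.fderiv_pullback hu w')
  rw [flatDeriv, h3.fderiv]
  simp
  module

/-- Since `dG(v) v = -1`, the differential of the lift kills `v`, so `z` is determined only modulo
`v`. Applying `dG` to the solved equation eliminates `z` and isolates `c`. Thus every choice made in
`metric` and `connection` is harmless. -/
theorem decomposition_iff (h : IsLogPotential U f G) (hv : v ∈ U) (w w' z : V) (c : ℝ) :
    flatDeriv f v w w' = fderiv ℝ (pullback f) v z + c • pullback f v ↔
      c = potentialMetric G v w w' ∧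
      ∃ k : ℝ, z = fderiv ℝ G v w • w' + fderiv ℝ G v w' • w + k • v := by
  rw [h.flatDeriv_eq hv, h.fderiv_pullback hv, h.pullback_eq v hv, smul_comm c, ← smul_add,
    smul_right_inj (Real.exp_ne_zero _)]
  have hself := h.fderiv_self hv
  constructor
  · intro hz
    set m := fderiv ℝ G v w * fderiv ℝ G v w' + fderiv ℝ (fderiv ℝ G) v w w' with hm
    have hz' : z = fderiv ℝ G v w • w' + fderiv ℝ G v w' • w +
        (m - fderiv ℝ G v z - c) • v := by
      rw [sub_smul, sub_smul]
      have := hz.symm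
      rw [← eq_sub_iff_add_eq, ← eq_sub_iff_add_eq] at this
      nth_rw 1 [this]; abel
    refine ⟨?_, _, hz'⟩
    have h1 := congrArg (fderiv ℝ G v) hz'
    simp only [map_add, map_smul, smul_eq_mul, hself] at h1
    rw [potentialMetric]
    linarith
  · rintro ⟨rfl, k, rfl⟩
    simp only [map_add, map_smul, smul_eq_mul, hself, potentialMetric]
    module

theorem metric_eq (h : IsLogPotential U f G) (hv : v ∈ U) (w w' : V) :
    metric f v w w' = potentialMetric G v w w' := by
  have hex : ∃ c : ℝ, ∃ z : V,
      flatDeriv f v w w' = fderiv ℝ (pullback f) v z + c • pullback f v :=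
    ⟨_, _, (h.decomposition_iff hv w w' _ _).2 ⟨rfl, 0, rfl⟩⟩
  obtain ⟨z, hz⟩ := Classical.epsilon_spec hex
  exact ((h.decomposition_iff hv w w' _ _).1 hz).1

theorem connection_eq (h : IsLogPotential U f G) (hv : v ∈ U) (w w' : V) :
    ∃ k : ℝ, connection f v w w' = fderiv ℝ G v w • w' + fderiv ℝ G v w' • w + k • v := by
  have hex : ∃ z : V,
      flatDeriv f v w w' = fderiv ℝ (pullback f) v z + metric f v w w' • pullback f v :=
    ⟨_, (h.decomposition_iff hv w w' _ _).2 ⟨h.metric_eq hv w w', 0, rfl⟩⟩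
  exact ((h.decomposition_iff hv w w' _ _).1 (Classical.epsilon_spec hex)).2

/-- `∇_w w` is `2 dG(w) w` modulo the position vector, which is null for `h`; the factor 2 in the
definition of the cubic form makes 4. -/
theorem cubicForm_eq (h : IsLogPotential U f G) (hv : v ∈ U) (w : V) :
    cubicForm f v w = fderiv ℝ (fun u => potentialMetric G u w w) v w
      - 4 * fderiv ℝ G v w * potentialMetric G v w w := by
  obtain ⟨k, hk⟩ := h.connection_eq hv w w
  have h1 : (fun u => metric f u w w) =ᶠ[𝓝 v] fun u => potentialMetric G u w w := by
    filter_upwards [h.isOpen.mem_nhds hv] with u hu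
    exact h.metric_eq hu w w
  have h2 : potentialMetric G v (fderiv ℝ G v w • w + fderiv ℝ G v w • w + k • v) w =
      2 * fderiv ℝ G v w * potentialMetric G v w w := by
    simp only [potentialMetric, map_add, map_smul, add_apply,
      smul_apply, smul_eq_mul, h.fderiv_self hv, h.fderiv_fderiv_self hv]
    ring
  rw [cubicForm, h1.fderiv_eq, hk, h.metric_eq hv, h2]
  ring

/-- The centro-affine form along a curve: if `c` and `w` are curves in `V`, this is the derivative
of `t ↦ h(w, w)`. -/
theorem hasDerivAt_potentialMetric (h : IsLogPotential U f G) {c w : ℝ → V} {c' w' : V} {t : ℝ}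
    (hv : c t ∈ U) (hc : HasDerivAt c c' t) (hw : HasDerivAt w w' t) :
    HasDerivAt (fun t => potentialMetric G (c t) (w t) (w t))
      (fderiv ℝ (fun u => potentialMetric G u (w t) (w t)) (c t) c'
        + 2 * potentialMetric G (c t) w' (w t)) t := by
  have h1 : HasFDerivAt (fun u => potentialMetric G u (w t) (w t))
      (fderiv ℝ (fun u => potentialMetric G u (w t) (w t)) (c t)) (c t) := by
    refine DifferentiableAt.hasFDerivAt ?_
    have d1 := (h.hasFDerivAt_fderiv hv).differentiableAt
    have d2 := (h.hasFDerivAt_fderiv_fderiv hv).differentiableAt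
    unfold potentialMetric
    fun_prop
  have h2 := (h.hasFDerivAt_fderiv hv).differentiableAt.hasDerivAt_comp_curve hc
  have h3 := DifferentiableAt.hasDerivAt_comp_curve (W := V →L[ℝ] V →L[ℝ] ℝ)
    (h.hasFDerivAt_fderiv_fderiv hv).differentiableAt hc
  have h4 := ((h3.clm_apply hw).clm_apply hw).sub ((h2.clm_apply hw).mul (h2.clm_apply hw))
  have h5 := ((h3.clm_apply (hasDerivAt_const t (w t))).clm_apply (hasDerivAt_const t (w t))).sub
    ((h2.clm_apply (hasDerivAt_const t (w t))).mul (h2.clm_apply (hasDerivAt_const t (w t))))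
  have h6 := (h1.differentiableAt.hasDerivAt_comp_curve hc).unique h5
  refine HasDerivAt.congr_deriv (f := fun t => potentialMetric G (c t) (w t) (w t)) h4 ?_
  rw [h6]
  have h7 := h.fderiv_fderiv_symm hv (w t) w'
  simp [potentialMetric, h7]
  ring

/-- The metric and the cubic form in terms of the derivatives of the potential along a line. -/
theorem metric_cubicForm_of_line (h : IsLogPotential U f G) (hv : v ∈ U) {w : V} {l₁ l₂ : ℝ → ℝ}
    {l₃ : ℝ} (h₁ : ∀ᶠ t in 𝓝 (0 : ℝ), HasDerivAt (fun t : ℝ => G (v + t • w)) (l₁ t) t)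
    (h₂ : ∀ᶠ t in 𝓝 (0 : ℝ), HasDerivAt l₁ (l₂ t) t) (h₃ : HasDerivAt l₂ l₃ 0) :
    metric f v w w = l₂ 0 - l₁ 0 ^ 2 ∧
    cubicForm f v w = l₃ - 6 * l₁ 0 * l₂ 0 + 4 * l₁ 0 ^ 3 := by
  have hline : ∀ t : ℝ, HasDerivAt (fun t : ℝ => v + t • w) w t := fun t => by
    simpa using ((hasDerivAt_id t).smul_const w).const_add v
  have hU : ∀ᶠ t in 𝓝 (0 : ℝ), v + t • w ∈ U :=
    (hline 0).continuousAt.eventually_mem (h.isOpen.mem_nhds (by simpa using hv))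
  have e1 : ∀ᶠ t in 𝓝 (0 : ℝ), l₁ t = fderiv ℝ G (v + t • w) w := by
    filter_upwards [h₁, hU] with t ht hm
    exact ht.unique ((h.hasFDerivAt hm).differentiableAt.hasDerivAt_comp_curve (hline t))
  have e2 : ∀ᶠ t in 𝓝 (0 : ℝ), l₂ t = fderiv ℝ (fderiv ℝ G) (v + t • w) w w := by
    filter_upwards [h₂, hU, e1.eventually_nhds] with t ht hm he
    have h1 := (h.hasFDerivAt_fderiv hm).differentiableAt.hasDerivAt_comp_curve_apply (hline t) w
    exact ht.unique (h1.congr_of_eventuallyEq he)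
  have e3 : ∀ᶠ t in 𝓝 (0 : ℝ), l₂ t - l₁ t ^ 2 = potentialMetric G (v + t • w) w w := by
    filter_upwards [e1, e2] with t h1 h2
    rw [h1, h2, potentialMetric]; ring
  have hm : metric f v w w = l₂ 0 - l₁ 0 ^ 2 := by
    rw [h.metric_eq hv, e3.self_of_nhds]; simp
  refine ⟨hm, ?_⟩
  have hv0 : v + (0 : ℝ) • w ∈ U := by simpa using hv
  have d1 := h.hasDerivAt_potentialMetric hv0 (hline 0) (hasDerivAt_const (0 : ℝ) w)
  have d2 := h₃.fun_sub (h₂.self_of_nhds.fun_pow 2)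
  have d3 := d1.unique (d2.congr_of_eventuallyEq (by
    filter_upwards [e3] with t ht
    exact ht.symm))
  have e4 : fderiv ℝ G v w = l₁ 0 := by rw [e1.self_of_nhds]; simp
  have e5 : potentialMetric G v 0 w = 0 := by simp [potentialMetric]
  simp only [zero_smul, add_zero, e5, mul_zero] at d3
  rw [h.cubicForm_eq hv, d3, e4, ← h.metric_eq hv, hm]
  push_cast
  ring

end IsLogPotential

end CentroAffine

/-! ### Convex cones, boundary points and the Hilbert distance. -/

namespace CentroAffine

variable {V : Type*} [NormedAddCommGroup V] [NormedSpace ℝ V]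

theorem Represents.exists_smul_eq {v w : V} {p : ℙ ℝ V} (hv : Represents v p)
    (hw : Represents w p) : ∃ c : ℝ, c ≠ 0 ∧ w = c • v := by
  obtain ⟨hv0, rfl⟩ := hv
  obtain ⟨hw0, h⟩ := hw
  obtain ⟨c, hc⟩ := (Projectivization.mk_eq_mk_iff' ℝ w v hw0 hv0).1 h
  exact ⟨c, fun h0 => hw0 (by rw [← hc, h0, zero_smul]), hc.symm⟩

theorem Represents.smul {v : V} {p : ℙ ℝ V} (hv : Represents v p) {c : ℝ} (hc : c ≠ 0) :
    Represents (c • v) p := by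
  obtain ⟨hv0, rfl⟩ := hv
  exact ⟨smul_ne_zero hc hv0, (Projectivization.mk_eq_mk_iff' ℝ _ _ _ hv0).2 ⟨c, rfl⟩⟩

section Cone

variable {K : ProperCone ℝ V}

theorem add_mem_cone {v w : V} (hv : v ∈ K) (hw : w ∈ K) : v + w ∈ K :=
  K.toPointedCone.add_mem hv hw

theorem neg_notMem_cone (hK : (K.toPointedCone : ConvexCone ℝ V).Salient) {v : V} (hv : v ∈ K)
    (h0 : v ≠ 0) : -v ∉ K :=
  hK v hv h0

theorem smul_mem_interior_cone {v : V} (hv : v ∈ interior (K : Set V)) {c : ℝ} (hc : 0 < c) :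
    c • v ∈ interior (K : Set V) := by
  rw [mem_interior] at hv ⊢
  obtain ⟨t, htK, hto, hvt⟩ := hv
  refine ⟨(fun x => c • x) '' t, ?_, isOpenMap_smul₀ hc.ne' t hto, mem_image_of_mem _ hvt⟩
  rintro _ ⟨x, hx, rfl⟩
  exact K.smul_mem (htK hx) hc.le

theorem add_mem_interior_cone {v w : V} (hv : v ∈ interior (K : Set V)) (hw : w ∈ K) :
    v + w ∈ interior (K : Set V) := by
  rw [mem_interior] at hv ⊢
  obtain ⟨t, htK, hto, hvt⟩ := hv
  refine ⟨(fun x => x + w) '' t, ?_, isOpenMap_add_right w t hto, mem_image_of_mem _ hvt⟩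
  rintro _ ⟨x, hx, rfl⟩
  exact add_mem_cone (htK hx) hw

theorem exists_sub_smul_mem_cone {v : V} (hv : v ∈ interior (K : Set V)) (w : V) :
    ∃ δ : ℝ, 0 < δ ∧ v - δ • w ∈ K := by
  have h1 : ContinuousAt (fun δ : ℝ => v - δ • w) 0 := by fun_prop
  have h2 : ∀ᶠ δ in 𝓝 (0 : ℝ), v - δ • w ∈ (K : Set V) :=
    h1.eventually_mem (by simpa using mem_interior_iff_mem_nhds.1 hv)
  obtain ⟨δ, h3, h4⟩ := ((h2.filter_mono nhdsWithin_le_nhds).and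
    (self_mem_nhdsWithin (a := (0 : ℝ)) (s := Ioi 0))).exists
  exact ⟨δ, h4, h3⟩

theorem zero_notMem_interior_cone [Nontrivial V]
    (hK : (K.toPointedCone : ConvexCone ℝ V).Salient) : (0 : V) ∉ interior (K : Set V) := by
  intro h
  obtain ⟨x, hx⟩ := exists_ne (0 : V)
  obtain ⟨δ, hδ, h1⟩ := exists_sub_smul_mem_cone h x
  obtain ⟨δ', hδ', h2⟩ := exists_sub_smul_mem_cone h (-x)
  rw [zero_sub] at h1
  rw [zero_sub, smul_neg, neg_neg] at h2
  have h3 := K.smul_mem h2 (r := δ / δ') (by positivity)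
  rw [smul_smul, div_mul_cancel₀ _ hδ'.ne'] at h3
  exact neg_notMem_cone hK h3 (smul_ne_zero hδ.ne' hx) h1

theorem pos_of_smul_mem_cone (hK : (K.toPointedCone : ConvexCone ℝ V).Salient) {v : V} {c : ℝ}
    (hv : v ∈ K) (hc : c • v ∈ K) (h0 : v ≠ 0) (hc0 : c ≠ 0) : 0 < c := by
  rcases lt_or_gt_of_ne hc0 with h | h
  · have := K.smul_mem hc (r := (-c)⁻¹) (inv_nonneg.2 (by linarith))
    rw [smul_smul, show (-c)⁻¹ * c = -1 by field_simp, neg_one_smul] at this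
    exact absurd this (neg_notMem_cone hK hv h0)
  · exact h

/-- Take the largest `m` with `B - m A` in the cone. It is finite because `A - δ B` lies in the cone
for some `δ > 0`: for `m > 1/δ` a negative multiple of `B` would lie in it too. -/
theorem exists_sub_smul_mem_frontier (hK : (K.toPointedCone : ConvexCone ℝ V).Salient) {A B : V}
    (hA : A ∈ interior (K : Set V)) (hB : B ∈ interior (K : Set V)) (hB0 : B ≠ 0) :
    ∃ m : ℝ, 0 < m ∧ B - m • A ∈ frontier (K : Set V) := by
  set S := {m : ℝ | B - m • A ∈ K} with hS
  have hclosed : IsClosed S :=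
    K.isClosed.preimage (show Continuous fun m : ℝ => B - m • A by fun_prop)
  obtain ⟨δ, hδ, hδK⟩ := exists_sub_smul_mem_cone hA B
  obtain ⟨δ', hδ', hδK'⟩ := exists_sub_smul_mem_cone hB A
  have hbdd : BddAbove S := by
    refine ⟨1 / δ, fun m hm => ?_⟩
    by_contra! hlt
    have hm0 : 0 < m := lt_trans (by positivity) hlt
    have h1 := add_mem_cone (K.smul_mem hδK hm0.le) hm
    have h2 : m • (A - δ • B) + (B - m • A) = (1 - m * δ) • B := by module
    rw [h2] at h1
    have h3 : 1 < m * δ := by rwa [div_lt_iff₀ hδ] at hlt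
    have := pos_of_smul_mem_cone hK (interior_subset hB) h1 hB0 (by linarith)
    linarith
  have hmem : sSup S ∈ S := hclosed.csSup_mem ⟨δ', hδK'⟩ hbdd
  refine ⟨sSup S, hδ'.trans_le (le_csSup hbdd hδK'), ?_⟩
  rw [frontier, K.isClosed.closure_eq]
  refine ⟨hmem, fun hint => ?_⟩
  obtain ⟨ε, hε, hεK⟩ := exists_sub_smul_mem_cone hint A
  have : sSup S + ε ∈ S := by
    rw [hS, mem_ofPred_eq, add_smul, ← sub_sub]
    exact hεK
  linarith [le_csSup hbdd this]

/-- The projective line through two points of a proper convex domain meets its boundary in two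
points, in the expected order. -/
theorem exists_boundary_points {Ω : Set (ℙ ℝ V)} [Nontrivial V] (h : IsProperConvexDomain Ω K)
    {a b : ℙ ℝ V} (ha : a ∈ Ω) (hb : b ∈ Ω) (hab : a ≠ b) :
    ∃ X Y A B : V, ∃ s t : ℝ,
        X ∈ frontier (K : Set V) ∧ X ≠ 0 ∧ Y ∈ frontier (K : Set V) ∧ Y ≠ 0 ∧
        0 < s ∧ s < t ∧ t < 1 ∧
        A = AffineMap.lineMap X Y s ∧ B = AffineMap.lineMap X Y t ∧
        Represents A a ∧ Represents B b := by
  obtain ⟨A, hA, hAa⟩ := (h.mem_iff a).1 ha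
  obtain ⟨B, hB, hBb⟩ := (h.mem_iff b).1 hb
  have hK := h.salient
  have hA0 := hAa.1
  have hB0 := hBb.1
  have hmem : ∀ {x : V}, x ∈ frontier (K : Set V) → x ∈ K := fun hx => by
    rw [frontier, K.isClosed.closure_eq] at hx; exact hx.1
  have hind : ∀ m : ℝ, m ≠ 0 → B ≠ m • A := by
    rintro m hm rfl
    obtain ⟨h1, h2⟩ := hAa.smul hm
    obtain ⟨h3, h4⟩ := hBb
    exact hab (h2.symm.trans h4)
  obtain ⟨m, hm, hY⟩ := exists_sub_smul_mem_frontier hK hA hB hB0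
  obtain ⟨m', hm', hX⟩ := exists_sub_smul_mem_frontier hK hB hA hA0
  set Y := B - m • A with hYdef
  set X := A - m' • B with hXdef
  have hY0 : Y ≠ 0 := fun h0 => hind m hm.ne' (sub_eq_zero.1 h0)
  have hX0 : X ≠ 0 := fun h0 => hind m'⁻¹ (inv_ne_zero hm'.ne') (by
    rw [sub_eq_zero.1 h0, smul_smul, inv_mul_cancel₀ hm'.ne', one_smul])
  have hsum : X + m' • Y = (1 - m * m') • A := by rw [hXdef, hYdef]; module
  have hsum' : Y + m • X = (1 - m * m') • B := by rw [hXdef, hYdef]; module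
  -- Salience of the cone gives this inequality, which encodes the order `x, a, b, y` on the line.
  have hlt : m * m' < 1 := by
    have hsK : (1 - m * m') • A ∈ K := by
      rw [← hsum]
      exact add_mem_cone (hmem hX) (K.smul_mem (hmem hY) hm'.le)
    rcases eq_or_ne (1 - m * m') 0 with h0 | h0
    · rw [h0, zero_smul] at hsum
      have h1 := K.smul_mem (hmem hY) hm'.le
      refine absurd ?_ (neg_notMem_cone hK h1 (smul_ne_zero hm'.ne' hY0))
      rw [← eq_neg_iff_add_eq_zero.2 hsum]
      exact hmem hX
    · have := pos_of_smul_mem_cone hK (interior_subset hA) hsK hA0 h0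
      linarith
  have hlt' : 0 < 1 - m * m' := by linarith
  have e1 : AffineMap.lineMap X Y (m' / (1 + m')) = ((1 - m * m') / (1 + m')) • A := by
    rw [AffineMap.lineMap_apply_module, div_eq_inv_mul (1 - m * m'), mul_smul, ← hsum, smul_add,
      smul_smul]
    congr 2
    · field_simp; ring
    · field_simp
  have e2 : AffineMap.lineMap X Y (1 / (1 + m)) = ((1 - m * m') / (1 + m)) • B := by
    rw [AffineMap.lineMap_apply_module, div_eq_inv_mul (1 - m * m'), mul_smul, ← hsum', smul_add,
      smul_smul, add_comm]
    congr 2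
    · field_simp
    · field_simp; ring
  refine ⟨X, Y, _, _, m' / (1 + m'), 1 / (1 + m), hX, hX0, hY, hY0, by positivity, ?_, ?_, rfl, rfl,
    ?_, ?_⟩
  · rw [div_lt_div_iff₀ (by positivity) (by positivity)]
    nlinarith
  · rw [div_lt_one (by positivity)]; linarith
  · rw [e1]; exact hAa.smul (by positivity)
  · rw [e2]; exact hBb.smul (by positivity)

/-- The value chosen in the definition comes with witnesses, so no uniqueness of the boundary points
is needed. The two logarithmic terms are the parameters of `a` and `b` on `planeCurve`. -/
theorem hilbertDist_spec {Ω : Set (ℙ ℝ V)} [Nontrivial V] (h : IsProperConvexDomain Ω K)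
    {a b : ℙ ℝ V} (ha : a ∈ Ω) (hb : b ∈ Ω) (hab : a ≠ b) :
    ∃ X Y A B : V, ∃ s t : ℝ,
        X ∈ frontier (K : Set V) ∧ X ≠ 0 ∧ Y ∈ frontier (K : Set V) ∧ Y ≠ 0 ∧
        0 < s ∧ s < t ∧ t < 1 ∧
        A = AffineMap.lineMap X Y s ∧ B = AffineMap.lineMap X Y t ∧
        Represents A a ∧ Represents B b ∧ LinearIndependent ℝ ![X, Y] ∧
        hilbertDist K a b = 1 / 2 * Real.log (t / (1 - t)) - 1 / 2 * Real.log (s / (1 - s)) := by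
  obtain ⟨X, Y, A, B, s, t, h1⟩ := exists_boundary_points h ha hb hab
  have hex : ∃ d : ℝ, ∃ X Y A B : V, ∃ s t : ℝ,
        X ∈ frontier (K : Set V) ∧ X ≠ 0 ∧ Y ∈ frontier (K : Set V) ∧ Y ≠ 0 ∧
        0 < s ∧ s < t ∧ t < 1 ∧
        A = AffineMap.lineMap X Y s ∧ B = AffineMap.lineMap X Y t ∧
        Represents A a ∧ Represents B b ∧
        d = 1 / 2 * Real.log ((dist Y A * dist X B) / (dist Y B * dist X A)) := by
    refine ⟨1 / 2 * Real.log ((dist Y A * dist X B) / (dist Y B * dist X A)),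
      X, Y, A, B, s, t, ?_⟩
    obtain ⟨h2, h3, h4, h5, h6, h7, h8, h9, h10, h11, h12⟩ := h1
    exact ⟨h2, h3, h4, h5, h6, h7, h8, h9, h10, h11, h12, rfl⟩
  obtain ⟨X, Y, A, B, s, t, hX, hX0, hY, hY0, hs, hst, ht, hA, hB, hAa, hBb, hd⟩ :=
    Classical.epsilon_spec hex
  have hXY : X ≠ Y := by
    rintro rfl
    rw [AffineMap.lineMap_same_apply] at hA hB
    obtain ⟨h3, h4⟩ := hA ▸ hAa
    obtain ⟨h5, h6⟩ := hB ▸ hBb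
    exact hab (h4.symm.trans h6)
  have hD : 0 < dist X Y := dist_pos.2 hXY
  refine ⟨X, Y, A, B, s, t, hX, hX0, hY, hY0, hs, hst, ht, hA, hB, hAa, hBb, ?_, ?_⟩
  · by_contra hdep
    rw [LinearIndependent.pair_iff' hX0] at hdep
    push Not at hdep
    obtain ⟨k, hk⟩ := hdep
    have hA' : A = (1 - s + s * k) • X := by
      rw [hA, AffineMap.lineMap_apply_module, ← hk]; module
    have hB' : B = (1 - t + t * k) • X := by
      rw [hB, AffineMap.lineMap_apply_module, ← hk]; module
    have hXa : Represents X a := by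
      have h0 : (1 - s + s * k) ≠ 0 := fun h0 => hAa.1 (by rw [hA', h0, zero_smul])
      have := hAa.smul (inv_ne_zero h0)
      rwa [hA', smul_smul, inv_mul_cancel₀ h0, one_smul] at this
    have hXb : Represents X b := by
      have h0 : (1 - t + t * k) ≠ 0 := fun h0 => hBb.1 (by rw [hB', h0, zero_smul])
      have := hBb.smul (inv_ne_zero h0)
      rwa [hB', smul_smul, inv_mul_cancel₀ h0, one_smul] at this
    obtain ⟨h3, h4⟩ := hXa
    obtain ⟨h5, h6⟩ := hXb
    exact hab (h4.symm.trans h6)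
  · rw [hilbertDist, if_neg hab]
    refine hd.trans ?_
    have d1 : dist Y A = (1 - s) * dist X Y := by
      rw [hA, dist_right_lineMap, Real.norm_of_nonneg (by linarith)]
    have d2 : dist Y B = (1 - t) * dist X Y := by
      rw [hB, dist_right_lineMap, Real.norm_of_nonneg (by linarith)]
    have d3 : dist X A = s * dist X Y := by
      rw [hA, dist_left_lineMap, Real.norm_of_nonneg (by linarith)]
    have d4 : dist X B = t * dist X Y := by
      rw [hB, dist_left_lineMap, Real.norm_of_nonneg (by linarith)]
    have ht0 : 0 < t := hs.trans hst
    have ht1 : 0 < 1 - t := by linarith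
    have hs1 : 0 < 1 - s := by linarith
    rw [d1, d2, d3, d4, ← mul_sub, ← Real.log_div (by positivity) (by positivity)]
    congr 2
    field_simp

/-- One interior point on the open segment suffices: subtract a small multiple of it, and what
remains is still a nonnegative combination of `X` and `Y`. -/
theorem combo_mem_interior {X Y : V} (hX : X ∈ K) (hY : Y ∈ K) {s : ℝ} (hs0 : 0 < s) (hs1 : s < 1)
    (hA : AffineMap.lineMap X Y s ∈ interior (K : Set V)) {α β : ℝ} (hα : 0 < α) (hβ : 0 < β) :
    α • X + β • Y ∈ interior (K : Set V) := by
  set c := min α β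
  have hc : 0 < c := lt_min hα hβ
  have h1 : c * (1 - s) ≤ α := by nlinarith [min_le_left α β]
  have h2 : c * s ≤ β := by nlinarith [min_le_right α β]
  have h3 : α • X + β • Y = c • AffineMap.lineMap X Y s +
      ((α - c * (1 - s)) • X + (β - c * s) • Y) := by
    rw [AffineMap.lineMap_apply_module]; module
  rw [h3]
  exact add_mem_interior_cone (smul_mem_interior_cone hA hc)
    (add_mem_cone (K.smul_mem hX (by linarith)) (K.smul_mem hY (by linarith)))

theorem mem_interior_of_represents {Ω : Set (ℙ ℝ V)} (h : IsProperConvexDomain Ω K) {a : ℙ ℝ V}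
    (ha : a ∈ Ω) {v : V} (hv : v ∈ K) (hva : Represents v a) : v ∈ interior (K : Set V) := by
  obtain ⟨u, hu, hua⟩ := (h.mem_iff a).1 ha
  obtain ⟨c, hc, rfl⟩ := hua.exists_smul_eq hva
  exact smul_mem_interior_cone hu (pos_of_smul_mem_cone h.salient (interior_subset hu) hv hua.1 hc)

end Cone

/-- The lift of a proper convex domain has a logarithmically homogeneous potential. -/
theorem IsConvexLift.exists_isLogPotential {V : Type*} [NormedAddCommGroup V]
    [InnerProductSpace ℝ V] [Nontrivial V] {Ω : Set (ℙ ℝ V)} {K : ProperCone ℝ V} {f : ℙ ℝ V → V}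
    (hΩ : IsProperConvexDomain Ω K) (hf : IsConvexLift Ω K f) :
    IsLogPotential (interior (K : Set V)) f
      (fun v => Real.log ‖pullback f v‖ - Real.log ‖v‖) := by
  have hne : ∀ v ∈ interior (K : Set V), v ≠ 0 := fun v hv h0 =>
    zero_notMem_interior_cone hΩ.salient (h0 ▸ hv)
  have hpb : ∀ v ∈ interior (K : Set V), ∃ c : ℝ, 0 < c ∧ pullback f v = c • v := by
    intro v hv
    have hv0 := hne v hv
    have hmem : Projectivization.mk ℝ v hv0 ∈ Ω := (hΩ.mem_iff _).2 ⟨v, hv, hv0, rfl⟩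
    have h1 := hf.represents _ hmem
    obtain ⟨c, hc, hcv⟩ := Represents.exists_smul_eq ⟨hv0, rfl⟩ h1
    have h2 := interior_subset (hf.mem_interior _ hmem)
    rw [hcv] at h2
    refine ⟨c, pos_of_smul_mem_cone hΩ.salient (interior_subset hv) h2 hv0 hc, ?_⟩
    rw [pullback, dif_pos hv0, hcv]
  refine ⟨isOpen_interior, fun v hv c hc => smul_mem_interior_cone hv hc, hne, ?_, ?_, ?_⟩
  · have h0 : ∀ v ∈ interior (K : Set V), pullback f v ≠ 0 := fun v hv => by
      obtain ⟨c, hc, hcv⟩ := hpb v hv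
      rw [hcv]; exact smul_ne_zero hc.ne' (hne v hv)
    -- The norm comes from an inner product, hence is smooth away from the origin.
    exact ((hf.contDiffOn.norm ℝ h0).log fun v hv => norm_ne_zero_iff.2 (h0 v hv)).sub
      ((contDiffOn_id.norm ℝ hne).log fun v hv => norm_ne_zero_iff.2 (hne v hv))
  · intro v hv c hc
    have hv0 := hne v hv
    have h1 : pullback f (c • v) = pullback f v := by
      rw [pullback, pullback, dif_pos hv0, dif_pos (smul_ne_zero hc.ne' hv0)]
      congr 1
      exact (Projectivization.mk_eq_mk_iff' ℝ _ _ _ hv0).2 ⟨c, rfl⟩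
    simp only [h1, norm_smul, Real.norm_of_nonneg hc.le]
    rw [Real.log_mul hc.ne' (norm_ne_zero_iff.2 hv0)]
    ring
  · intro v hv
    obtain ⟨c, hc, hcv⟩ := hpb v hv
    have hv0 : 0 < ‖v‖ := norm_pos_iff.2 (hne v hv)
    rw [hcv, norm_smul, Real.norm_of_nonneg hc.le, Real.log_mul hc.ne' hv0.ne', add_sub_cancel_right,
      Real.exp_log hc]

/-! ### Restriction to a projective line. -/

section Plane

variable {U : Set V} {f : ℙ ℝ V → V} {G : V → ℝ} {X Y : V}

/-- The parametrization of the segment between `X` and `Y` by the Hilbert arc length. -/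
noncomputable def planeCurve (X Y : V) (t : ℝ) : V := Real.exp (-t) • X + Real.exp t • Y

/-- The velocity of `planeCurve`. -/
noncomputable def planeVelocity (X Y : V) (t : ℝ) : V := Real.exp t • Y - Real.exp (-t) • X

theorem hasDerivAt_planeCurve (t : ℝ) : HasDerivAt (planeCurve X Y) (planeVelocity X Y t) t := by
  have h1 : HasDerivAt (fun t : ℝ => Real.exp (-t)) (-Real.exp (-t)) t := by
    simpa using (hasDerivAt_neg t).exp
  have h2 := (h1.smul_const X).fun_add ((Real.hasDerivAt_exp t).smul_const Y)
  refine HasDerivAt.congr_deriv (f := planeCurve X Y) h2 ?_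
  rw [planeVelocity]; module

theorem hasDerivAt_planeVelocity (t : ℝ) : HasDerivAt (planeVelocity X Y) (planeCurve X Y t) t := by
  have h1 : HasDerivAt (fun t : ℝ => Real.exp (-t)) (-Real.exp (-t)) t := by
    simpa using (hasDerivAt_neg t).exp
  have h2 := ((Real.hasDerivAt_exp t).smul_const Y).fun_sub (h1.smul_const X)
  refine HasDerivAt.congr_deriv (f := planeVelocity X Y) h2 ?_
  rw [planeCurve]; module

/-- The speed of `planeCurve` in the centro-affine metric. -/
noncomputable def planeSpeed (G : V → ℝ) (X Y : V) (t : ℝ) : ℝ :=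
  √(potentialMetric G (planeCurve X Y t) (planeVelocity X Y t) (planeVelocity X Y t))

theorem IsLogPotential.continuous_planeSpeed (h : IsLogPotential U f G)
    (hU : ∀ t, planeCurve X Y t ∈ U) : Continuous (planeSpeed G X Y) := by
  refine Continuous.sqrt (continuous_iff_continuousAt.2 fun t => ?_)
  exact (h.hasDerivAt_potentialMetric (hU t) (hasDerivAt_planeCurve t)
    (hasDerivAt_planeVelocity t)).continuousAt

/-- Turns the one-sided bound on the cubic form into a bound on its absolute value. -/
theorem IsLogPotential.cubicForm_neg (h : IsLogPotential U f G) {v : V} (hv : v ∈ U) (w : V) :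
    cubicForm f v (-w) = -cubicForm f v w := by
  rw [h.cubicForm_eq hv, h.cubicForm_eq hv]
  have : ∀ u, potentialMetric G u (-w) (-w) = potentialMetric G u w w := fun u => by
    simp [potentialMetric]
  simp only [this, map_neg]
  ring

/-- Along a projective line, the centro-affine geometry is described by a trajectory of the control
system. -/
theorem IsLogPotential.isTrajectory {γ : ℝ} (h : IsLogPotential U f G)
    (hU : ∀ t, planeCurve X Y t ∈ U)
    (hpos : ∀ t, 0 < metric f (planeCurve X Y t) (planeVelocity X Y t) (planeVelocity X Y t))
    (hC : ∀ v ∈ U, ∀ w : V, cubicForm f v w ≤ 2 * γ * (metric f v w w) ^ (3 / 2 : ℝ)) :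
    IsTrajectory γ (fun t => fderiv ℝ G (planeCurve X Y t) (planeVelocity X Y t))
      (planeSpeed G X Y) := by
  have hpos' : ∀ t, 0 < potentialMetric G (planeCurve X Y t) (planeVelocity X Y t)
      (planeVelocity X Y t) := fun t => by rw [← h.metric_eq (hU t)]; exact hpos t
  have hsq : ∀ t, planeSpeed G X Y t ^ 2 = potentialMetric G (planeCurve X Y t)
      (planeVelocity X Y t) (planeVelocity X Y t) := fun t => Real.sq_sqrt (hpos' t).le
  have hq : ∀ t, 0 < planeSpeed G X Y t := fun t => Real.sqrt_pos.2 (hpos' t)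
  refine ⟨hq, fun t => ?_, fun t => ?_⟩
  · have h1 := DifferentiableAt.hasDerivAt_comp_curve (W := V →L[ℝ] ℝ)
      (h.hasFDerivAt_fderiv (hU t)).differentiableAt (hasDerivAt_planeCurve t)
    have h2 := h1.clm_apply (hasDerivAt_planeVelocity (X := X) (Y := Y) t)
    refine h2.congr_deriv ?_
    rw [hsq, potentialMetric, h.fderiv_self (hU t)]
    ring
  · have h1 := h.hasDerivAt_potentialMetric (hU t) (hasDerivAt_planeCurve t)
      (hasDerivAt_planeVelocity (X := X) (Y := Y) t)
    have h2 := HasDerivAt.congr_deriv (f := planeSpeed G X Y) (h1.sqrt (hpos' t).ne') rfl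
    -- The derivative of the velocity is the position vector, which contributes nothing.
    rw [h.potentialMetric_self_left (hU t)] at h2
    set v := planeCurve X Y t
    set w := planeVelocity X Y t
    have h3 := h.cubicForm_eq (hU t) w
    have hqt := hq t
    have hm32 : (metric f v w w) ^ (3 / 2 : ℝ) = planeSpeed G X Y t ^ 3 := by
      rw [h.metric_eq (hU t), ← hsq, ← Real.rpow_natCast _ 2, ← Real.rpow_mul hqt.le,
        ← Real.rpow_natCast _ 3]
      norm_num
    have hm32' : (metric f v (-w) (-w)) ^ (3 / 2 : ℝ) = planeSpeed G X Y t ^ 3 := by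
      rw [← hm32, h.metric_eq (hU t), h.metric_eq (hU t)]
      simp [potentialMetric]
    have c1 := hC v (hU t) w
    have c2 := hC v (hU t) (-w)
    rw [hm32] at c1
    rw [hm32', h.cubicForm_neg (hU t)] at c2
    refine ⟨cubicForm f v w / (2 * planeSpeed G X Y t ^ 3), ?_, h2.congr_deriv ?_⟩
    · rw [abs_le, le_div_iff₀ (by positivity), div_le_iff₀ (by positivity)]
      constructor <;> linarith
    · have h4 : √(potentialMetric G v w w) = planeSpeed G X Y t := rfl
      have h5 : fderiv ℝ (fun u => potentialMetric G u w w) v w = cubicForm f v w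
        + 4 * fderiv ℝ G v w * planeSpeed G X Y t ^ 2 := by rw [h3, hsq]; ring
      rw [h4, h5]
      field_simp
      ring

/-- The length of a segment is the integral of the speed in the Hilbert arc length. -/
theorem IsLogPotential.segmentLength_eq (h : IsLogPotential U f G)
    (hU : ∀ t, planeCurve X Y t ∈ U) {a b : ℙ ℝ V} {α₀ β₀ α₁ β₁ : ℝ} (hα₀ : 0 < α₀) (hβ₀ : 0 < β₀)
    (hα₁ : 0 < α₁) (hβ₁ : 0 < β₁) (hlt : β₀ * α₁ < β₁ * α₀) (ha : f a = α₀ • X + β₀ • Y)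
    (hb : f b = α₁ • X + β₁ • Y) :
    segmentLength f a b =
      ∫ t in (1 / 2 * Real.log (β₀ / α₀))..(1 / 2 * Real.log (β₁ / α₁)), planeSpeed G X Y t := by
  set α : ℝ → ℝ := fun r => (1 - r) * α₀ + r * α₁ with hα
  set β : ℝ → ℝ := fun r => (1 - r) * β₀ + r * β₁ with hβ
  have hαpos : ∀ r ∈ Icc (0 : ℝ) 1, 0 < α r := fun r hr => by
    rcases hr.1.eq_or_lt with h0 | h0
    · simp [hα, ← h0, hα₀]
    · have := mul_pos h0 hα₁
      have := mul_nonneg (sub_nonneg.2 hr.2) hα₀.le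
      simp only [hα]; linarith
  have hβpos : ∀ r ∈ Icc (0 : ℝ) 1, 0 < β r := fun r hr => by
    rcases hr.1.eq_or_lt with h0 | h0
    · simp [hβ, ← h0, hβ₀]
    · have := mul_pos h0 hβ₁
      have := mul_nonneg (sub_nonneg.2 hr.2) hβ₀.le
      simp only [hβ]; linarith
  have hdα : ∀ r, HasDerivAt α (α₁ - α₀) r := fun r => by
    have := (((hasDerivAt_id r).const_sub 1).mul_const α₀).fun_add
      ((hasDerivAt_id r).mul_const α₁)
    exact this.congr_deriv (by ring)
  have hdβ : ∀ r, HasDerivAt β (β₁ - β₀) r := fun r => by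
    have := (((hasDerivAt_id r).const_sub 1).mul_const β₀).fun_add
      ((hasDerivAt_id r).mul_const β₁)
    exact this.congr_deriv (by ring)
  set τ : ℝ → ℝ := fun r => 1 / 2 * Real.log (β r / α r) with hτ
  set τ' : ℝ → ℝ := fun r => 1 / 2 * ((β₁ - β₀) / β r - (α₁ - α₀) / α r) with hτ'
  have hdτ : ∀ r ∈ Icc (0 : ℝ) 1, HasDerivAt τ (τ' r) r := by
    intro r hr
    have h1 := hαpos r hr
    have h2 := hβpos r hr
    have h3 := (((hdβ r).fun_div (hdα r) h1.ne').log (by positivity)).const_mul (1 / 2)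
    refine h3.congr_deriv ?_
    simp only [hτ']
    field_simp
  have hτ'pos : ∀ r ∈ Icc (0 : ℝ) 1, 0 ≤ τ' r := by
    intro r hr
    have h1 := hαpos r hr
    have h2 := hβpos r hr
    refine mul_nonneg (by norm_num) (sub_nonneg.2 ?_)
    rw [div_le_div_iff₀ h1 h2]
    simp only [hα, hβ]
    nlinarith
  have hcurve : ∀ r ∈ Icc (0 : ℝ) 1, √(metric f (AffineMap.lineMap (f a) (f b) r)
      (deriv (fun t : ℝ => AffineMap.lineMap (f a) (f b) t) r)
      (deriv (fun t : ℝ => AffineMap.lineMap (f a) (f b) t) r)) =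
      (planeSpeed G X Y ∘ τ) r * τ' r := by
    intro r hr
    have h1 := hαpos r hr
    have h2 := hβpos r hr
    -- The factor `√(αβ)` rescales `planeCurve` at `τ` to the point `α X + β Y` of the segment.
    have hk : 0 < √(α r * β r) := Real.sqrt_pos.2 (by positivity)
    have hexp : Real.exp (τ r) = √(β r / α r) := by
      simp only [hτ]
      rw [mul_comm, Real.exp_mul, Real.exp_log (by positivity), ← Real.sqrt_eq_rpow]
    have e1 : √(α r * β r) * Real.exp (τ r) = β r := by
      rw [hexp, ← Real.sqrt_mul (by positivity)]
      rw [show α r * β r * (β r / α r) = β r ^ 2 by field_simp, Real.sqrt_sq h2.le]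
    have e2 : √(α r * β r) * Real.exp (-τ r) = α r := by
      rw [Real.exp_neg, hexp, ← Real.sqrt_inv, ← Real.sqrt_mul (by positivity)]
      rw [show α r * β r * (β r / α r)⁻¹ = α r ^ 2 by field_simp, Real.sqrt_sq h1.le]
    have hpt : AffineMap.lineMap (f a) (f b) r = √(α r * β r) • planeCurve X Y (τ r) := by
      rw [planeCurve, smul_add (√(α r * β r)), smul_smul, smul_smul, e1, e2,
        AffineMap.lineMap_apply_module, ha, hb]
      simp only [hα, hβ]
      module
    have hder : deriv (fun t : ℝ => AffineMap.lineMap (f a) (f b) t) r = √(α r * β r) •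
        (τ' r • planeVelocity X Y (τ r) +
          (1 / 2 * ((β₁ - β₀) / β r + (α₁ - α₀) / α r)) • planeCurve X Y (τ r)) := by
      have h3 : deriv (fun t : ℝ => AffineMap.lineMap (f a) (f b) t) r = f b - f a :=
        AffineMap.hasDerivAt_lineMap.deriv
      have h4 : √(α r * β r) • (τ' r • planeVelocity X Y (τ r) +
          (1 / 2 * ((β₁ - β₀) / β r + (α₁ - α₀) / α r)) • planeCurve X Y (τ r)) =
          ((α₁ - α₀) / α r * (√(α r * β r) * Real.exp (-τ r))) • X +
          ((β₁ - β₀) / β r * (√(α r * β r) * Real.exp (τ r))) • Y := by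
        rw [planeVelocity, planeCurve]
        simp only [hτ']
        module
      rw [h3, h4, e1, e2, ha, hb, div_mul_cancel₀ _ h1.ne', div_mul_cancel₀ _ h2.ne']
      module
    rw [hpt, hder, h.metric_eq (h.smul_mem _ (hU _) _ hk), h.potentialMetric_smul (hU _) hk,
      Real.sqrt_mul (sq_nonneg _), Real.sqrt_sq (hτ'pos r hr), mul_comm]
    rfl
  rw [segmentLength, curveLength,
    intervalIntegral.integral_congr (g := fun r => (planeSpeed G X Y ∘ τ) r * τ' r)
      (fun r hr => hcurve r (by rwa [uIcc_of_le zero_le_one] at hr)),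
    intervalIntegral.integral_comp_mul_deriv (f := τ) (f' := τ')
      (fun r hr => hdτ r (by rwa [uIcc_of_le zero_le_one] at hr)) ?_
      (h.continuous_planeSpeed hU)]
  · simp [hτ, hα, hβ]
  · rw [uIcc_of_le zero_le_one]
    have c1 : Continuous α := continuous_iff_continuousAt.2 fun r => (hdα r).continuousAt
    have c2 : Continuous β := continuous_iff_continuousAt.2 fun r => (hdβ r).continuousAt
    exact continuousOn_const.mul ((continuousOn_const.div c2.continuousOn
      fun r hr => (hβpos r hr).ne').sub (continuousOn_const.div c1.continuousOn
      fun r hr => (hαpos r hr).ne'))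

end Plane

theorem curveLength_nonneg (f : ℙ ℝ V → V) (c : ℝ → V) : 0 ≤ curveLength f c :=
  intervalIntegral.integral_nonneg zero_le_one fun _ _ => Real.sqrt_nonneg _

theorem geodesicDist_le_segmentLength {K : ProperCone ℝ V} {f : ℙ ℝ V → V} {a b : ℙ ℝ V}
    (ha : f a ∈ interior (K : Set V)) (hb : f b ∈ interior (K : Set V)) :
    geodesicDist K f a b ≤ segmentLength f a b := by
  refine csInf_le ⟨0, ?_⟩ ⟨fun t => AffineMap.lineMap (f a) (f b) t, ?_, ?_, by simp, by simp, rfl⟩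
  · rintro _ ⟨c, -, -, -, -, rfl⟩
    exact curveLength_nonneg f c
  · simp only [AffineMap.lineMap_apply_module]
    fun_prop
  · intro t ht
    exact K.convex.interior.lineMap_mem ha hb ht

/-- The length of a segment in a proper convex domain with bounded cubic form. -/
theorem segmentLength_lt_lengthBound {V : Type*} [NormedAddCommGroup V] [InnerProductSpace ℝ V]
    [Nontrivial V] {Ω : Set (ℙ ℝ V)} {K : ProperCone ℝ V} {f : ℙ ℝ V → V} {μ : ℝ} (hμ : 1 < μ)
    (hΩ : IsProperConvexDomain Ω K) (hf : IsConvexLift Ω K f) (hC : CubicFormBound K f (μ - 1 / μ))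
    {a b : ℙ ℝ V} (ha : a ∈ Ω) (hb : b ∈ Ω) (hab : a ≠ b) :
    0 < hilbertDist K a b ∧ segmentLength f a b < lengthBound μ (hilbertDist K a b) := by
  have h := hf.exists_isLogPotential hΩ
  set G : V → ℝ := fun v => Real.log ‖pullback f v‖ - Real.log ‖v‖
  obtain ⟨X, Y, A, B, s, t, hX, hX0, hY, hY0, hs, hst, ht, hA, hB, hAa, hBb, hind, hd⟩ :=
    hilbertDist_spec hΩ ha hb hab
  have hmem : ∀ {x : V}, x ∈ frontier (K : Set V) → x ∈ K := fun hx => by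
    rw [frontier, K.isClosed.closure_eq] at hx; exact hx.1
  have hseg : ∀ {r : ℝ}, 0 < r → r < 1 → AffineMap.lineMap X Y r ∈ K := fun {r} h0 h1 => by
    rw [AffineMap.lineMap_apply_module]
    exact add_mem_cone (K.smul_mem (hmem hX) (by linarith)) (K.smul_mem (hmem hY) h0.le)
  have ht0 : 0 < t := hs.trans hst
  have hs1 : s < 1 := hst.trans ht
  have hAi : A ∈ interior (K : Set V) :=
    mem_interior_of_represents hΩ ha (hA ▸ hseg hs hs1) hAa
  have hBi : B ∈ interior (K : Set V) :=
    mem_interior_of_represents hΩ hb (hB ▸ hseg ht0 ht) hBb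
  have hU : ∀ r, planeCurve X Y r ∈ interior (K : Set V) := fun r =>
    combo_mem_interior (hmem hX) (hmem hY) hs hs1 (hA ▸ hAi) (Real.exp_pos _) (Real.exp_pos _)
  have htraj := h.isTrajectory hU (fun r => hf.metric_pos _ (hU r) _ (fun hspan => ?_)) hC
  swap
  · obtain ⟨k, hk⟩ := Submodule.mem_span_singleton.1 hspan
    have h1 : (k * Real.exp (-r) + Real.exp (-r)) • X + (k * Real.exp r - Real.exp r) • Y = 0 := by
      have := sub_eq_zero.2 hk
      rw [planeCurve, planeVelocity] at this
      rw [← this]; module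
    obtain ⟨h2, h3⟩ := LinearIndependent.pair_iff.1 hind _ _ h1
    have h4 := Real.exp_pos r
    have h5 := Real.exp_pos (-r)
    nlinarith
  obtain ⟨c₀, hc₀, hfa⟩ := hAa.exists_smul_eq (hf.represents a ha)
  obtain ⟨c₁, hc₁, hfb⟩ := hBb.exists_smul_eq (hf.represents b hb)
  have hc₀' : 0 < c₀ := pos_of_smul_mem_cone hΩ.salient (interior_subset hAi)
    (hfa ▸ interior_subset (hf.mem_interior a ha)) hAa.1 hc₀
  have hc₁' : 0 < c₁ := pos_of_smul_mem_cone hΩ.salient (interior_subset hBi)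
    (hfb ▸ interior_subset (hf.mem_interior b hb)) hBb.1 hc₁
  have hs' : 0 < 1 - s := by linarith
  have ht' : 0 < 1 - t := by linarith
  have hlen := h.segmentLength_eq (X := X) (Y := Y) hU (a := a) (b := b)
    (α₀ := c₀ * (1 - s)) (β₀ := c₀ * s) (α₁ := c₁ * (1 - t)) (β₁ := c₁ * t)
    (by positivity) (by positivity) (by positivity) (by positivity)
    (by have : 0 < c₀ * c₁ * (t - s) := by
          have : 0 < t - s := by linarith
          positivity
        nlinarith)
    (by rw [hfa, hA, AffineMap.lineMap_apply_module]; module)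
    (by rw [hfb, hB, AffineMap.lineMap_apply_module]; module)
  rw [mul_div_mul_left _ _ hc₀, mul_div_mul_left _ _ hc₁] at hlen
  have hlt : 1 / 2 * Real.log (s / (1 - s)) < 1 / 2 * Real.log (t / (1 - t)) := by
    have : Real.log (s / (1 - s)) < Real.log (t / (1 - t)) := by
      refine Real.log_lt_log (by positivity) ?_
      rw [div_lt_div_iff₀ hs' ht']
      nlinarith
    linarith
  rw [hd, hlen]
  exact ⟨by linarith, htraj.integral_lt_lengthBound hμ hlt⟩

end CentroAffine

/-! ### The extremals as trajectories with piecewise continuous control. -/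

/-- The pair `(p, q)` solves the control system near `t` with a control which has right limits, and
lies in the region on which the cubic form of the rotationally symmetric lift is bounded. -/
structure IsWeakTrajectoryAt (μ : ℝ) (p q : ℝ → ℝ) (t : ℝ) : Prop where
  continuousAt : ContinuousAt q t
  hasDerivAt_fst : HasDerivAt p (p t ^ 2 + q t ^ 2 - 1) t
  hasDerivWithinAt_snd : ∃ u, |u| ≤ μ - 1 / μ ∧
    HasDerivWithinAt q (2 * p t * q t + u * q t ^ 2) (Ici t) t
  le_left : 1 - p t ≤ μ * q t
  le_right : 1 + p t ≤ μ * q t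
  left_le : q t ≤ μ * (1 + p t)
  right_le : q t ≤ μ * (1 - p t)

namespace IsWeakTrajectoryAt

variable {μ c t : ℝ} {p q p₁ q₁ p₂ q₂ : ℝ → ℝ}

/-- `f` before the time `c` and `g` afterwards. -/
noncomputable def glue (c : ℝ) (f g : ℝ → ℝ) (t : ℝ) : ℝ := if t < c then f t else g t

theorem glue_of_ge (f g : ℝ → ℝ) (h : c ≤ t) : glue c f g t = g t := if_neg h.not_gt

theorem glue_of_le {f g : ℝ → ℝ} (hc : f c = g c) (h : t ≤ c) : glue c f g t = f t := by
  rcases h.lt_or_eq with h | rfl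
  · exact if_pos h
  · rw [glue_of_ge f g le_rfl, hc]

theorem hasDerivAt_glue {f g : ℝ → ℝ} {d : ℝ} (hc : f c = g c) (hf : t ≤ c → HasDerivAt f d t)
    (hg : c ≤ t → HasDerivAt g d t) : HasDerivAt (glue c f g) d t := by
  rcases lt_trichotomy t c with h | rfl | h
  · refine (hf h.le).congr_of_eventuallyEq ?_
    filter_upwards [gt_mem_nhds h] with s hs
    exact if_pos hs
  · have h1 : HasDerivWithinAt (glue t f g) d (Iic t) t :=
      (hf le_rfl).hasDerivWithinAt.congr (fun s hs => glue_of_le hc hs) (glue_of_le hc le_rfl)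
    have h2 : HasDerivWithinAt (glue t f g) d (Ici t) t :=
      (hg le_rfl).hasDerivWithinAt.congr (fun s hs => glue_of_ge f g hs) (glue_of_ge f g le_rfl)
    have := h1.union h2
    rwa [Iic_union_Ici, hasDerivWithinAt_univ] at this
  · refine (hg h.le).congr_of_eventuallyEq ?_
    filter_upwards [lt_mem_nhds h] with s hs
    exact glue_of_ge f g hs.le

theorem continuousAt_glue {f g : ℝ → ℝ} (hc : f c = g c) (hf : t ≤ c → ContinuousAt f t)
    (hg : c ≤ t → ContinuousAt g t) : ContinuousAt (glue c f g) t := by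
  rcases lt_trichotomy t c with h | rfl | h
  · refine (hf h.le).congr ?_
    filter_upwards [gt_mem_nhds h] with s hs
    exact (if_pos hs).symm
  · have h1 : ContinuousWithinAt (glue t f g) (Iic t) t :=
      (hf le_rfl).continuousWithinAt.congr (fun s hs => glue_of_le hc hs) (glue_of_le hc le_rfl)
    have h2 : ContinuousWithinAt (glue t f g) (Ici t) t :=
      (hg le_rfl).continuousWithinAt.congr (fun s hs => glue_of_ge f g hs) (glue_of_ge f g le_rfl)
    have := h1.union h2
    rwa [Iic_union_Ici, continuousWithinAt_univ] at this
  · refine (hg h.le).congr ?_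
    filter_upwards [lt_mem_nhds h] with s hs
    exact (glue_of_ge f g hs.le).symm

/-- The control may jump at the gluing time, so `q` keeps only a right derivative. The derivative of
`p` depends on the values of `p` and `q` alone and thus matches from both sides. -/
theorem glue_at (hp : p₁ c = p₂ c) (hq : q₁ c = q₂ c)
    (h₁ : t ≤ c → IsWeakTrajectoryAt μ p₁ q₁ t) (h₂ : c ≤ t → IsWeakTrajectoryAt μ p₂ q₂ t) :
    IsWeakTrajectoryAt μ (glue c p₁ p₂) (glue c q₁ q₂) t := by
  have hcont : ContinuousAt (glue c q₁ q₂) t :=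
    continuousAt_glue hq (fun h => (h₁ h).continuousAt) (fun h => (h₂ h).continuousAt)
  have hder : HasDerivAt (glue c p₁ p₂) (glue c p₁ p₂ t ^ 2 + glue c q₁ q₂ t ^ 2 - 1) t := by
    refine hasDerivAt_glue hp (fun h => ?_) (fun h => ?_)
    · rw [glue_of_le hp h, glue_of_le hq h]; exact (h₁ h).hasDerivAt_fst
    · rw [glue_of_ge _ _ h, glue_of_ge _ _ h]; exact (h₂ h).hasDerivAt_fst
  rcases lt_or_ge t c with h | h
  · have h3 := h₁ h.le
    obtain ⟨u, hu, hd⟩ := h3.hasDerivWithinAt_snd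
    refine ⟨hcont, hder, ⟨u, hu, ?_⟩, ?_, ?_, ?_, ?_⟩
    · rw [glue_of_le hp h.le, glue_of_le hq h.le]
      refine hd.congr_of_eventuallyEq ?_ (glue_of_le hq h.le)
      filter_upwards [mem_nhdsWithin_of_mem_nhds (gt_mem_nhds h)] with s hs
      exact if_pos hs
    all_goals rw [glue_of_le hp h.le, glue_of_le hq h.le]
    exacts [h3.le_left, h3.le_right, h3.left_le, h3.right_le]
  · have h3 := h₂ h
    obtain ⟨u, hu, hd⟩ := h3.hasDerivWithinAt_snd
    refine ⟨hcont, hder, ⟨u, hu, ?_⟩, ?_, ?_, ?_, ?_⟩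
    · rw [glue_of_ge _ _ h, glue_of_ge _ _ h]
      exact hd.congr (fun s hs => glue_of_ge _ _ (h.trans hs)) (glue_of_ge _ _ h)
    all_goals rw [glue_of_ge _ _ h, glue_of_ge _ _ h]
    exacts [h3.le_left, h3.le_right, h3.left_le, h3.right_le]

theorem of_hasDerivAt {u : ℝ} (hu : |u| ≤ μ - 1 / μ)
    (hq : HasDerivAt q (2 * p t * q t + u * q t ^ 2) t)
    (hp : HasDerivAt p (p t ^ 2 + q t ^ 2 - 1) t) (h₁ : 1 - p t ≤ μ * q t) (h₂ : 1 + p t ≤ μ * q t)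
    (h₃ : q t ≤ μ * (1 + p t)) (h₄ : q t ≤ μ * (1 - p t)) : IsWeakTrajectoryAt μ p q t :=
  ⟨hq.continuousAt, hp, ⟨u, hu, hq.hasDerivWithinAt⟩, h₁, h₂, h₃, h₄⟩

end IsWeakTrajectoryAt

section Pieces

variable {μ A E S a t : ℝ}

/-- The last inequality is an equality, the edge itself. The second and third amount to the
reciprocal speed being at most `(μ² + 1)/(2μ)`, its limit as time grows, and at least `1/μ`, its
value at the tip. -/
theorem edge_constraints (hμ : 1 < μ) (hA : 0 ≤ A) (hy : 1 / μ ≤ edgeRecip μ A t) :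
    1 - (1 - 1 / (μ * edgeRecip μ A t)) ≤ μ * (1 / edgeRecip μ A t) ∧
    1 + (1 - 1 / (μ * edgeRecip μ A t)) ≤ μ * (1 / edgeRecip μ A t) ∧
    1 / edgeRecip μ A t ≤ μ * (1 + (1 - 1 / (μ * edgeRecip μ A t))) ∧
    1 / edgeRecip μ A t ≤ μ * (1 - (1 - 1 / (μ * edgeRecip μ A t))) := by
  have hμ0 : 0 < μ := by linarith
  have hy0 : 0 < edgeRecip μ A t := lt_of_lt_of_le (by positivity) hy
  have hy1 : edgeRecip μ A t ≤ (μ ^ 2 + 1) / (2 * μ) := by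
    have : 0 ≤ A * Real.exp (-2 * t) := by positivity
    unfold edgeRecip; linarith
  set y := edgeRecip μ A t
  rw [div_le_iff₀ hμ0] at hy
  rw [le_div_iff₀ (by positivity)] at hy1
  refine ⟨?_, ?_, ?_, ?_⟩
  · field_simp; nlinarith
  · field_simp; nlinarith
  · field_simp; nlinarith
  · field_simp; simp

theorem isWeakTrajectoryAt_edge (hμ : 1 < μ) (hA : 0 ≤ A) (hy : 1 / μ ≤ edgeRecip μ A t) :
    IsWeakTrajectoryAt μ (fun t => 1 - 1 / (μ * edgeRecip μ A t))
      (fun t => 1 / edgeRecip μ A t) t := by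
  have hy0 : 0 < edgeRecip μ A t := lt_of_lt_of_le (by positivity) hy
  have hc := edge_constraints hμ hA hy
  refine .of_hasDerivAt (u := -(μ - 1 / μ)) ?_ (hasDerivAt_inv_edgeRecip hμ hy0)
    (hasDerivAt_edge_fst hμ hy0) hc.1 hc.2.1 hc.2.2.1 hc.2.2.2
  rw [abs_neg, abs_of_nonneg]
  rw [sub_nonneg, div_le_iff₀ (by linarith)]
  nlinarith

theorem isWeakTrajectoryAt_edge_reverse (hμ : 1 < μ) (hA : 0 ≤ A)
    (hy : 1 / μ ≤ edgeRecip μ A (-t)) :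
    IsWeakTrajectoryAt μ (fun t => -(1 - 1 / (μ * edgeRecip μ A (-t))))
      (fun t => 1 / edgeRecip μ A (-t)) t := by
  have hy0 : 0 < edgeRecip μ A (-t) := lt_of_lt_of_le (by positivity) hy
  have hc := edge_constraints hμ hA hy
  refine .of_hasDerivAt (u := (μ - 1 / μ)) ?_ ?_ ?_ ?_ ?_ ?_ ?_
  · rw [abs_of_nonneg]
    rw [sub_nonneg, div_le_iff₀ (by linarith)]
    nlinarith
  · have := (hasDerivAt_inv_edgeRecip hμ hy0).scomp t (hasDerivAt_neg t)
    exact this.congr_deriv (by rw [neg_one_smul]; ring)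
  · have := ((hasDerivAt_edge_fst hμ hy0).scomp t (hasDerivAt_neg t)).neg
    exact this.congr_deriv (by rw [neg_one_smul]; ring)
  · linarith [hc.2.1]
  · linarith [hc.1]
  · linarith [hc.2.2.2]
  · linarith [hc.2.2.1]

theorem IsSwitch.isWeakTrajectoryAt {T : ℝ} (h : IsSwitch μ T E S a) (ht : t ∈ Icc (-a) a) :
    IsWeakTrajectoryAt μ (fun t => Real.sinh (2 * t) / (E - Real.cosh (2 * t)))
      (fun t => S / (E - Real.cosh (2 * t))) t := by
  have hμ := h.one_lt
  have hμ0 : 0 < μ := by linarith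
  have hle : ∀ {s}, s ∈ Icc (-a) a → Real.exp (2 * s) ≤ E - S / μ := fun {s} hs => by
    rw [← h.exp_switch, Real.exp_le_exp]; linarith [hs.2]
  have hge : ∀ {s}, s ∈ Icc (-a) a → E - Real.exp (2 * s) ≤ μ * S := fun {s} hs => by
    have h1 : Real.exp (-(2 * a)) ≤ Real.exp (2 * s) := by
      rw [Real.exp_le_exp]; linarith [hs.1]
    refine (sub_le_sub_left h1 E).trans ?_
    have h2 := Real.exp_pos (2 * a)
    rw [Real.exp_neg, sub_le_iff_le_add, ← sub_le_iff_le_add', ← one_div, le_div_iff₀ h2]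
    rw [h.exp_switch] at h2 ⊢
    have h4 := h.S_sq
    have h5 := h.S_lt
    have h6 := h.S_pos
    have h7 : (E - μ * S) * (E - S / μ) = E ^ 2 + S ^ 2 - E * S * (μ + 1 / μ) := by
      field_simp; ring
    have h8 : 2 ≤ μ + 1 / μ := by
      have : μ + 1 / μ - 2 = (μ - 1) ^ 2 / μ := by field_simp; ring
      have : 0 ≤ (μ - 1) ^ 2 / μ := by positivity
      linarith
    have h9 : 2 * (S * S) ≤ (μ + 1 / μ) * (E * S) := by
      have : S * S ≤ E * S := by nlinarith
      have : 0 < E * S := mul_pos (h6.trans h5) h6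
      nlinarith
    rw [h7]
    nlinarith
  have hneg : -t ∈ Icc (-a) a := ⟨by linarith [ht.2], by linarith [ht.1]⟩
  have hpos : 0 < E - Real.cosh (2 * t) := by
    have h1 : Real.cosh (2 * t) ≤ Real.cosh (2 * a) := by
      rw [Real.cosh_le_cosh, abs_mul, abs_mul]
      have : |t| ≤ |a| := (abs_le.2 ht).trans (le_abs_self a)
      gcongr
    linarith [h.sub_cosh_pos]
  have e1 := Real.cosh_add_sinh (2 * t)
  have e2 := Real.cosh_sub_sinh (2 * t)
  have i1 := hle ht
  have i2 := hle hneg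
  have i3 := hge ht
  have i4 := hge hneg
  rw [← e1] at i1 i3
  rw [mul_neg, ← e2] at i2 i4
  have hS : μ * (S / μ) = S := by field_simp
  refine .of_hasDerivAt (u := 0) ?_ ?_ (hasDerivAt_singular_fst h.S_sq hpos) ?_ ?_ ?_ ?_
  · rw [abs_zero, sub_nonneg, div_le_iff₀ hμ0]
    nlinarith
  · refine (hasDerivAt_singular_snd hpos).congr_deriv (by ring)
  · rw [← mul_div_assoc, one_sub_div hpos.ne', div_le_div_iff_of_pos_right hpos]
    linarith
  · rw [← mul_div_assoc, one_add_div hpos.ne', div_le_div_iff_of_pos_right hpos]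
    linarith
  · rw [one_add_div hpos.ne', ← mul_div_assoc, div_le_div_iff_of_pos_right hpos]
    nlinarith
  · rw [one_sub_div hpos.ne', ← mul_div_assoc, div_le_div_iff_of_pos_right hpos]
    nlinarith

end Pieces

theorem integral_edge {μ A a T : ℝ} (hμ : 1 < μ) (haT : a ≤ T) (hA : 0 ≤ A)
    (hy : 0 < edgeRecip μ A a) :
    (∫ t in a..T, 1 / edgeRecip μ A t) = μ / (μ ^ 2 + 1) *
      (Real.log ((μ ^ 2 + 1) / (2 * μ) * Real.exp (2 * T) - A) -
      Real.log ((μ ^ 2 + 1) / (2 * μ) * Real.exp (2 * a) - A)) := by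
  have hpos : ∀ t ∈ Icc a T, 0 < edgeRecip μ A t := fun t ht => hy.trans_le (edgeRecip_mono hA ht.1)
  rw [intervalIntegral.integral_eq_sub_of_hasDerivAt (fun t ht => hasDerivAt_edge_length hμ
    (hpos t (by rwa [uIcc_of_le haT] at ht))), mul_sub]
  refine ContinuousOn.intervalIntegrable fun t ht => ?_
  exact (hasDerivAt_inv_edgeRecip hμ
    (hpos t (by rwa [uIcc_of_le haT] at ht))).continuousAt.continuousWithinAt

open IsWeakTrajectoryAt in
/-- The extremals of the length functional. -/
theorem exists_isWeakTrajectoryAt {μ T : ℝ} (hμ : 1 < μ) (hT : 0 < T) :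
    ∃ p q : ℝ → ℝ, (∀ t, IsWeakTrajectoryAt μ p q t) ∧
      (∫ t in -T..T, q t) = lengthBound μ (2 * T) := by
  have hμ0 : 0 < μ := by linarith
  rcases le_or_gt (Real.exp (2 * T)) ((μ ^ 2 + 1) / (μ ^ 2 - 1)) with hE | hE
  · set A := (μ ^ 2 + 1) / (2 * μ) - 1 / μ with hA
    have hA0 : 0 ≤ A := by
      have hA' : A = (μ ^ 2 - 1) / (2 * μ) := by rw [hA]; field_simp; ring
      rw [hA']; have : 0 ≤ μ ^ 2 - 1 := by nlinarith
      positivity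
    have hy0 : edgeRecip μ A 0 = 1 / μ := by simp [edgeRecip, hA]
    have hy : ∀ {t}, 0 ≤ t → 1 / μ ≤ edgeRecip μ A t := fun ht => hy0 ▸ edgeRecip_mono hA0 ht
    have hp0 : (fun t => -(1 - 1 / (μ * edgeRecip μ A (-t)))) 0
        = (fun t => 1 - 1 / (μ * edgeRecip μ A t)) 0 := by
      simp only [neg_zero, hy0]; field_simp; simp
    have hq0 : (fun t => 1 / edgeRecip μ A (-t)) 0 = (fun t => 1 / edgeRecip μ A t) 0 := by simp
    have hW : ∀ t, IsWeakTrajectoryAt μ _ _ t := fun t => glue_at hp0 hq0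
      (fun ht => isWeakTrajectoryAt_edge_reverse hμ hA0 (hy (by linarith)))
      (fun ht => isWeakTrajectoryAt_edge hμ hA0 (hy ht))
    refine ⟨_, _, hW, ?_⟩
    have hcont := continuous_iff_continuousAt.2 fun t => (hW t).continuousAt
    rw [← intervalIntegral.integral_add_adjacent_intervals (hcont.intervalIntegrable (-T) 0)
      (hcont.intervalIntegrable 0 T)]
    rw [intervalIntegral.integral_congr (a := -T) (b := 0) (g := fun t => 1 / edgeRecip μ A (-t))
        (fun t ht => ?_),
      intervalIntegral.integral_congr (a := 0) (b := T) (g := fun t => 1 / edgeRecip μ A t)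
        (fun t ht => ?_),
      intervalIntegral.integral_comp_neg (fun t => 1 / edgeRecip μ A t), neg_zero, neg_neg,
      integral_edge hμ hT.le hA0 (by rw [hy0]; positivity), lengthBound_of_exp_le hμ hE,
      ← Real.log_div]
    · have : ((μ ^ 2 + 1) / (2 * μ) * Real.exp (2 * T) - A) /
          ((μ ^ 2 + 1) / (2 * μ) * Real.exp (2 * 0) - A)
          = ((μ ^ 2 + 1) * (Real.exp (2 * T) - 1) + 2) / 2 := by
        rw [mul_zero, Real.exp_zero, hA]
        field_simp
        ring
      rw [this]
      ring
    · rw [edge_add_exp]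
      have : 0 < edgeRecip μ A T := lt_of_lt_of_le (by positivity) (hy hT.le)
      positivity
    · rw [edge_add_exp, hy0]; positivity
    · rw [uIcc_of_le hT.le] at ht
      exact glue_of_ge _ _ ht.1
    · rw [uIcc_of_le (by linarith)] at ht
      exact glue_of_le hq0 ht.2
  · obtain ⟨a, hs⟩ := exists_isSwitch hμ hE
    set E := Real.exp (2 * T) with hEdef
    set S := √(E ^ 2 - 1)
    have hA0 := hs.edgeConst_nonneg
    set A := IsSwitch.edgeConst μ E S
    have ha := hs.pos
    have hya : 1 / μ ≤ edgeRecip μ A a := by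
      have h1 : 0 ≤ Real.sinh (2 * a) / (E - Real.cosh (2 * a)) :=
        div_nonneg (Real.sinh_nonneg_iff.2 (by linarith)) hs.sub_cosh_pos.le
      have h3 := hs.edgeRecip_pos
      rw [hs.fst_switch, sub_nonneg, div_le_one (by positivity)] at h1
      rw [div_le_iff₀ hμ0]; linarith
    have hy : ∀ {t}, a ≤ t → 1 / μ ≤ edgeRecip μ A t := fun ht =>
      hya.trans (edgeRecip_mono hA0 ht)
    have hp1 : (fun t => -(1 - 1 / (μ * edgeRecip μ A (-t)))) (-a)
        = (fun t => Real.sinh (2 * t) / (E - Real.cosh (2 * t))) (-a) := by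
      simp only [neg_neg, mul_neg, Real.sinh_neg, Real.cosh_neg, neg_div, hs.fst_switch]
      rfl
    have hq1 : (fun t => 1 / edgeRecip μ A (-t)) (-a)
        = (fun t => S / (E - Real.cosh (2 * t))) (-a) := by
      simp only [neg_neg, mul_neg, Real.cosh_neg, hs.snd_switch]
      rfl
    have hp2 : glue (-a) (fun t => -(1 - 1 / (μ * edgeRecip μ A (-t))))
        (fun t => Real.sinh (2 * t) / (E - Real.cosh (2 * t))) a
        = (fun t => 1 - 1 / (μ * edgeRecip μ A t)) a := by
      rw [glue_of_ge _ _ (by linarith)]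
      exact hs.fst_switch
    have hq2 : glue (-a) (fun t => 1 / edgeRecip μ A (-t))
        (fun t => S / (E - Real.cosh (2 * t))) a = (fun t => 1 / edgeRecip μ A t) a := by
      rw [glue_of_ge _ _ (by linarith)]
      exact hs.snd_switch
    have hW : ∀ t, IsWeakTrajectoryAt μ _ _ t := fun t => glue_at hp2 hq2
      (fun ht => glue_at hp1 hq1
        (fun ht => isWeakTrajectoryAt_edge_reverse hμ hA0 (hy (by linarith)))
        (fun ht' => hs.isWeakTrajectoryAt ⟨ht', ht⟩))
      (fun ht => isWeakTrajectoryAt_edge hμ hA0 (hy ht))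
    refine ⟨_, _, hW, ?_⟩
    have hcont := continuous_iff_continuousAt.2 fun t => (hW t).continuousAt
    have haT := hs.lt
    rw [← intervalIntegral.integral_add_adjacent_intervals (hcont.intervalIntegrable (-T) a)
      (hcont.intervalIntegrable a T),
      ← intervalIntegral.integral_add_adjacent_intervals (hcont.intervalIntegrable (-T) (-a))
      (hcont.intervalIntegrable (-a) a)]
    have I1 : (∫ t in -a..a, S / (E - Real.cosh (2 * t))) =
        Real.log ((μ - 1) / (μ + 1) * (E + S)) := by
      have hpos : ∀ t ∈ uIcc (-a) a, 0 < E - Real.cosh (2 * t) := fun t ht => by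
        rw [uIcc_of_le (by linarith)] at ht
        have h1 : Real.cosh (2 * t) ≤ Real.cosh (2 * a) := by
          rw [Real.cosh_le_cosh, abs_mul, abs_mul]
          have : |t| ≤ |a| := (abs_le.2 ht).trans (le_abs_self a)
          gcongr
        linarith [hs.sub_cosh_pos]
      rw [intervalIntegral.integral_eq_sub_of_hasDerivAt (fun t ht =>
        hasDerivAt_singular_length hs.S_pos hs.one_lt_E hs.S_sq (hpos t ht))
        (ContinuousOn.intervalIntegrable fun t ht =>
          (hasDerivAt_singular_snd (hpos t ht)).continuousAt.continuousWithinAt), hs.singular_length]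
      have h1 := singular_length_pos hs.S_pos hs.one_lt_E hs.S_sq (hpos a right_mem_uIcc)
      have h2 : (E + S) * Real.exp (2 * -a) - 1 = (E + S - Real.exp (2 * a)) / Real.exp (2 * a) := by
        rw [mul_neg, Real.exp_neg]; field_simp
      have h3 : E + S - Real.exp (2 * -a) = ((E + S) * Real.exp (2 * a) - 1) / Real.exp (2 * a) := by
        rw [mul_neg, Real.exp_neg]; field_simp
      rw [h2, h3, Real.log_div h1.2.ne' (Real.exp_pos _).ne',
        Real.log_div h1.1.ne' (Real.exp_pos _).ne', ← hs.singular_length]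
      ring
    have I2 := integral_edge hμ haT.le hA0 hs.edgeRecip_pos
    rw [hs.edge_length] at I2
    rw [intervalIntegral.integral_congr (a := -T) (b := -a) (g := fun t => 1 / edgeRecip μ A (-t))
        (fun t ht => ?_),
      intervalIntegral.integral_congr (a := -a) (b := a)
        (g := fun t => S / (E - Real.cosh (2 * t))) (fun t ht => ?_),
      intervalIntegral.integral_congr (a := a) (b := T) (g := fun t => 1 / edgeRecip μ A t)
        (fun t ht => ?_),
      intervalIntegral.integral_comp_neg (fun t => 1 / edgeRecip μ A t), neg_neg, neg_neg,
      I1, I2, lengthBound_of_lt_exp hμ hE]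
    · ring
    · rw [uIcc_of_le haT.le] at ht
      exact glue_of_ge _ _ ht.1
    · rw [uIcc_of_le (by linarith)] at ht
      simp only
      rw [glue_of_le hq2 ht.2, glue_of_ge _ _ ht.1]
    · rw [uIcc_of_le (by linarith)] at ht
      simp only
      rw [glue_of_le hq2 (by linarith [ht.2]), glue_of_le hq1 ht.2]

/-! ### Smoothing an extremal. -/

/-- A pair of functions on the line for which the rotationally symmetric lift has a cubic form
bounded by `2γ`: `p` is the derivative of the potential, with derivatives `p₁` and `p₂`. -/
structure IsProfile (μ : ℝ) (p p₁ p₂ : ℝ → ℝ) : Prop where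
  hasDerivAt : ∀ t, HasDerivAt p (p₁ t) t
  hasDerivAt_deriv : ∀ t, HasDerivAt p₁ (p₂ t) t
  continuous_deriv : Continuous p₂
  lt_one : ∀ t, p t < 1
  neg_one_lt : ∀ t, -1 < p t
  metric_pos : ∀ t, 0 < p₁ t + 1 - p t ^ 2
  cubic_le : ∀ t, |p₂ t - 6 * p t * p₁ t - 4 * p t + 4 * p t ^ 3|
    ≤ 2 * (μ - 1 / μ) * √(p₁ t + 1 - p t ^ 2) ^ 3
  le_left : ∀ t, 1 + p t ≤ μ * √(p₁ t + 1 - p t ^ 2)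
  left_le : ∀ t, √(p₁ t + 1 - p t ^ 2) ≤ μ * (1 + p t)

/-- The region in which weak trajectories run. -/
def weakRegion (μ : ℝ) : Set (ℝ × ℝ) :=
  {x | 1 - x.1 ≤ μ * x.2 ∧ 1 + x.1 ≤ μ * x.2 ∧ x.2 ≤ μ * (1 + x.1) ∧ x.2 ≤ μ * (1 - x.1)}

theorem weakRegion_bounds {μ : ℝ} (hμ : 1 < μ) {x : ℝ × ℝ} (hx : x ∈ weakRegion μ) :
    |x.1| < 1 ∧ 0 < x.2 ∧ x.2 ≤ μ := by
  obtain ⟨h1, h2, h3, h4⟩ := hx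
  have hq : 0 < x.2 := by
    by_contra! h
    nlinarith
  refine ⟨abs_lt.2 ⟨?_, ?_⟩, hq, by nlinarith⟩ <;> nlinarith

theorem isCompact_weakRegion {μ : ℝ} (hμ : 1 < μ) : IsCompact (weakRegion μ) := by
  refine (isCompact_Icc (a := (-1 : ℝ)) (b := 1)).prod (isCompact_Icc (a := (0 : ℝ)) (b := μ))
    |>.of_isClosed_subset ?_ ?_
  · have c1 : IsClosed {x : ℝ × ℝ | 1 - x.1 ≤ μ * x.2} := isClosed_le (by fun_prop) (by fun_prop)
    have c2 : IsClosed {x : ℝ × ℝ | 1 + x.1 ≤ μ * x.2} := isClosed_le (by fun_prop) (by fun_prop)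
    have c3 : IsClosed {x : ℝ × ℝ | x.2 ≤ μ * (1 + x.1)} := isClosed_le (by fun_prop) (by fun_prop)
    have c4 : IsClosed {x : ℝ × ℝ | x.2 ≤ μ * (1 - x.1)} := isClosed_le (by fun_prop) (by fun_prop)
    exact c1.inter (c2.inter (c3.inter c4))
  · intro x hx
    obtain ⟨h1, h2, h3⟩ := weakRegion_bounds hμ hx
    exact ⟨⟨(abs_lt.1 h1).1.le, (abs_lt.1 h1).2.le⟩, h2.le, h3⟩

/-- The part of the second derivative of `p` along a trajectory which does not depend on the
control. -/
def driftTerm (x : ℝ × ℝ) : ℝ := 2 * x.1 * (x.1 ^ 2 + x.2 ^ 2 - 1) + 4 * x.1 * x.2 ^ 2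

/-- The bounds which define a profile hold for all small perturbations of the values of a weak
trajectory with a smaller constant. -/
theorem exists_uniform_perturbation {μ μ' η : ℝ} (hμ' : 1 < μ') (hμ : μ' < μ) (hη : 0 < η) :
    ∃ δ > 0, ∀ x ∈ weakRegion μ', ∀ P M N : ℝ, |P - x.1| < δ →
      |M - (x.1 ^ 2 + x.2 ^ 2 - 1)| < δ →
      |N - driftTerm x| ≤ 2 * (μ' - 1 / μ') * x.2 ^ 3 + δ / 2 →
      P < 1 ∧ -1 < P ∧ 0 < M + 1 - P ^ 2 ∧
      |N - 6 * P * M - 4 * P + 4 * P ^ 3| ≤ 2 * (μ - 1 / μ) * √(M + 1 - P ^ 2) ^ 3 ∧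
      1 + P ≤ μ * √(M + 1 - P ^ 2) ∧ √(M + 1 - P ^ 2) ≤ μ * (1 + P) ∧
      x.2 - η ≤ √(M + 1 - P ^ 2) := by
  have hμ1 : 1 < μ := hμ'.trans hμ
  set Pf : (ℝ × ℝ × ℝ) × (ℝ × ℝ) → ℝ := fun z => z.2.1 + z.1.1 with hPf
  set Mf : (ℝ × ℝ × ℝ) × (ℝ × ℝ) → ℝ := fun z => z.2.1 ^ 2 + z.2.2 ^ 2 - 1 + z.1.2.1 with hMf
  have hPc : Continuous Pf := by fun_prop
  have hMc : Continuous Mf := by fun_prop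
  -- Unperturbed, every inequality is strict on the region because `μ' < μ`. Compactness of the
  -- region makes the admissible perturbation uniform.
  have key : ∀ᶠ e in 𝓝 (0 : ℝ × ℝ × ℝ), ∀ x ∈ weakRegion μ',
      (Pf (e, x) < 1 ∧ -1 < Pf (e, x)) ∧ 0 < Mf (e, x) + 1 - Pf (e, x) ^ 2 ∧
      |driftTerm x - 6 * Pf (e, x) * Mf (e, x) - 4 * Pf (e, x) + 4 * Pf (e, x) ^ 3|
        + (2 * (μ' - 1 / μ') * x.2 ^ 3 + e.2.2)
        < 2 * (μ - 1 / μ) * √(Mf (e, x) + 1 - Pf (e, x) ^ 2) ^ 3 ∧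
      1 + Pf (e, x) < μ * √(Mf (e, x) + 1 - Pf (e, x) ^ 2) ∧
      √(Mf (e, x) + 1 - Pf (e, x) ^ 2) < μ * (1 + Pf (e, x)) ∧
      x.2 - η < √(Mf (e, x) + 1 - Pf (e, x) ^ 2) := by
    refine (isCompact_weakRegion hμ').eventually_forall_of_forall_eventually fun x hx => ?_
    have hh : Mf (0, x) + 1 - Pf (0, x) ^ 2 = x.2 ^ 2 := by simp [hPf, hMf]
    obtain ⟨h1, h2, h3⟩ := weakRegion_bounds hμ' hx
    have hsq : √(Mf (0, x) + 1 - Pf (0, x) ^ 2) = x.2 := by rw [hh, Real.sqrt_sq h2.le]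
    have hP0 : Pf (0, x) = x.1 := by simp [hPf]
    have hM0 : Mf (0, x) = x.1 ^ 2 + x.2 ^ 2 - 1 := by simp [hMf]
    obtain ⟨g1, g2, g3, g4⟩ := hx
    obtain ⟨h5, h6⟩ := abs_lt.1 h1
    have hsqc : Continuous fun z : (ℝ × ℝ × ℝ) × (ℝ × ℝ) => √(Mf z + 1 - Pf z ^ 2) := by fun_prop
    have hdr : Continuous fun z : (ℝ × ℝ × ℝ) × (ℝ × ℝ) => driftTerm z.2 := by
      unfold driftTerm; fun_prop
    refine (((continuous_iff_continuousAt.1 hPc _).eventually_lt continuousAt_const ?_).and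
      (continuousAt_const.eventually_lt (continuous_iff_continuousAt.1 hPc _) ?_)).and
      ((continuousAt_const.eventually_lt (g := fun z => Mf z + 1 - Pf z ^ 2)
        (Continuous.continuousAt (by fun_prop)) ?_).and
      ((ContinuousAt.eventually_lt (Continuous.continuousAt (by fun_prop))
        (Continuous.continuousAt (by fun_prop)) ?_).and
      ((ContinuousAt.eventually_lt (Continuous.continuousAt (by fun_prop))
        (Continuous.continuousAt (by fun_prop)) ?_).and
      ((ContinuousAt.eventually_lt (Continuous.continuousAt (by fun_prop))
        (Continuous.continuousAt (by fun_prop)) ?_).and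
      (ContinuousAt.eventually_lt (Continuous.continuousAt (by fun_prop))
        (Continuous.continuousAt (by fun_prop)) ?_)))))
    · rw [hP0]; exact h6
    · rw [hP0]; exact h5
    · rw [hh]; positivity
    · simp only [hsq]
      simp only [hP0, hM0, driftTerm]
      -- The drift cancels in the cubic form, leaving only the control term `2 u q³`.
      have e : 2 * x.1 * (x.1 ^ 2 + x.2 ^ 2 - 1) + 4 * x.1 * x.2 ^ 2
          - 6 * x.1 * (x.1 ^ 2 + x.2 ^ 2 - 1) - 4 * x.1 + 4 * x.1 ^ 3 = 0 := by ring
      rw [e, abs_zero]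
      have hlt : μ' - 1 / μ' < μ - 1 / μ := by
        have : 1 / μ < 1 / μ' := one_div_lt_one_div_of_lt (by linarith) hμ
        linarith
      have : 0 < x.2 ^ 3 := by positivity
      simp only [Prod.snd_zero]
      nlinarith
    · simp only [hsq]; rw [hP0]; nlinarith
    · simp only [hsq]; rw [hP0]; nlinarith
    · simp only [hsq]; linarith
  obtain ⟨δ, hδ, hball⟩ := Metric.eventually_nhds_iff_ball.1 key
  refine ⟨δ, hδ, fun x hx P M N hP hM hN => ?_⟩
  have hmem : ((P - x.1, M - (x.1 ^ 2 + x.2 ^ 2 - 1), δ / 2) : ℝ × ℝ × ℝ) ∈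
      Metric.ball (0 : ℝ × ℝ × ℝ) δ := by
    rw [mem_ball_zero_iff, Prod.norm_def, Prod.norm_def]
    simp only [Real.norm_eq_abs, max_lt_iff]
    exact ⟨hP, hM, by rw [abs_of_pos (by linarith)]; linarith⟩
  have hall := hball _ hmem x hx
  simp only [hPf, hMf, add_sub_cancel] at hall
  obtain ⟨⟨i1, i2⟩, i3, i4, i5, i6, i7⟩ := hall
  refine ⟨i1, i2, i3, ?_, i5.le, i6.le, i7.le⟩
  refine le_trans ?_ i4.le
  have : N - 6 * P * M - 4 * P + 4 * P ^ 3 =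
      (driftTerm x - 6 * P * M - 4 * P + 4 * P ^ 3) + (N - driftTerm x) := by ring
  rw [this]
  exact (abs_add_le _ _).trans (by linarith)

/-- Averaging a weak trajectory over short time intervals makes it smooth. -/
theorem exists_isProfile {μ μ' η : ℝ} (hμ' : 1 < μ') (hμ : μ' < μ) (hη : 0 < η) {p q : ℝ → ℝ}
    (h : ∀ t, IsWeakTrajectoryAt μ' p q t) :
    ∃ r r₁ r₂ : ℝ → ℝ, IsProfile μ r r₁ r₂ ∧ ∀ t, q t - η ≤ √(r₁ t + 1 - r t ^ 2) := by
  obtain ⟨δ, hδ, hpert⟩ := exists_uniform_perturbation hμ' hμ hη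
  have hγ' : 0 < μ' - 1 / μ' := by
    rw [sub_pos, div_lt_iff₀ (by linarith)]; nlinarith
  set γ' := μ' - 1 / μ'
  have hmem : ∀ t, (p t, q t) ∈ weakRegion μ' := fun t =>
    ⟨(h t).le_left, (h t).le_right, (h t).left_le, (h t).right_le⟩
  have hb := fun t => weakRegion_bounds hμ' (hmem t)
  simp only at hb
  have hpc : Continuous p := continuous_iff_continuousAt.2 fun t => (h t).hasDerivAt_fst.continuousAt
  have hqc : Continuous q := continuous_iff_continuousAt.2 fun t => (h t).continuousAt
  choose u hu hqd using fun t => (h t).hasDerivWithinAt_snd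
  -- Generous enough to be a Lipschitz constant for both `p` and `q`.
  set L := 1 + 2 * μ' + (μ' + γ') * μ' ^ 2 + μ' ^ 2 with hL
  have hL0 : 0 ≤ L := by positivity
  have hpb : ∀ t, |p t ^ 2 + q t ^ 2 - 1| ≤ L := fun t => by
    obtain ⟨h1, h2, h3⟩ := hb t
    have h4 : p t ^ 2 ≤ 1 := by rw [sq_le_one_iff_abs_le_one]; exact h1.le
    have h5 : q t ^ 2 ≤ μ' ^ 2 := by gcongr
    have h6 : 0 ≤ (μ' + γ') * μ' ^ 2 := by positivity
    rw [abs_le]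
    constructor
    · nlinarith [sq_nonneg (p t), sq_nonneg (q t)]
    · linarith
  have hqb : ∀ t, |2 * p t * q t + u t * q t ^ 2| ≤ L := fun t => by
    obtain ⟨h1, h2, h3⟩ := hb t
    have h4 : |2 * p t * q t| ≤ 2 * μ' := by
      rw [abs_mul, abs_mul, abs_two, abs_of_pos h2]
      nlinarith [abs_nonneg (p t)]
    have h5 : |u t * q t ^ 2| ≤ γ' * μ' ^ 2 := by
      rw [abs_mul, abs_of_nonneg (sq_nonneg (q t))]
      gcongr
      exact hu t
    have h6 : 0 ≤ μ' * μ' ^ 2 := by positivity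
    have h7 : 0 ≤ μ' ^ 2 := by positivity
    have := abs_add_le (2 * p t * q t) (u t * q t ^ 2)
    rw [hL, add_mul]; linarith
  have hpl : ∀ s t, s ≤ t → |p t - p s| ≤ L * (t - s) := fun s t hst =>
    norm_image_sub_le_of_norm_deriv_right_le_segment (f := p) hpc.continuousOn
      (fun x _ => (h x).hasDerivAt_fst.hasDerivWithinAt) (fun x _ => hpb x) t ⟨hst, le_rfl⟩
  have hql : ∀ s t, s ≤ t → |q t - q s| ≤ L * (t - s) := fun s t hst =>
    norm_image_sub_le_of_norm_deriv_right_le_segment (f := q) hqc.continuousOn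
      (fun x _ => hqd x) (fun x _ => hqb x) t ⟨hst, le_rfl⟩
  have hpl' : ∀ s t, |p t - p s| ≤ L * |t - s| := fun s t => by
    rcases le_total s t with hst | hst
    · rw [abs_of_nonneg (sub_nonneg.2 hst)]; exact hpl s t hst
    · rw [abs_sub_comm, abs_sub_comm t, abs_of_nonneg (sub_nonneg.2 hst)]; exact hpl t s hst
  have hql' : ∀ s t, |q t - q s| ≤ L * |t - s| := fun s t => by
    rcases le_total s t with hst | hst
    · rw [abs_of_nonneg (sub_nonneg.2 hst)]; exact hql s t hst
    · rw [abs_sub_comm, abs_sub_comm t, abs_of_nonneg (sub_nonneg.2 hst)]; exact hql t s hst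
  set F : ℝ × ℝ → ℝ × ℝ × ℝ := fun x => (x.1 ^ 2 + x.2 ^ 2 - 1, driftTerm x, x.2 ^ 3) with hF
  have hFc : Continuous F := by unfold F driftTerm; fun_prop
  have hFu := (isCompact_weakRegion hμ').uniformContinuousOn_of_continuous hFc.continuousOn
  -- The tolerance ensures that the error of the drift plus `2γ'` times that of `q³` is at most `δ /
  -- 2`.
  obtain ⟨κ, hκ, hκF⟩ := Metric.uniformContinuousOn_iff.1 hFu (min (δ / 2) (δ / (8 * γ' + 8)))
    (by positivity)
  obtain ⟨ε, hε, hεκ, hεδ⟩ : ∃ ε > 0, L * ε < κ ∧ L * ε < δ := by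
    refine ⟨min κ δ / (L + 1), by positivity, ?_, ?_⟩
    · rw [mul_div_assoc', div_lt_iff₀ (by positivity)]
      have := min_le_left κ δ
      have : 0 < min κ δ := by positivity
      nlinarith
    · rw [mul_div_assoc', div_lt_iff₀ (by positivity)]
      have := min_le_right κ δ
      have : 0 < min κ δ := by positivity
      nlinarith
  have hnear : ∀ s t, |s - t| ≤ ε → |p s - p t| < δ ∧
      |(p s ^ 2 + q s ^ 2 - 1) - (p t ^ 2 + q t ^ 2 - 1)| < δ ∧
      |driftTerm (p s, q s) - driftTerm (p t, q t)| + 2 * γ' * |q s ^ 3 - q t ^ 3| ≤ δ / 2 := by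
    intro s t hst
    have h1 : |p s - p t| ≤ L * ε := (hpl' t s).trans (by gcongr)
    have h2 : |q s - q t| ≤ L * ε := (hql' t s).trans (by gcongr)
    have h3 : dist (p s, q s) (p t, q t) < κ := by
      rw [Prod.dist_eq, Real.dist_eq, Real.dist_eq]
      exact max_lt (h1.trans_lt hεκ) (h2.trans_lt hεκ)
    have h4 := hκF _ (hmem s) _ (hmem t) h3
    simp only [hF, Prod.dist_eq, Real.dist_eq, max_lt_iff, lt_min_iff] at h4
    obtain ⟨⟨h5, h6, h7⟩, ⟨h8, h9, h10⟩⟩ := h4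
    refine ⟨h1.trans_lt hεδ, by linarith, ?_⟩
    have h11 : |driftTerm (p s, q s) - driftTerm (p t, q t)| + 2 * γ' * |q s ^ 3 - q t ^ 3| ≤
        δ / (8 * γ' + 8) + 2 * γ' * (δ / (8 * γ' + 8)) := by gcongr
    refine h11.trans ?_
    rw [mul_div_assoc', ← add_div, div_le_div_iff₀ (by positivity) (by norm_num)]
    nlinarith [mul_pos hδ hγ']
  set m : ℝ → ℝ := fun t => p t ^ 2 + q t ^ 2 - 1 with hm
  have hmc : Continuous m := by fun_prop
  -- The smoothed `p` is its mean over `[t - ε, t + ε]`, the symmetric difference quotient of `I`.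
  -- Its two derivatives are the same quotients of `p` and of `p' = m`.
  set I : ℝ → ℝ := fun t => ∫ s in (0 : ℝ)..t, p s with hI
  have hId : ∀ t, HasDerivAt I (p t) t := fun t => hpc.integral_hasStrictDerivAt 0 t |>.hasDerivAt
  have hshift : ∀ {f f' : ℝ → ℝ}, (∀ t, HasDerivAt f (f' t) t) → ∀ t, HasDerivAt
      (fun t => (f (t + ε) - f (t - ε)) / (2 * ε)) ((f' (t + ε) - f' (t - ε)) / (2 * ε)) t :=
    fun hf t => (((hf (t + ε)).comp_add_const t ε).fun_sub
      ((hf (t - ε)).comp_sub_const t ε)).div_const _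
  have hslope : ∀ {f f' : ℝ → ℝ}, (∀ t, HasDerivAt f (f' t) t) → ∀ t, ∃ s, |s - t| ≤ ε ∧
      (f (t + ε) - f (t - ε)) / (2 * ε) = f' s := by
    intro f f' hf t
    obtain ⟨s, hs, hse⟩ := exists_hasDerivAt_eq_slope f f' (show t - ε < t + ε by linarith)
      (fun x _ => (hf x).continuousAt.continuousWithinAt) (fun x _ => hf x)
    refine ⟨s, abs_le.2 ⟨by linarith [hs.1], by linarith [hs.2]⟩, ?_⟩
    rw [hse]; congr 1; ring
  have hall : ∀ t, _ := fun t => hpert (p t, q t) (hmem t)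
    ((I (t + ε) - I (t - ε)) / (2 * ε)) ((p (t + ε) - p (t - ε)) / (2 * ε))
    ((m (t + ε) - m (t - ε)) / (2 * ε)) (by
      obtain ⟨s, hs, hse⟩ := hslope hId t
      rw [hse]; exact (hnear s t hs).1) (by
      obtain ⟨s, hs, hse⟩ := hslope (fun t => (h t).hasDerivAt_fst) t
      rw [hse]; exact (hnear s t hs).2.1) (by
      have hmd : ∀ s ∈ Ico (t - ε) (t + ε), HasDerivWithinAt
          (fun s => m s - driftTerm (p t, q t) * s)
          (driftTerm (p s, q s) + 2 * u s * q s ^ 3 - driftTerm (p t, q t)) (Ici s) s := by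
        intro s _
        have h1 := (((h s).hasDerivAt_fst.hasDerivWithinAt (s := Ici s)).fun_pow 2).fun_add
          ((hqd s).fun_pow 2)
        have h2 := (h1.sub_const 1).fun_sub
          ((hasDerivWithinAt_id s (Ici s)).const_mul (driftTerm (p t, q t)))
        refine h2.congr_deriv ?_
        simp only [driftTerm]
        push_cast
        ring
      have hbd : ∀ s ∈ Ico (t - ε) (t + ε),
          ‖driftTerm (p s, q s) + 2 * u s * q s ^ 3 - driftTerm (p t, q t)‖ ≤
            2 * γ' * q t ^ 3 + δ / 2 := by
        intro s hs
        have h1 := (hnear s t (abs_le.2 ⟨by linarith [hs.1], by linarith [hs.2]⟩)).2.2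
        have h2 : |2 * u s * q s ^ 3| ≤ 2 * γ' * q s ^ 3 := by
          have h3 := (hb s).2.1
          rw [abs_mul, abs_mul, abs_two, abs_of_pos (by positivity : 0 < q s ^ 3)]
          have := hu s
          gcongr
        have h3 : q s ^ 3 ≤ q t ^ 3 + |q s ^ 3 - q t ^ 3| := by
          linarith [le_abs_self (q s ^ 3 - q t ^ 3)]
        have h4 : 2 * γ' * q s ^ 3 ≤ 2 * γ' * (q t ^ 3 + |q s ^ 3 - q t ^ 3|) := by gcongr
        rw [Real.norm_eq_abs]
        have h5 : driftTerm (p s, q s) + 2 * u s * q s ^ 3 - driftTerm (p t, q t) =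
          (driftTerm (p s, q s) - driftTerm (p t, q t)) + 2 * u s * q s ^ 3 := by ring
        rw [h5]
        refine (abs_add_le _ _).trans ?_
        linarith
      -- The mean value inequality for right derivatives: `m` need not be differentiable where the
      -- control jumps.
      have h1 := norm_image_sub_le_of_norm_deriv_right_le_segment
        (f := fun s => m s - driftTerm (p t, q t) * s) (a := t - ε) (b := t + ε)
        (by fun_prop) hmd hbd (t + ε) ⟨by linarith, le_rfl⟩
      rw [Real.norm_eq_abs] at h1
      have h2 : (m (t + ε) - m (t - ε)) / (2 * ε) - driftTerm (p t, q t) =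
          (m (t + ε) - driftTerm (p t, q t) * (t + ε) -
            (m (t - ε) - driftTerm (p t, q t) * (t - ε))) / (2 * ε) := by
        field_simp
        ring
      rw [h2, abs_div, abs_of_pos (show 0 < 2 * ε by positivity), div_le_iff₀ (by positivity)]
      refine h1.trans (le_of_eq ?_)
      ring)
  refine ⟨_, _, _, ⟨fun t => hshift hId t, fun t => hshift (fun t => (h t).hasDerivAt_fst) t, ?_,
    fun t => (hall t).1, fun t => (hall t).2.1, fun t => (hall t).2.2.1, fun t => (hall t).2.2.2.1,
    fun t => (hall t).2.2.2.2.1, fun t => (hall t).2.2.2.2.2.1⟩,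
    fun t => (hall t).2.2.2.2.2.2⟩
  fun_prop

/-! ### Derivatives of the symmetric potential along a line. -/

section LineCalculus

variable {g p p₁ p₂ : ℝ → ℝ} {X₀ Y₀ A b η : ℝ}

/-- The derivatives of the potential of the rotationally symmetric lift along a line, combined to
the metric and the cubic form. -/
theorem exists_line_derivatives (hg : ∀ t, HasDerivAt g (p t) t) (hp : ∀ t, HasDerivAt p (p₁ t) t)
    (hp₁ : ∀ t, HasDerivAt p₁ (p₂ t) t) (hX₀ : 0 < X₀) (hY₀ : 0 < Y₀) {l : ℝ → ℝ}
    (hl : ∀ᶠ t in 𝓝 (0 : ℝ), l t =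
      -(1 / 2) * Real.log (X₀ + t * A - t ^ 2 * η / (Y₀ + t * b)) - 1 / 2 * Real.log (Y₀ + t * b)
      + g (1 / 2 * (Real.log (Y₀ + t * b)
        - Real.log (X₀ + t * A - t ^ 2 * η / (Y₀ + t * b))))) :
    ∃ l₁ l₂ : ℝ → ℝ, ∃ l₃ : ℝ, (∀ᶠ t in 𝓝 (0 : ℝ), HasDerivAt l (l₁ t) t) ∧
      (∀ᶠ t in 𝓝 (0 : ℝ), HasDerivAt l₁ (l₂ t) t) ∧ HasDerivAt l₂ l₃ 0 ∧
      (∀ τ σ e : ℝ, τ = 1 / 2 * (Real.log Y₀ - Real.log X₀) → σ = 1 / 2 * (b / Y₀ - A / X₀) →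
        e = η / (X₀ * Y₀) →
        l₂ 0 - l₁ 0 ^ 2 = σ ^ 2 * (p₁ τ + 1 - p τ ^ 2) + e * (1 + p τ) ∧
        l₃ - 6 * l₁ 0 * l₂ 0 + 4 * l₁ 0 ^ 3 =
          σ ^ 3 * (p₂ τ - 6 * p τ * p₁ τ - 4 * p τ + 4 * p τ ^ 3)
          + 3 * σ * e * (p₁ τ - 2 * p τ - 2 * p τ ^ 2)) := by
  set Y : ℝ → ℝ := fun t => Y₀ + t * b with hY
  set X : ℝ → ℝ := fun t => X₀ + t * A - t ^ 2 * η / Y t with hX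
  set X1 : ℝ → ℝ := fun t => A - η * (2 * t * Y t - t ^ 2 * b) / Y t ^ 2 with hX1
  set X2 : ℝ → ℝ := fun t => -(2 * η * Y₀ ^ 2) / Y t ^ 3 with hX2
  set X3 : ℝ → ℝ := fun t => 6 * η * Y₀ ^ 2 * b / Y t ^ 4 with hX3
  have hYd : ∀ t, HasDerivAt Y b t := fun t =>
    (((hasDerivAt_id t).mul_const b).const_add Y₀).congr_deriv (one_mul b)
  have hYc : Continuous Y := by fun_prop
  have hYpos : ∀ᶠ t in 𝓝 (0 : ℝ), 0 < Y t :=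
    continuousAt_const.eventually_lt hYc.continuousAt (by simpa [hY] using hY₀)
  have hXd : ∀ t, 0 < Y t → HasDerivAt X (X1 t) t := fun t ht => by
    have h1 := (((hasDerivAt_id t).mul_const A).const_add X₀).fun_sub
      ((((hasDerivAt_id t).fun_pow 2).mul_const η).fun_div (hYd t) ht.ne')
    refine h1.congr_deriv ?_
    simp only [hX1, id, Nat.cast_ofNat]
    field_simp
    ring
  have hX1d : ∀ t, 0 < Y t → HasDerivAt X1 (X2 t) t := fun t ht => by
    have h1 := (((((hasDerivAt_id t).const_mul 2).fun_mul (hYd t)).fun_sub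
      (((hasDerivAt_id t).fun_pow 2).mul_const b)).const_mul η).fun_div
      ((hYd t).fun_pow 2) (by positivity)
    refine (h1.const_sub A).congr_deriv ?_
    have hYt : Y₀ = Y t - t * b := by simp [hY]
    simp only [hX2, id, Nat.cast_ofNat, hYt]
    field_simp
    ring
  have hX2d : ∀ t, 0 < Y t → HasDerivAt X2 (X3 t) t := fun t ht => by
    have h1 := (hasDerivAt_const t (-(2 * η * Y₀ ^ 2))).fun_div
      ((hYd t).fun_pow 3) (by positivity)
    refine h1.congr_deriv ?_
    simp only [hX3, Nat.cast_ofNat]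
    field_simp
    ring
  have hXpos : ∀ᶠ t in 𝓝 (0 : ℝ), 0 < X t :=
    continuousAt_const.eventually_lt (hXd 0 (by simpa [hY] using hY₀)).continuousAt
      (by simpa [hX] using hX₀)
  set τ : ℝ → ℝ := fun t => 1 / 2 * (Real.log (Y t) - Real.log (X t)) with hτ
  set σ : ℝ → ℝ := fun t => 1 / 2 * (b / Y t - X1 t / X t) with hσ
  set α1 : ℝ → ℝ := fun t => X2 t / X t - (X1 t / X t) ^ 2 with hα1
  set α2 : ℝ → ℝ := fun t => X3 t / X t - X2 t * X1 t / X t ^ 2 - 2 * (X1 t / X t) * α1 t with hα2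
  set σ1 : ℝ → ℝ := fun t => 1 / 2 * (-(b / Y t) ^ 2 - α1 t) with hσ1
  have hτd : ∀ t, 0 < Y t → 0 < X t → HasDerivAt τ (σ t) t := fun t hy hx =>
    (((hYd t).log hy.ne').fun_sub ((hXd t hy).log hx.ne')).const_mul (1 / 2)
  have hαd : ∀ t, 0 < Y t → 0 < X t → HasDerivAt (fun t => X1 t / X t) (α1 t) t := fun t hy hx => by
    refine ((hX1d t hy).fun_div (hXd t hy) hx.ne').congr_deriv ?_
    simp only [hα1]; field_simp
  have hα1d : ∀ t, 0 < Y t → 0 < X t → HasDerivAt α1 (α2 t) t := fun t hy hx => by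
    refine (((hX2d t hy).fun_div (hXd t hy) hx.ne').fun_sub
      ((hαd t hy hx).fun_pow 2)).congr_deriv ?_
    simp only [hα2, Nat.cast_ofNat, show 2 - 1 = 1 from rfl, pow_one]; field_simp
  have hβd : ∀ t, 0 < Y t → HasDerivAt (fun t => b / Y t) (-(b / Y t) ^ 2) t := fun t hy => by
    refine ((hasDerivAt_const t b).fun_div (hYd t) hy.ne').congr_deriv ?_
    field_simp; ring
  have hσd : ∀ t, 0 < Y t → 0 < X t → HasDerivAt σ (σ1 t) t := fun t hy hx =>
    ((hβd t hy).fun_sub (hαd t hy hx)).const_mul (1 / 2)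
  have hσ1d : ∀ t, 0 < Y t → 0 < X t →
      HasDerivAt σ1 (1 / 2 * (2 * (b / Y t) ^ 3 - α2 t)) t := fun t hy hx => by
    refine ((((hβd t hy).fun_pow 2).fun_neg.fun_sub (hα1d t hy hx)).const_mul (1 / 2)).congr_deriv ?_
    push_cast; ring
  set l₁ : ℝ → ℝ := fun t => -(1 / 2) * (X1 t / X t) - 1 / 2 * (b / Y t) + p (τ t) * σ t with hl₁
  set l₂ : ℝ → ℝ := fun t => -(1 / 2) * α1 t - 1 / 2 * (-(b / Y t) ^ 2)
    + (p₁ (τ t) * σ t * σ t + p (τ t) * σ1 t) with hl₂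
  have hl₁d : ∀ t, 0 < Y t → 0 < X t → HasDerivAt l₁ (l₂ t) t := fun t hy hx =>
    (((hαd t hy hx).const_mul (-(1 / 2))).fun_sub ((hβd t hy).const_mul (1 / 2))).fun_add
      (((hp (τ t)).comp t (hτd t hy hx)).fun_mul (hσd t hy hx))
  have hy0 : 0 < Y 0 := hYpos.self_of_nhds
  have hx0 : 0 < X 0 := hXpos.self_of_nhds
  have hl₂d := (((hα1d 0 hy0 hx0).const_mul (-(1 / 2))).fun_sub
      (((hβd 0 hy0).fun_pow 2).fun_neg.const_mul (1 / 2))).fun_add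
      (((((hp₁ (τ 0)).comp 0 (hτd 0 hy0 hx0)).fun_mul (hσd 0 hy0 hx0)).fun_mul
        (hσd 0 hy0 hx0)).fun_add
        (((hp (τ 0)).comp 0 (hτd 0 hy0 hx0)).fun_mul (hσ1d 0 hy0 hx0)))
  refine ⟨l₁, l₂, _, ?_, ?_, hl₂d, ?_⟩
  · filter_upwards [hYpos, hXpos, hl.eventually_nhds] with t hy hx ht
    have h1 := ((((hXd t hy).log hx.ne').const_mul (-(1 / 2))).fun_sub
      (((hYd t).log hy.ne').const_mul (1 / 2))).fun_add ((hg (τ t)).comp t (hτd t hy hx))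
    exact HasDerivAt.congr_of_eventuallyEq h1 ht
  · filter_upwards [hYpos, hXpos] with t hy hx
    exact hl₁d t hy hx
  · rintro τ' σ' e rfl rfl rfl
    have hτ0 : τ 0 = 1 / 2 * (Real.log Y₀ - Real.log X₀) := by simp [hτ, hX, hY]
    have eY : Y 0 = Y₀ := by simp [hY]
    have eX : X 0 = X₀ := by simp [hX]
    have eX1 : X1 0 = A := by simp [hX1]
    have eX2 : X2 0 = -(2 * η) / Y₀ := by simp only [hX2, eY]; field_simp
    have eX3 : X3 0 = 6 * η * b / Y₀ ^ 2 := by simp only [hX3, eY]; field_simp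
    simp only [hl₁, hl₂, hσ, hσ1, hα2, hα1, hτ0, eY, eX, eX1, eX2, eX3, Function.comp_apply]
    set P := p (1 / 2 * (Real.log Y₀ - Real.log X₀))
    set P1 := p₁ (1 / 2 * (Real.log Y₀ - Real.log X₀))
    set P2 := p₂ (1 / 2 * (Real.log Y₀ - Real.log X₀))
    -- Passing to logarithmic slopes removes all denominators, so that both identities become
    -- polynomial.
    obtain ⟨A', rfl⟩ : ∃ A', A = A' * X₀ := ⟨A / X₀, by field_simp⟩
    obtain ⟨b', rfl⟩ : ∃ b', b = b' * Y₀ := ⟨b / Y₀, by field_simp⟩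
    obtain ⟨e', rfl⟩ : ∃ e', η = e' * (X₀ * Y₀) := ⟨η / (X₀ * Y₀), by field_simp⟩
    have s1 : b' * Y₀ / Y₀ = b' := by field_simp
    have s2 : A' * X₀ / X₀ = A' := by field_simp
    have s3 : e' * (X₀ * Y₀) / (X₀ * Y₀) = e' := by field_simp
    have s4 : -(2 * (e' * (X₀ * Y₀))) / Y₀ / X₀ = -2 * e' := by field_simp
    have s5 : 6 * (e' * (X₀ * Y₀)) * (b' * Y₀) / Y₀ ^ 2 / X₀ = 6 * e' * b' := by field_simp
    have s6 : -(2 * (e' * (X₀ * Y₀))) / Y₀ * (A' * X₀) / X₀ ^ 2 = -2 * e' * A' := by field_simp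
    simp only [s1, s2, s3, s4, s5, s6]
    push_cast
    constructor <;> ring

end LineCalculus

namespace IsProfile

variable {μ : ℝ} {p p₁ p₂ : ℝ → ℝ}

/-- The cubic form of the rotationally symmetric lift is bounded in all directions. -/
theorem cubic_le_all (h : IsProfile μ p p₁ p₂) (hμ : 1 < μ) (t σ : ℝ) {e : ℝ} (he : 0 ≤ e) :
    σ ^ 3 * (p₂ t - 6 * p t * p₁ t - 4 * p t + 4 * p t ^ 3)
      + 3 * σ * e * (p₁ t - 2 * p t - 2 * p t ^ 2) ≤
    2 * (μ - 1 / μ) * (σ ^ 2 * (p₁ t + 1 - p t ^ 2) + e * (1 + p t)) ^ (3 / 2 : ℝ) := by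
  have hpos := h.metric_pos t
  have hq : 0 < √(p₁ t + 1 - p t ^ 2) := Real.sqrt_pos.2 hpos
  have hsq := Real.sq_sqrt hpos.le
  have hc := h.cubic_le t
  have h1 := h.le_left t
  have h2 := h.left_le t
  have h3 : 0 < 1 + p t := by linarith [h.neg_one_lt t]
  have h4 : p₁ t - 2 * p t - 2 * p t ^ 2 = √(p₁ t + 1 - p t ^ 2) ^ 2 - (1 + p t) ^ 2 := by
    rw [hsq]; ring
  rw [h4]
  set q := √(p₁ t + 1 - p t ^ 2)
  rw [← hsq]
  set c := p₂ t - 6 * p t * p₁ t - 4 * p t + 4 * p t ^ 3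
  set k := 1 + p t
  have hμ0 : 0 < μ := by linarith
  set γ := μ - 1 / μ with hγ
  have hγ0 : 0 < γ := by rw [hγ, sub_pos, div_lt_iff₀ hμ0]; nlinarith
  -- Divided by `q k`, this is `|r - 1/r| ≤ μ - 1/μ` for the ratio `r = q/k`, which holds for `r`
  -- between `1/μ` and `μ`.
  have hk : |q ^ 2 - k ^ 2| ≤ γ * (q * k) := by
    have e1 : γ * (q * k) = (μ * k) * q - q * k / μ := by rw [hγ]; ring
    have e2 : γ * (q * k) = (μ * q) * k - k * q / μ := by rw [hγ]; ring
    have e3 : q / μ ≤ k := by rw [div_le_iff₀ hμ0]; linarith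
    have e4 : k / μ ≤ q := by rw [div_le_iff₀ hμ0]; linarith
    rw [abs_le]
    constructor
    · have : k * q / μ ≤ q * q := by
        rw [mul_comm k, mul_div_assoc]; gcongr
      nlinarith
    · have : q * k / μ ≤ k * k := by
        rw [mul_comm q, mul_div_assoc]; gcongr
      nlinarith
  set a := |σ| * q with ha
  set B := e * k with hB
  have ha0 : 0 ≤ a := by positivity
  have hB0 : 0 ≤ B := by positivity
  have hM : σ ^ 2 * q ^ 2 + B = a ^ 2 + B := by rw [ha, mul_pow, sq_abs]
  rw [hM]
  have t1 : σ ^ 3 * c ≤ 2 * γ * a ^ 3 := by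
    refine (le_abs_self _).trans ?_
    rw [abs_mul, abs_pow, ha, mul_pow]
    calc |σ| ^ 3 * |c| ≤ |σ| ^ 3 * (2 * γ * q ^ 3) := by gcongr
      _ = _ := by ring
  have t2 : 3 * σ * e * (q ^ 2 - k ^ 2) ≤ 3 * γ * (a * B) := by
    refine (le_abs_self _).trans ?_
    rw [abs_mul, abs_mul, abs_mul, abs_of_pos (show (0 : ℝ) < 3 by norm_num), abs_of_nonneg he]
    calc 3 * |σ| * e * |q ^ 2 - k ^ 2| ≤ 3 * |σ| * e * (γ * (q * k)) := by gcongr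
      _ = _ := by rw [ha, hB]; ring
  have hs : 0 ≤ a ^ 2 + B := by positivity
  have t3 : ∀ s : ℝ, 0 ≤ s → s ^ (3 / 2 : ℝ) = √s ^ 3 := fun s hs => by
    rw [Real.sqrt_eq_rpow, ← Real.rpow_natCast, ← Real.rpow_mul hs]
    norm_num
  rw [t3 _ hs]
  -- The radial and the mixed term together stay below the power of the metric; after squaring, the
  -- difference has nonnegative coefficients.
  have t4 : 2 * a ^ 3 + 3 * (a * B) ≤ 2 * √(a ^ 2 + B) ^ 3 := by
    refine (pow_le_pow_iff_left₀ (by positivity) (by positivity) two_ne_zero).1 ?_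
    have : (2 * √(a ^ 2 + B) ^ 3) ^ 2 = 4 * (√(a ^ 2 + B) ^ 2) ^ 3 := by ring
    rw [this, Real.sq_sqrt hs]
    have h5 : 0 ≤ 3 * a ^ 2 * B ^ 2 + 4 * B ^ 3 := by positivity
    linarith [show 4 * (a ^ 2 + B) ^ 3 - (2 * a ^ 3 + 3 * (a * B)) ^ 2
      = 3 * a ^ 2 * B ^ 2 + 4 * B ^ 3 by ring]
  linarith [mul_le_mul_of_nonneg_left t4 hγ0.le]

theorem contDiff (h : IsProfile μ p p₁ p₂) : ContDiff ℝ 2 p := by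
  have d1 : deriv p = p₁ := funext fun t => (h.hasDerivAt t).deriv
  have d2 : deriv p₁ = p₂ := funext fun t => (h.hasDerivAt_deriv t).deriv
  have c1 : ContDiff ℝ 1 p₁ := contDiff_one_iff_deriv.2
    ⟨fun t => (h.hasDerivAt_deriv t).differentiableAt, by rw [d2]; exact h.continuous_deriv⟩
  rw [show (2 : WithTop ℕ∞) = 1 + 1 by norm_num, contDiff_succ_iff_deriv]
  exact ⟨fun t => (h.hasDerivAt t).differentiableAt, by simp, by rw [d1]; exact c1⟩

/-- An antiderivative of the profile. -/
noncomputable def potential (p : ℝ → ℝ) (t : ℝ) : ℝ := ∫ s in (0 : ℝ)..t, p s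

theorem hasDerivAt_potential (h : IsProfile μ p p₁ p₂) (t : ℝ) :
    HasDerivAt (potential p) (p t) t :=
  (h.contDiff.continuous.integral_hasStrictDerivAt 0 t).hasDerivAt

theorem contDiff_potential (h : IsProfile μ p p₁ p₂) : ContDiff ℝ 3 (potential p) := by
  rw [show (3 : WithTop ℕ∞) = 2 + 1 by norm_num, contDiff_succ_iff_deriv]
  refine ⟨fun t => (h.hasDerivAt_potential t).differentiableAt, by simp, ?_⟩
  rw [funext fun t => (h.hasDerivAt_potential t).deriv]
  exact h.contDiff

end IsProfile

/-! ### The quadratic cone and its symmetric lifts. -/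

/-- A linear coordinate system of `V` with two real coordinates and a vectorial one. -/
structure ConeCoordinates (V W : Type*) [NormedAddCommGroup V] [NormedSpace ℝ V]
    [NormedAddCommGroup W] [InnerProductSpace ℝ W] where
  x : V →L[ℝ] ℝ
  y : V →L[ℝ] ℝ
  z : V →L[ℝ] W
  e : V
  f : V
  x_e : x e = 1
  y_e : y e = 0
  z_e : z e = 0
  x_f : x f = 0
  y_f : y f = 1
  z_f : z f = 0
  eq_zero : ∀ v, x v = 0 → y v = 0 → z v = 0 → v = 0

namespace ConeCoordinates

open CentroAffine

variable {V W : Type*} [NormedAddCommGroup V] [NormedSpace ℝ V]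
  [NormedAddCommGroup W] [InnerProductSpace ℝ W] (D : ConeCoordinates V W)

/-- The closed quadratic cone `‖z‖² ≤ x y`. -/
def cone : ProperCone ℝ V where
  carrier := {v | 0 ≤ D.x v ∧ 0 ≤ D.y v ∧ ‖D.z v‖ ^ 2 ≤ D.x v * D.y v}
  add_mem' := by
    rintro v w ⟨h1, h2, h3⟩ ⟨h4, h5, h6⟩
    refine ⟨by rw [map_add]; positivity, by rw [map_add]; positivity, ?_⟩
    simp only [map_add]
    have h7 : ‖D.z v‖ * ‖D.z w‖ ≤ 1 / 2 * (D.x v * D.y w + D.x w * D.y v) := by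
      refine (pow_le_pow_iff_left₀ (by positivity) (by positivity) two_ne_zero).1 ?_
      have := mul_le_mul h3 h6 (by positivity) (by positivity)
      nlinarith [sq_nonneg (D.x v * D.y w - D.x w * D.y v)]
    have h8 : ‖D.z v + D.z w‖ ^ 2 ≤ (‖D.z v‖ + ‖D.z w‖) ^ 2 := by
      gcongr; exact norm_add_le _ _
    nlinarith
  zero_mem' := by simp
  smul_mem' := by
    rintro ⟨c, hc⟩ v ⟨h1, h2, h3⟩
    change 0 ≤ D.x (c • v) ∧ 0 ≤ D.y (c • v) ∧ ‖D.z (c • v)‖ ^ 2 ≤ D.x (c • v) * D.y (c • v)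
    simp only [map_smul, smul_eq_mul, norm_smul, mul_pow, Real.norm_eq_abs, sq_abs]
    refine ⟨by positivity, by positivity, ?_⟩
    nlinarith [mul_le_mul_of_nonneg_left h3 (sq_nonneg c)]
  isClosed' := by
    refine (isClosed_le continuous_const D.x.continuous).inter
      ((isClosed_le continuous_const D.y.continuous).inter
      (isClosed_le (D.z.continuous.norm.pow 2) (D.x.continuous.mul D.y.continuous)))

/-- The open quadratic cone `‖z‖² < x y`. -/
def openCone : Set V := {v | 0 < D.x v ∧ 0 < D.y v ∧ ‖D.z v‖ ^ 2 < D.x v * D.y v}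

theorem mem_cone {v : V} :
    v ∈ D.cone ↔ 0 ≤ D.x v ∧ 0 ≤ D.y v ∧ ‖D.z v‖ ^ 2 ≤ D.x v * D.y v := Iff.rfl

theorem isOpen_openCone : IsOpen D.openCone :=
  (isOpen_lt continuous_const D.x.continuous).inter
    ((isOpen_lt continuous_const D.y.continuous).inter
      (isOpen_lt (D.z.continuous.norm.pow 2) (D.x.continuous.mul D.y.continuous)))

theorem interior_cone : interior (D.cone : Set V) = D.openCone := by
  refine Subset.antisymm (fun v hv => ?_)
    (interior_maximal (fun v hv => ⟨hv.1.le, hv.2.1.le, hv.2.2.le⟩) D.isOpen_openCone)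
  -- Subtracting a small multiple of `e + f` lowers both `x` and `y` and leaves `z` unchanged, so
  -- the weak inequalities become strict.
  obtain ⟨δ, hδ, h⟩ := exists_sub_smul_mem_cone hv (D.e + D.f)
  obtain ⟨h1, h2, h3⟩ := D.mem_cone.1 h
  simp only [map_sub, map_smul, map_add, D.x_e, D.x_f, D.y_e, D.y_f, D.z_e, D.z_f, smul_eq_mul,
    add_zero, zero_add, mul_one, smul_zero, sub_zero] at h1 h2 h3
  exact ⟨by linarith, by linarith, by nlinarith⟩

theorem salient_cone : (D.cone.toPointedCone : ConvexCone ℝ V).Salient := by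
  intro v hv h0 hn
  obtain ⟨h1, h2, h3⟩ := D.mem_cone.1 hv
  obtain ⟨h4, h5, -⟩ := D.mem_cone.1 hn
  rw [map_neg] at h4 h5
  have hx : D.x v = 0 := by linarith
  have hy : D.y v = 0 := by linarith
  refine h0 (D.eq_zero v hx hy ?_)
  rw [hx, zero_mul] at h3
  exact norm_eq_zero.1 (pow_eq_zero_iff two_ne_zero |>.1 (le_antisymm h3 (sq_nonneg _)))

/-- The domain of the quadratic cone. -/
def domain : Set (ℙ ℝ V) := {p | ∃ v ∈ D.openCone, Represents v p}

theorem planeCurve_mem (t : ℝ) : planeCurve D.e D.f t ∈ D.openCone := by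
  simp only [openCone, mem_ofPred_eq, planeCurve, map_add, map_smul, D.x_e, D.x_f, D.y_e, D.y_f,
    D.z_e, D.z_f, smul_eq_mul, mul_one, mul_zero, add_zero, zero_add, smul_zero, norm_zero]
  exact ⟨by positivity, by positivity, by rw [zero_pow two_ne_zero]; positivity⟩

theorem ne_zero_of_mem {v : V} (hv : v ∈ D.openCone) : v ≠ 0 := by
  rintro rfl
  simpa using hv.1

theorem smul_mem_openCone {v : V} (hv : v ∈ D.openCone) {c : ℝ} (hc : 0 < c) :
    c • v ∈ D.openCone := by
  rw [← interior_cone] at hv ⊢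
  exact smul_mem_interior_cone hv hc

theorem isProperConvexDomain : IsProperConvexDomain D.domain D.cone :=
  ⟨D.salient_cone, ⟨_, by rw [interior_cone]; exact D.planeCurve_mem 0⟩,
    fun p => by rw [interior_cone]; rfl⟩

/-- The first coordinate of the point of the plane of `e, f` to which `v` is moved by a parabolic
automorphism of the cone. -/
noncomputable def reducedX (v : V) : ℝ := D.x v - ‖D.z v‖ ^ 2 / D.y v

theorem reducedX_pos {v : V} (hv : v ∈ D.openCone) : 0 < D.reducedX v := by
  rw [reducedX, sub_pos, div_lt_iff₀ hv.2.1]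
  exact hv.2.2

/-- Half the logarithm of the slope of the reduced point. -/
noncomputable def height (v : V) : ℝ := 1 / 2 * (Real.log (D.y v) - Real.log (D.reducedX v))

/-- The potential of the lift defined by the function `g` of one variable. -/
noncomputable def potential (g : ℝ → ℝ) (v : V) : ℝ :=
  -(1 / 2) * Real.log (D.reducedX v) - 1 / 2 * Real.log (D.y v) + g (D.height v)

open Classical in
/-- The lift with a given potential. -/
noncomputable def lift (g : ℝ → ℝ) (p : ℙ ℝ V) : V :=
  if h : ∃ v ∈ D.openCone, Represents v p then Real.exp (D.potential g h.choose) • h.choose else 0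

theorem reducedX_smul {v : V} (hv : v ∈ D.openCone) {c : ℝ} (hc : 0 < c) :
    D.reducedX (c • v) = c * D.reducedX v := by
  have := hv.2.1
  simp only [reducedX, map_smul, smul_eq_mul, norm_smul, mul_pow, Real.norm_eq_abs, sq_abs]
  field_simp

theorem height_smul {v : V} (hv : v ∈ D.openCone) {c : ℝ} (hc : 0 < c) :
    D.height (c • v) = D.height v := by
  rw [height, D.reducedX_smul hv hc, map_smul, smul_eq_mul, Real.log_mul hc.ne' hv.2.1.ne',
    Real.log_mul hc.ne' (D.reducedX_pos hv).ne', height]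
  ring

theorem potential_smul (g : ℝ → ℝ) {v : V} (hv : v ∈ D.openCone) {c : ℝ} (hc : 0 < c) :
    D.potential g (c • v) = D.potential g v - Real.log c := by
  rw [potential, D.reducedX_smul hv hc, D.height_smul hv hc, map_smul, smul_eq_mul,
    Real.log_mul hc.ne' hv.2.1.ne', Real.log_mul hc.ne' (D.reducedX_pos hv).ne', potential]
  ring

theorem lift_eq (g : ℝ → ℝ) {v : V} (hv : v ∈ D.openCone) {p : ℙ ℝ V} (hp : Represents v p) :
    D.lift g p = Real.exp (D.potential g v) • v := by
  have h : ∃ v ∈ D.openCone, Represents v p := ⟨v, hv, hp⟩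
  rw [lift, dif_pos h]
  obtain ⟨hu, hup⟩ := h.choose_spec
  obtain ⟨c, hc0, hc⟩ := hp.exists_smul_eq hup
  rw [hc] at hu ⊢
  have hc1 : 0 < c := by
    have h1 := hu.1
    rw [map_smul, smul_eq_mul] at h1
    exact pos_of_mul_pos_left h1 hv.1.le
  rw [D.potential_smul g hv hc1, Real.exp_sub, Real.exp_log hc1, smul_smul,
    div_mul_cancel₀ _ hc0]

theorem contDiffOn_reducedX : ContDiffOn ℝ 3 D.reducedX D.openCone :=
  D.x.contDiff.contDiffOn.sub ((D.z.contDiff.norm_sq ℝ).contDiffOn.div D.y.contDiff.contDiffOn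
    fun _ hv => hv.2.1.ne')

theorem contDiffOn_height : ContDiffOn ℝ 3 D.height D.openCone :=
  contDiffOn_const.mul ((D.y.contDiff.contDiffOn.log fun _ hv => hv.2.1.ne').sub
    (D.contDiffOn_reducedX.log fun _ hv => (D.reducedX_pos hv).ne'))

theorem isLogPotential {g : ℝ → ℝ} (hg : ContDiff ℝ 3 g) :
    IsLogPotential D.openCone (D.lift g) (D.potential g) where
  isOpen := D.isOpen_openCone
  smul_mem _ hv _ hc := D.smul_mem_openCone hv hc
  ne_zero _ hv := D.ne_zero_of_mem hv
  contDiffOn := ((contDiffOn_const.mul (D.contDiffOn_reducedX.log fun _ hv =>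
    (D.reducedX_pos hv).ne')).sub (contDiffOn_const.mul
    (D.y.contDiff.contDiffOn.log fun _ hv => hv.2.1.ne'))).add
    (hg.comp_contDiffOn D.contDiffOn_height)
  apply_smul _ hv _ hc := D.potential_smul g hv hc
  pullback_eq v hv := by
    rw [pullback, dif_pos (D.ne_zero_of_mem hv)]
    exact D.lift_eq g hv ⟨_, rfl⟩

/-- The component of `w` at `v` along the fibres of `reducedX / y`, in vectorial coordinates. -/
noncomputable def fibreComponent (v w : V) : W := D.z w - (D.y w / D.y v) • D.z v

/-- The derivative of `reducedX`. -/
noncomputable def reducedXDeriv (v w : V) : ℝ :=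
  D.x w - D.y w * ‖D.z v‖ ^ 2 / D.y v ^ 2 - 2 * inner ℝ (D.z v) (D.fibreComponent v w) / D.y v

/-- The derivative of `height`. -/
noncomputable def heightDeriv (v w : V) : ℝ :=
  1 / 2 * (D.y w / D.y v - D.reducedXDeriv v w / D.reducedX v)

/-- Splitting `z` along the line into its multiple of `z v` and the fibre component separates the
quadratic term; the rest is affine in `t`. -/
theorem reducedX_line {v : V} (hv : v ∈ D.openCone) (w : V) {t : ℝ} (ht : 0 < D.y v + t * D.y w) :
    D.reducedX (v + t • w) = D.reducedX v + t * D.reducedXDeriv v w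
      - t ^ 2 * ‖D.fibreComponent v w‖ ^ 2 / (D.y v + t * D.y w) := by
  have hy := hv.2.1
  have h1 : D.z v + t • D.z w
      = ((D.y v + t * D.y w) / D.y v) • D.z v + t • D.fibreComponent v w := by
    rw [fibreComponent, add_div, div_self hy.ne', mul_div_assoc]
    module
  simp only [reducedX, reducedXDeriv, map_add, map_smul, smul_eq_mul]
  rw [h1, norm_add_sq_real, norm_smul, norm_smul, inner_smul_left, inner_smul_right, mul_pow,
    mul_pow, Real.norm_eq_abs, Real.norm_eq_abs, sq_abs, sq_abs]
  simp only [conj_trivial]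
  field_simp
  ring

theorem hasDerivAt_height {c : ℝ → V} {c' : V} {t : ℝ} (hc : HasDerivAt c c' t)
    (ht : c t ∈ D.openCone) :
    HasDerivAt (fun s => D.height (c s)) (D.heightDeriv (c t) c') t := by
  have hx := D.x.hasFDerivAt.comp_hasDerivAt t hc
  have hy := D.y.hasFDerivAt.comp_hasDerivAt t hc
  have hz := (D.z.hasFDerivAt.comp_hasDerivAt t hc).norm_sq
  have hX := hx.sub (hz.div hy ht.2.1.ne')
  have h1 := ((hy.log ht.2.1.ne').sub (hX.log (D.reducedX_pos ht).ne')).const_mul (1 / 2)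
  refine HasDerivAt.congr_deriv (f := fun s => D.height (c s)) h1 ?_
  have hX0 := D.reducedX_pos ht
  have hy0 := ht.2.1
  simp only [heightDeriv, Function.comp_apply, Pi.sub_apply, Pi.div_apply, reducedXDeriv,
    fibreComponent, inner_sub_right, inner_smul_right, real_inner_self_eq_norm_sq]
  change 1 / 2 * (_ - _ / D.reducedX (c t)) = _
  congr 3
  field_simp
  ring

end ConeCoordinates

namespace ConeCoordinates

open CentroAffine

variable {V W : Type*} [NormedAddCommGroup V] [NormedSpace ℝ V]
  [NormedAddCommGroup W] [InnerProductSpace ℝ W] (D : ConeCoordinates V W)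

section Lift

variable {μ : ℝ} {p p₁ p₂ : ℝ → ℝ}

/-- The height and fibre directions are orthogonal for the metric. The cubic form has a pure height
part, the one seen on the plane, and a mixed part linear in the height direction. -/
theorem metric_cubicForm (h : IsProfile μ p p₁ p₂) {v : V} (hv : v ∈ D.openCone) (w : V) :
    metric (D.lift (IsProfile.potential p)) v w w =
      D.heightDeriv v w ^ 2 * (p₁ (D.height v) + 1 - p (D.height v) ^ 2)
      + ‖D.fibreComponent v w‖ ^ 2 / (D.reducedX v * D.y v) * (1 + p (D.height v)) ∧
    cubicForm (D.lift (IsProfile.potential p)) v w =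
      D.heightDeriv v w ^ 3 * (p₂ (D.height v) - 6 * p (D.height v) * p₁ (D.height v)
        - 4 * p (D.height v) + 4 * p (D.height v) ^ 3)
      + 3 * D.heightDeriv v w * (‖D.fibreComponent v w‖ ^ 2 / (D.reducedX v * D.y v))
        * (p₁ (D.height v) - 2 * p (D.height v) - 2 * p (D.height v) ^ 2) := by
  have hy : ∀ᶠ t in 𝓝 (0 : ℝ), 0 < D.y v + t * D.y w := by
    have hc : Continuous fun t : ℝ => D.y v + t * D.y w := by fun_prop
    exact continuousAt_const.eventually_lt hc.continuousAt (by simpa using hv.2.1)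
  obtain ⟨l₁, l₂, l₃, h₁, h₂, h₃, h₄⟩ := exists_line_derivatives h.hasDerivAt_potential h.hasDerivAt
    h.hasDerivAt_deriv (D.reducedX_pos hv) hv.2.1 (A := D.reducedXDeriv v w) (b := D.y w)
    (η := ‖D.fibreComponent v w‖ ^ 2) (l := fun t => D.potential (IsProfile.potential p) (v + t • w))
    (by
      filter_upwards [hy] with t ht
      rw [potential, height, D.reducedX_line hv w ht, map_add, map_smul, smul_eq_mul])
  obtain ⟨h5, h6⟩ := h₄ _ _ _ rfl rfl rfl
  obtain ⟨h7, h8⟩ := (D.isLogPotential h.contDiff_potential).metric_cubicForm_of_line hv h₁ h₂ h₃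
  exact ⟨h7.trans h5, h8.trans h6⟩

theorem mem_span_of_eq_zero {v w : V} (hv : v ∈ D.openCone) (h1 : D.heightDeriv v w = 0)
    (h2 : D.fibreComponent v w = 0) : w ∈ Submodule.span ℝ {v} := by
  refine Submodule.mem_span_singleton.2 ⟨D.y w / D.y v, ?_⟩
  have hy := hv.2.1
  have hX := D.reducedX_pos hv
  have h3 : D.z w = (D.y w / D.y v) • D.z v := by rwa [fibreComponent, sub_eq_zero] at h2
  rw [← sub_eq_zero]
  refine D.eq_zero _ ?_ ?_ ?_
  · rw [heightDeriv, mul_eq_zero, or_iff_right (by norm_num), sub_eq_zero, eq_div_iff hX.ne',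
      reducedXDeriv, h2, inner_zero_right, reducedX] at h1
    rw [map_sub, map_smul, smul_eq_mul]
    field_simp at h1 ⊢
    have : D.y v * (D.y w * D.x v - D.y v * D.x w) = 0 := by linarith
    linarith [(mul_eq_zero.1 this).resolve_left hy.ne']
  · rw [map_sub, map_smul, smul_eq_mul, div_mul_cancel₀ _ hy.ne', sub_self]
  · rw [map_sub, map_smul, h3, sub_self]

theorem isConvexLift (h : IsProfile μ p p₁ p₂) :
    IsConvexLift D.domain D.cone (D.lift (IsProfile.potential p)) where
  mem_interior q hq := by
    obtain ⟨v, hv, hvq⟩ := hq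
    rw [D.lift_eq _ hv hvq, D.interior_cone]
    exact D.smul_mem_openCone hv (Real.exp_pos _)
  represents q hq := by
    obtain ⟨v, hv, hvq⟩ := hq
    rw [D.lift_eq _ hv hvq]
    exact hvq.smul (Real.exp_pos _).ne'
  contDiffOn := by
    rw [D.interior_cone]
    have hG := D.isLogPotential h.contDiff_potential
    exact (hG.contDiffOn.exp.smul contDiffOn_id).congr hG.pullback_eq
  metric_pos v hv w hw := by
    rw [D.interior_cone] at hv
    rw [(D.metric_cubicForm h hv w).1]
    have h1 := h.metric_pos (D.height v)
    have h2 : 0 < 1 + p (D.height v) := by linarith [h.neg_one_lt (D.height v)]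
    have h3 := mul_pos (D.reducedX_pos hv) hv.2.1
    by_cases h4 : D.heightDeriv v w = 0
    · have h5 : 0 < ‖D.fibreComponent v w‖ :=
        norm_pos_iff.2 fun h5 => hw (D.mem_span_of_eq_zero hv h4 h5)
      positivity
    · positivity

theorem cubicFormBound (h : IsProfile μ p p₁ p₂) (hμ : 1 < μ) :
    CubicFormBound D.cone (D.lift (IsProfile.potential p)) (μ - 1 / μ) := by
  intro v hv w
  rw [D.interior_cone] at hv
  obtain ⟨h1, h2⟩ := D.metric_cubicForm h hv w
  have h3 := mul_pos (D.reducedX_pos hv) hv.2.1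
  rw [h1, h2]
  exact h.cubic_le_all hμ _ _ (by positivity)

theorem height_planeCurve (t : ℝ) : D.height (planeCurve D.e D.f t) = t := by
  simp only [height, reducedX, planeCurve, map_add, map_smul, D.x_e, D.x_f, D.y_e, D.y_f,
    D.z_e, D.z_f, smul_eq_mul, mul_one, mul_zero, add_zero, zero_add, smul_zero, norm_zero,
    ne_eq, OfNat.ofNat_ne_zero, not_false_eq_true, zero_pow, zero_div, sub_zero, Real.log_exp]
  ring

theorem planeSpeed_eq (h : IsProfile μ p p₁ p₂) (t : ℝ) :
    planeSpeed (D.potential (IsProfile.potential p)) D.e D.f t = √(p₁ t + 1 - p t ^ 2) := by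
  have hv := D.planeCurve_mem t
  have h1 := (D.metric_cubicForm h hv (planeVelocity D.e D.f t)).1
  have h2 : D.fibreComponent (planeCurve D.e D.f t) (planeVelocity D.e D.f t) = 0 := by
    simp [fibreComponent, planeCurve, planeVelocity, D.z_e, D.z_f]
  have h3 : D.heightDeriv (planeCurve D.e D.f t) (planeVelocity D.e D.f t) = 1 := by
    have h4 := D.hasDerivAt_height (hasDerivAt_planeCurve t) hv
    simp only [height_planeCurve] at h4
    exact h4.unique (hasDerivAt_id t)
  rw [h2, h3, D.height_planeCurve] at h1
  rw [planeSpeed, ← (D.isLogPotential h.contDiff_potential).metric_eq hv, h1]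
  simp

/-- The length of a curve is bounded from below by the length of its projection to the plane. -/
theorem integral_height_le_curveLength (h : IsProfile μ p p₁ p₂) {c : ℝ → V} (hc : ContDiff ℝ 1 c)
    (hcU : ∀ t ∈ Icc (0 : ℝ) 1, c t ∈ D.openCone) :
    ∫ t in D.height (c 0)..D.height (c 1), √(p₁ t + 1 - p t ^ 2) ≤
      curveLength (D.lift (IsProfile.potential p)) c := by
  have hG := D.isLogPotential h.contDiff_potential
  have hcd : ∀ t, HasDerivAt c (deriv c t) t := fun t =>
    (hc.differentiable one_ne_zero t).hasDerivAt
  have hc' : Continuous (deriv c) := hc.continuous_deriv_one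
  have hu : uIcc (0 : ℝ) 1 = Icc 0 1 := uIcc_of_le zero_le_one
  have hS : Continuous fun t => √(p₁ t + 1 - p t ^ 2) := by
    have h1 : Continuous p₁ := continuous_iff_continuousAt.2 fun t =>
      (h.hasDerivAt_deriv t).continuousAt
    have h2 : Continuous p := h.contDiff.continuous
    fun_prop
  have hH : ∀ t ∈ Icc (0 : ℝ) 1,
      HasDerivAt (fun s => D.height (c s)) (D.heightDeriv (c t) (deriv c t)) t := fun t ht =>
    D.hasDerivAt_height (hcd t) (hcU t ht)
  have hHc : ContinuousOn (fun t => D.height (c t)) (Icc 0 1) := fun t ht =>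
    (hH t ht).continuousAt.continuousWithinAt
  have hH' : ContinuousOn (fun t => D.heightDeriv (c t) (deriv c t)) (Icc 0 1) := by
    have hX : ContinuousOn (fun t => D.reducedX (c t)) (Icc 0 1) :=
      D.contDiffOn_reducedX.continuousOn.comp hc.continuous.continuousOn hcU
    have hx := (D.x.continuous.comp hc').continuousOn (s := Icc (0 : ℝ) 1)
    have hy := (D.y.continuous.comp hc').continuousOn (s := Icc (0 : ℝ) 1)
    have hz := (D.z.continuous.comp hc').continuousOn (s := Icc (0 : ℝ) 1)
    have hy0 := (D.y.continuous.comp hc.continuous).continuousOn (s := Icc (0 : ℝ) 1)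
    have hz0 := (D.z.continuous.comp hc.continuous).continuousOn (s := Icc (0 : ℝ) 1)
    have hb := hy.div hy0 fun t ht => (hcU t ht).2.1.ne'
    exact continuousOn_const.mul (hb.sub (ContinuousOn.div
      ((hx.sub ((hy.mul (hz0.norm.pow 2)).div (hy0.pow 2)
        fun t ht => (pow_pos (hcU t ht).2.1 2).ne')).sub
        ((continuousOn_const.mul (hz0.inner (hz.sub (hb.smul hz0)))).div hy0
          fun t ht => (hcU t ht).2.1.ne')) hX fun t ht => (D.reducedX_pos (hcU t ht)).ne'))
  have hM : ContinuousOn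
      (fun t => √(metric (D.lift (IsProfile.potential p)) (c t) (deriv c t) (deriv c t)))
      (Icc 0 1) := by
    refine ContinuousOn.sqrt (ContinuousOn.congr (f := fun t =>
      potentialMetric (D.potential (IsProfile.potential p)) (c t) (deriv c t) (deriv c t)) ?_
      fun t ht => hG.metric_eq (hcU t ht) _ _)
    intro t ht
    have c1 : ContinuousAt (fun s => fderiv ℝ (D.potential (IsProfile.potential p)) (c s)) t :=
      ContinuousAt.comp (hG.contDiffAt_fderiv (hcU t ht)).continuousAt hc.continuous.continuousAt
    have c2 : ContinuousAt
        (fun s => fderiv ℝ (fderiv ℝ (D.potential (IsProfile.potential p))) (c s)) t :=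
      ContinuousAt.comp (hG.contDiffAt_fderiv_fderiv (hcU t ht)).continuousAt
        hc.continuous.continuousAt
    have c3 := hc'.continuousAt (x := t)
    exact (((c2.clm_apply c3).clm_apply c3).sub
      ((c1.clm_apply c3).mul (c1.clm_apply c3))).continuousWithinAt
  rw [← intervalIntegral.integral_comp_mul_deriv (f := fun t => D.height (c t))
    (fun t ht => hH t (hu ▸ ht)) (hu ▸ hH') hS, curveLength]
  refine intervalIntegral.integral_mono_on zero_le_one ?_ ?_ fun t ht => ?_
  · exact ((hS.comp_continuousOn hHc).mul hH').intervalIntegrable_of_Icc zero_le_one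
  · exact hM.intervalIntegrable_of_Icc zero_le_one
  · have hv := hcU t ht
    -- Dropping the nonnegative fibre part of the metric leaves the speed of the height.
    refine Real.le_sqrt_of_sq_le ?_
    rw [(D.metric_cubicForm h hv _).1, Function.comp_apply, mul_pow,
      Real.sq_sqrt (h.metric_pos _).le, mul_comm]
    have h3 := mul_pos (D.reducedX_pos hv) hv.2.1
    have h2 : 0 < 1 + p (D.height (c t)) := by linarith [h.neg_one_lt (D.height (c t))]
    have : 0 ≤ ‖D.fibreComponent (c t) (deriv c t)‖ ^ 2 / (D.reducedX (c t) * D.y (c t))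
      * (1 + p (D.height (c t))) := by positivity
    linarith

end Lift

/-- The point of the domain on `planeCurve` with a given parameter. -/
noncomputable def planePoint (t : ℝ) : ℙ ℝ V :=
  Projectivization.mk ℝ (planeCurve D.e D.f t) (D.ne_zero_of_mem (D.planeCurve_mem t))

theorem represents_planePoint (t : ℝ) : Represents (planeCurve D.e D.f t) (D.planePoint t) :=
  ⟨_, rfl⟩

theorem planePoint_mem (t : ℝ) : D.planePoint t ∈ D.domain :=
  ⟨_, D.planeCurve_mem t, D.represents_planePoint t⟩

theorem planePoint_ne {s t : ℝ} (h : s < t) : D.planePoint s ≠ D.planePoint t := by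
  intro heq
  have h1 := D.represents_planePoint s
  rw [heq] at h1
  obtain ⟨c, hc0, hc⟩ := (D.represents_planePoint t).exists_smul_eq h1
  have hc1 : 0 < c := by
    have h2 := congrArg D.x hc
    rw [map_smul, smul_eq_mul] at h2
    exact pos_of_mul_pos_left (h2 ▸ (D.planeCurve_mem s).1) (D.planeCurve_mem t).1.le
  have h2 := congrArg D.height hc
  rw [D.height_smul (D.planeCurve_mem t) hc1, D.height_planeCurve, D.height_planeCurve] at h2
  exact h.ne h2

theorem mul_eq_zero_of_mem_frontier {v : V} (hv : v ∈ frontier (D.cone : Set V))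
    (hz : D.z v = 0) : 0 ≤ D.x v ∧ 0 ≤ D.y v ∧ D.x v * D.y v = 0 := by
  rw [frontier, D.cone.isClosed.closure_eq, D.interior_cone] at hv
  obtain ⟨⟨hx, hy, h1⟩, h2⟩ := hv
  refine ⟨hx, hy, ?_⟩
  by_contra h3
  refine h2 ⟨hx.lt_of_ne' fun h4 => h3 (by rw [h4, zero_mul]),
    hy.lt_of_ne' fun h4 => h3 (by rw [h4, mul_zero]), ?_⟩
  rw [hz, norm_zero, zero_pow two_ne_zero]
  exact (mul_nonneg hx hy).lt_of_ne' h3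

/-- The boundary points in the definition are only known to exist. Lying in the plane of `e, f`,
each is on one of two boundary rays, and the order of the points decides which. -/
theorem hilbertDist_planePoint [Nontrivial V] {T : ℝ} (hT : 0 < T) :
    hilbertDist D.cone (D.planePoint (-T)) (D.planePoint T) = 2 * T := by
  obtain ⟨X, Y, A, B, s, t, hX, -, hY, -, hs, hst, ht, hA, hB, hAa, hBb, -, hd⟩ :=
    hilbertDist_spec D.isProperConvexDomain (D.planePoint_mem (-T)) (D.planePoint_mem T)
      (D.planePoint_ne (by linarith))
  obtain ⟨α, hα0, hα⟩ := (D.represents_planePoint (-T)).exists_smul_eq hAa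
  obtain ⟨β, hβ0, hβ⟩ := (D.represents_planePoint T).exists_smul_eq hBb
  rw [AffineMap.lineMap_apply_module] at hA hB
  rw [hα] at hA
  rw [hβ] at hB
  have zA := congrArg D.z hA
  have zB := congrArg D.z hB
  have xA := congrArg D.x hA
  have xB := congrArg D.x hB
  have yA := congrArg D.y hA
  have yB := congrArg D.y hB
  simp only [planeCurve, map_add, map_smul, D.x_e, D.x_f, D.y_e, D.y_f, D.z_e, D.z_f, smul_eq_mul,
    mul_one, mul_zero, add_zero, zero_add, smul_zero, neg_neg] at zA zB xA xB yA yB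
  have zX : (t - s) • D.z X = 0 := by
    have : (t - s) • D.z X = t • ((1 - s) • D.z X + s • D.z Y)
      - s • ((1 - t) • D.z X + t • D.z Y) := by module
    rw [this, ← zA, ← zB, smul_zero, smul_zero, sub_zero]
  have zY : (t - s) • D.z Y = 0 := by
    have : (t - s) • D.z Y = (1 - s) • ((1 - t) • D.z X + t • D.z Y)
      - (1 - t) • ((1 - s) • D.z X + s • D.z Y) := by module
    rw [this, ← zA, ← zB, smul_zero, smul_zero, sub_zero]
  obtain ⟨x1, y1, e1⟩ := D.mul_eq_zero_of_mem_frontier hX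
    ((smul_eq_zero.1 zX).resolve_left (sub_pos.2 hst).ne')
  obtain ⟨x2, y2, e2⟩ := D.mul_eq_zero_of_mem_frontier hY
    ((smul_eq_zero.1 zY).resolve_left (sub_pos.2 hst).ne')
  have hs1 : 0 < 1 - s := by linarith
  have ht1 : 0 < 1 - t := by linarith
  have ht0 : 0 < t := by linarith
  set E := Real.exp T with hE
  set F := Real.exp (-T) with hF
  have hE0 : 0 < E := Real.exp_pos _
  have hF0 : 0 < F := Real.exp_pos _
  have hEF : F < E := Real.exp_lt_exp.2 (by linarith)
  have lE : Real.log E = T := Real.log_exp _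
  have lF : Real.log F = -T := Real.log_exp _
  clear_value E F
  have hα1 : 0 < α := by
    refine hα0.lt_of_le' (nonneg_of_mul_nonneg_left ?_ hE0)
    rw [xA]; positivity
  have hβ1 : 0 < β := by
    refine hβ0.lt_of_le' (nonneg_of_mul_nonneg_left ?_ hF0)
    rw [xB]; positivity
  set u := D.x X
  set v := D.y X
  set u' := D.x Y
  set v' := D.y Y
  clear_value u v u' v'
  rcases mul_eq_zero.1 e1 with rfl | rfl
  -- Here `X` is on the ray of `f`, which would reverse the order of the two points.
  · exfalso
    rw [mul_zero, zero_add] at xA xB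
    have hu' : 0 < u' := pos_of_mul_pos_right (xA ▸ mul_pos hα1 hE0) hs.le
    obtain rfl := (mul_eq_zero.1 e2).resolve_left hu'.ne'
    rw [mul_zero, add_zero] at yA yB
    have hv : 0 < v := pos_of_mul_pos_right (yA ▸ mul_pos hα1 hF0) hs1.le
    have h1 : s * (1 - t) * (u' * v) < t * (1 - s) * (u' * v) := by
      gcongr ?_ * _
      linarith
    have h2 : s * (1 - t) * (u' * v) = α * β * E ^ 2 := by
      rw [show s * (1 - t) * (u' * v) = (s * u') * ((1 - t) * v) by ring, ← xA, ← yB]; ring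
    have h3 : t * (1 - s) * (u' * v) = α * β * F ^ 2 := by
      rw [show t * (1 - s) * (u' * v) = (t * u') * ((1 - s) * v) by ring, ← xB, ← yA]; ring
    rw [h2, h3] at h1
    have h4 : α * β * F ^ 2 < α * β * E ^ 2 := by gcongr
    linarith
  · rw [mul_zero, zero_add] at yA yB
    have hv' : 0 < v' := pos_of_mul_pos_right (yA ▸ mul_pos hα1 hF0) hs.le
    obtain rfl := (mul_eq_zero.1 e2).resolve_right hv'.ne'
    rw [mul_zero, add_zero] at xA xB
    have hu : 0 < u := pos_of_mul_pos_right (xA ▸ mul_pos hα1 hE0) hs1.le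
    have h1 : s / (1 - s) = F / E * (u / v') := by
      rw [div_mul_div_comm, div_eq_div_iff hs1.ne' (by positivity)]
      refine mul_left_cancel₀ hα0 ?_
      rw [show α * (s * (E * v')) = (α * E) * (s * v') by ring,
        show α * (F * u * (1 - s)) = (α * F) * ((1 - s) * u) by ring, ← xA, ← yA, mul_comm]
    have h2 : t / (1 - t) = E / F * (u / v') := by
      rw [div_mul_div_comm, div_eq_div_iff ht1.ne' (by positivity)]
      refine mul_left_cancel₀ hβ0 ?_
      rw [show β * (t * (F * v')) = (β * F) * (t * v') by ring,
        show β * (E * u * (1 - t)) = (β * E) * ((1 - t) * u) by ring, ← xB, ← yB, mul_comm]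
    rw [hd, h1, h2, Real.log_mul (by positivity) (by positivity),
      Real.log_mul (by positivity) (by positivity), Real.log_div hE0.ne' hF0.ne',
      Real.log_div hF0.ne' hE0.ne', lE, lF]
    ring

end ConeCoordinates

namespace ConeCoordinates

open CentroAffine

variable {V W : Type*} [NormedAddCommGroup V] [NormedSpace ℝ V]
  [NormedAddCommGroup W] [InnerProductSpace ℝ W] (D : ConeCoordinates V W)

theorem height_lift_planePoint (g : ℝ → ℝ) (t : ℝ) : D.height (D.lift g (D.planePoint t)) = t := by
  rw [D.lift_eq g (D.planeCurve_mem t) (D.represents_planePoint t),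
    D.height_smul (D.planeCurve_mem t) (Real.exp_pos _), D.height_planeCurve]

theorem segmentLength_planePoint {μ : ℝ} {p p₁ p₂ : ℝ → ℝ} (h : IsProfile μ p p₁ p₂) {s t : ℝ}
    (hst : s < t) :
    segmentLength (D.lift (IsProfile.potential p)) (D.planePoint s) (D.planePoint t) =
      ∫ r in s..t, √(p₁ r + 1 - p r ^ 2) := by
  set g := IsProfile.potential p
  set k : ℝ → ℝ := fun r => Real.exp (D.potential g (planeCurve D.e D.f r)) with hk
  have hk0 : ∀ r, 0 < k r := fun r => Real.exp_pos _
  have hf : ∀ r, D.lift g (D.planePoint r)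
      = (k r * Real.exp (-r)) • D.e + (k r * Real.exp r) • D.f := fun r => by
    rw [D.lift_eq g (D.planeCurve_mem r) (D.represents_planePoint r), planeCurve, smul_add,
      smul_smul, smul_smul]
    rfl
  have hlog : ∀ r, 1 / 2 * Real.log (k r * Real.exp r / (k r * Real.exp (-r))) = r := fun r => by
    rw [mul_div_mul_left _ _ (hk0 r).ne', Real.log_div (Real.exp_ne_zero _) (Real.exp_ne_zero _),
      Real.log_exp, Real.log_exp]
    ring
  have hlt : k s * Real.exp s * (k t * Real.exp (-t)) < k t * Real.exp t * (k s * Real.exp (-s)) := by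
    have h1 : Real.exp s * Real.exp (-t) < Real.exp t * Real.exp (-s) := by
      rw [← Real.exp_add, ← Real.exp_add]
      exact Real.exp_lt_exp.2 (by linarith)
    calc _ = k s * k t * (Real.exp s * Real.exp (-t)) := by ring
      _ < k s * k t * (Real.exp t * Real.exp (-s)) :=
        mul_lt_mul_of_pos_left h1 (mul_pos (hk0 s) (hk0 t))
      _ = _ := by ring
  have h1 := (D.isLogPotential h.contDiff_potential).segmentLength_eq D.planeCurve_mem
    (mul_pos (hk0 s) (Real.exp_pos _)) (mul_pos (hk0 s) (Real.exp_pos _))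
    (mul_pos (hk0 t) (Real.exp_pos _)) (mul_pos (hk0 t) (Real.exp_pos _)) hlt (hf s) (hf t)
  rw [hlog, hlog] at h1
  rw [h1]
  exact intervalIntegral.integral_congr fun r _ => D.planeSpeed_eq h r

theorem geodesicDist_planePoint {μ : ℝ} {p p₁ p₂ : ℝ → ℝ} (h : IsProfile μ p p₁ p₂) {s t : ℝ}
    (hst : s < t) :
    geodesicDist D.cone (D.lift (IsProfile.potential p)) (D.planePoint s) (D.planePoint t) =
      segmentLength (D.lift (IsProfile.potential p)) (D.planePoint s) (D.planePoint t) := by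
  have hs := (D.isConvexLift h).mem_interior _ (D.planePoint_mem s)
  have ht := (D.isConvexLift h).mem_interior _ (D.planePoint_mem t)
  refine le_antisymm (geodesicDist_le_segmentLength hs ht) (le_csInf ?_ ?_)
  · refine ⟨_, fun r => AffineMap.lineMap (D.lift (IsProfile.potential p) (D.planePoint s))
      (D.lift (IsProfile.potential p) (D.planePoint t)) r, ?_, ?_, by simp, by simp, rfl⟩
    · simp only [AffineMap.lineMap_apply_module]
      fun_prop
    · exact fun r hr => D.cone.convex.interior.lineMap_mem hs ht hr
  · rintro _ ⟨c, hc, hcU, hc0, hc1, rfl⟩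
    have h1 := D.integral_height_le_curveLength h hc (by rwa [D.interior_cone] at hcU)
    rwa [hc0, hc1, D.height_lift_planePoint, D.height_lift_planePoint,
      ← D.segmentLength_planePoint h hst] at h1

/-- Lifts of the quadratic cone on which the bound on the length of segments is almost attained. -/
theorem exists_lift_lengthBound_lt [Nontrivial V] {μ d ε : ℝ} (hμ : 1 < μ) (hd : 0 < d)
    (hε : 0 < ε) :
    ∃ f : ℙ ℝ V → V, IsConvexLift D.domain D.cone f ∧ CubicFormBound D.cone f (μ - 1 / μ) ∧
      ∃ a ∈ D.domain, ∃ b ∈ D.domain, a ≠ b ∧ hilbertDist D.cone a b = d ∧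
        geodesicDist D.cone f a b = segmentLength f a b ∧
        lengthBound μ d - ε < segmentLength f a b := by
  -- Half of `ε` pays for lowering `μ`, the other half for the smoothing, which costs at most `ε /
  -- (2d)` per unit of time.
  obtain ⟨μ', hμ', hlt, hbound⟩ := exists_lengthBound_gt hμ hd (half_pos hε)
  have hT : 0 < d / 2 := half_pos hd
  obtain ⟨p, q, hw, hint⟩ := exists_isWeakTrajectoryAt hμ' hT
  obtain ⟨r, r₁, r₂, hr, hle⟩ := exists_isProfile hμ' hlt (η := ε / (2 * d)) (by positivity) hw
  refine ⟨D.lift (IsProfile.potential r), D.isConvexLift hr, D.cubicFormBound hr hμ,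
    D.planePoint (-(d / 2)), D.planePoint_mem _, D.planePoint (d / 2), D.planePoint_mem _,
    D.planePoint_ne (by linarith), by rw [D.hilbertDist_planePoint hT]; ring,
    D.geodesicDist_planePoint hr (by linarith), ?_⟩
  rw [D.segmentLength_planePoint hr (by linarith)]
  have hq : Continuous q := continuous_iff_continuousAt.2 fun t => (hw t).continuousAt
  have hS : Continuous fun t => √(r₁ t + 1 - r t ^ 2) := by
    have h1 : Continuous r₁ := continuous_iff_continuousAt.2 fun t =>
      (hr.hasDerivAt_deriv t).continuousAt
    have h2 : Continuous r := hr.contDiff.continuous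
    fun_prop
  have h1 : ∫ t in -(d / 2)..d / 2, (q t - ε / (2 * d)) ≤
      ∫ t in -(d / 2)..d / 2, √(r₁ t + 1 - r t ^ 2) :=
    intervalIntegral.integral_mono (by linarith)
      ((hq.sub continuous_const).intervalIntegrable _ _) (hS.intervalIntegrable _ _) hle
  rw [intervalIntegral.integral_sub (hq.intervalIntegrable _ _)
    (continuous_const.intervalIntegrable _ _), hint, intervalIntegral.integral_const,
    smul_eq_mul, show (d / 2 - -(d / 2)) * (ε / (2 * d)) = ε / 2 by field_simp; ring,
    show 2 * (d / 2) = d by ring] at h1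
  linarith

/-- The first and last coordinate of a Euclidean space, and the projection to the others. -/
noncomputable def euclidean {n : ℕ} (hn : 1 ≤ n) :
    ConeCoordinates (EuclideanSpace ℝ (Fin (n + 1))) (EuclideanSpace ℝ (Fin (n + 1))) where
  x := EuclideanSpace.proj 0
  y := EuclideanSpace.proj (Fin.last n)
  -- The third coordinate takes values in the whole space, with first and last entry removed; for `n
  -- = 1` it is zero.
  z := ContinuousLinearMap.id ℝ _
    - (EuclideanSpace.proj 0 : _ →L[ℝ] ℝ).smulRight (EuclideanSpace.single 0 1)
    - (EuclideanSpace.proj (Fin.last n) : _ →L[ℝ] ℝ).smulRight (EuclideanSpace.single (Fin.last n) 1)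
  e := EuclideanSpace.single 0 1
  f := EuclideanSpace.single (Fin.last n) 1
  x_e := by simp
  y_e := by
    have : Fin.last n ≠ 0 := by simp [Fin.ext_iff]; omega
    simp [this]
  z_e := by
    have : Fin.last n ≠ 0 := by simp [Fin.ext_iff]; omega
    simp [this]
  x_f := by
    have : (0 : Fin (n + 1)) ≠ Fin.last n := by simp [Fin.ext_iff]; omega
    simp [this]
  y_f := by simp
  z_f := by
    have : (0 : Fin (n + 1)) ≠ Fin.last n := by simp [Fin.ext_iff]; omega
    simp [this]
  eq_zero v h1 h2 h3 := by
    simpa [h1, h2, show v.ofLp 0 = 0 from h1, show v.ofLp (Fin.last n) = 0 from h2] using h3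

end ConeCoordinates

theorem theorem2 (n : ℕ) (hn : 1 ≤ n) (γ : ℝ) (hγ : 0 < γ) :
    -- the inequalities
    (∀ (Ω : Set (ℙ ℝ (EuclideanSpace ℝ (Fin (n + 1)))))
        (K : ProperCone ℝ (EuclideanSpace ℝ (Fin (n + 1))))
        (f : ℙ ℝ (EuclideanSpace ℝ (Fin (n + 1))) → EuclideanSpace ℝ (Fin (n + 1))),
        CentroAffine.IsProperConvexDomain Ω K → CentroAffine.IsConvexLift Ω K f →
        CentroAffine.CubicFormBound K f γ →
        ∀ a ∈ Ω, ∀ b ∈ Ω, a ≠ b →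
          CentroAffine.geodesicDist K f a b ≤ CentroAffine.segmentLength f a b ∧
          CentroAffine.segmentLength f a b
            < lengthBound (muOf γ) (CentroAffine.hilbertDist K a b) ∧
          lengthBound (muOf γ) (CentroAffine.hilbertDist K a b)
            < CentroAffine.hilbertDist K a b + additiveConst (muOf γ)) ∧
    -- the first two inequalities cannot be improved, for any value `d` of the Hilbert distance
    (∀ d : ℝ, 0 < d → ∀ ε : ℝ, 0 < ε →
      ∃ (Ω : Set (ℙ ℝ (EuclideanSpace ℝ (Fin (n + 1)))))
        (K : ProperCone ℝ (EuclideanSpace ℝ (Fin (n + 1))))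
        (f : ℙ ℝ (EuclideanSpace ℝ (Fin (n + 1))) → EuclideanSpace ℝ (Fin (n + 1))),
        CentroAffine.IsProperConvexDomain Ω K ∧ CentroAffine.IsConvexLift Ω K f ∧
        CentroAffine.CubicFormBound K f γ ∧
        ∃ a ∈ Ω, ∃ b ∈ Ω, a ≠ b ∧
          CentroAffine.hilbertDist K a b = d ∧
          CentroAffine.geodesicDist K f a b = CentroAffine.segmentLength f a b ∧
          lengthBound (muOf γ) d - ε < CentroAffine.segmentLength f a b) ∧
    -- the last inequality cannot be improved
    Tendsto (fun d : ℝ => lengthBound (muOf γ) d - d) atTop (𝓝 (additiveConst (muOf γ))) := by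
  have hμ := one_lt_muOf hγ
  refine ⟨fun Ω K f hΩ hf hC a ha b hb hab => ?_, fun d hd ε hε => ?_, tendsto_lengthBound_sub hμ⟩
  · rw [← muOf_sub_one_div hγ] at hC
    obtain ⟨h1, h2⟩ := CentroAffine.segmentLength_lt_lengthBound hμ hΩ hf hC ha hb hab
    exact ⟨CentroAffine.geodesicDist_le_segmentLength (hf.mem_interior a ha) (hf.mem_interior b hb),
      h2, lengthBound_lt_add_additiveConst hμ h1⟩
  · let D := ConeCoordinates.euclidean hn
    obtain ⟨f, hf, hC, h⟩ := D.exists_lift_lengthBound_lt hμ hd hε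
    rw [muOf_sub_one_div hγ] at hC
    exact ⟨D.domain, D.cone, f, D.isProperConvexDomain, hf, hC, h⟩
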